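/- Let $\mathbb K\in\{\mathbb R,\mathbb C\}$ be the scalar field and $p\in(1,\infty]$. A finite dimensional decomposition (FDD) of a Banach space $Z$ is a sequence $\mathsf H=(H_n)_{n\ge 1}$ of nonzero finite dimensional subspaces such that each $z\in Z$ has a unique norm convergent expansion $z=\sum_{n=1}^\infty z_n$ with $z_n\in H_n$; put $P^{\mathsf H}_n z=z_n$ and $Iz=\sum_{n\in I}z_n$ for $I\subset\mathbb N$ finite or cofinite. The FDD is bimonotone if $\|Iz\|\le\|z\|$ for every $z\in Z$ and every finite or cofinite interval $I$ of $\mathbb N$. Let $c_{00}(\mathsf H)$ be the algebraic linear span of $\bigcup_n H_n$. For $z\in c_{00}(\mathsf H)$ put $$[z]_{\wedge,p}=\inf\Big\{\big\|(\|J_iz\|_Z)_{i=1}^\infty\big\|_{\ell_p}:\ J_i\ne\varnothing,\ J_1<J_2<\cdots,\ \mathbb N=\bigcup_{i}J_i\Big\},$$ $$\|z\|_{\wedge,p}=\inf\Big\{\sum_{k=1}^m[z_k]_{\wedge,p}:\ m\in\mathbb N,\ z_k\in c_{00}(\mathsf H),\ z=\sum_{k=1}^m z_k\Big\},$$ and let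 $Z_{\wedge,p}(\mathsf H)$ be the completion of $(c_{00}(\mathsf H),\|\cdot\|_{\wedge,p})$. Let $\mathsf J=(J_n)_{n=1}^\infty$ be a sequence of nonzero finite dimensional normed spaces over $\mathbb K$ that is dense, for the Banach–Mazur distance $d(E,F)=\inf\{\|T\|\|T^{-1}\|:\ T:E\to F \text{ a linear isomorphism}\}$, in the class of all nonzero finite dimensional normed spaces (for every such $F$ and every $c>1$ there is an $n$ with $d(F,J_n)<c$), and suppose that $\dim J_n=1$ for infinitely many $n$. Call a Banach space $W$ a space $W(\mathsf J)$ if it has a bimonotone FDD whose $n$-th term is isometric to $J_n$ for all $n$ (again written $\mathsf J$) and if, for every Banach space $Z$ with a bimonotone FDD $\mathsf H$, there are $m_1<m_2<\cdots$ and a bounded linear operator $A:Z\to W$ such that $A(H_n)=J_{m_n}$ for all $n$, $\frac12\|z\|\le\|Az\|\le2\|z\|$ for all $z\in Z$, $A(Z)=\overline{\operatorname{span}}\{J_{m_n}:n\in\mathbb N\}$, and $w\mapsto\sum_{n=1}^\infty P^{\mathsf J}_{m_n}w$ is a well-defined operator of norm at most $1$ on $W$. Then a space $W(\mathsf J)$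 exists, and for every space $W=W(\mathsf J)$: (1) if $p<\infty$, then $\ell_p(W_{\wedge,p}(\mathsf J))$ is linearly isomorphic to $W_{\wedge,p}(\mathsf J)$; (2) if $p=\infty$, then $c_0(W_{\wedge,\infty}(\mathsf J))$ is linearly isomorphic to $W_{\wedge,\infty}(\mathsf J)$. Here $\ell_p(X)$ (respectively $c_0(X)$) is the Banach space of sequences in $X$ with $p$-summable norms (respectively tending to $0$), with its usual norm, and an isomorphism is a linear homeomorphism. -/

import Mathlib

open Filter Topology
open scoped ENNReal ZeroAtInfty

universe u v

noncomputable section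

/-! ### Finite dimensional decompositions -/

section FDD

variable {𝕜 : Type v} [RCLike 𝕜] {Z : Type u} [NormedAddCommGroup Z] [NormedSpace 𝕜 Z]

/-- `z = ∑ₙ xₙ`, a norm convergent series in the order of the index, with `xₙ ∈ Hₙ`. -/
def HasExpansion (H : ℕ → Submodule 𝕜 Z) (x : ∀ n, H n) (z : Z) : Prop :=
  Tendsto (fun N : ℕ => ∑ n ∈ Finset.range N, (x n : Z)) atTop (𝓝 z)

/-- `H` is a finite dimensional decomposition (FDD) of `Z`: the `Hₙ` are nonzero and finite
dimensional, and each vector has a unique expansion along `H`. -/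
structure IsFDD (H : ℕ → Submodule 𝕜 Z) : Prop where
  finiteDimensional : ∀ n, FiniteDimensional 𝕜 (H n)
  ne_bot : ∀ n, H n ≠ ⊥
  existsUnique : ∀ z : Z, ∃! x : ∀ n, H n, HasExpansion H x z

/-- The canonical projection `Pₙ` of an FDD: the `n`-th term of the expansion of `z`. -/
def IsFDD.proj {H : ℕ → Submodule 𝕜 Z} (h : IsFDD H) (n : ℕ) (z : Z) : Z :=
  ((h.existsUnique z).choose n : Z)

/-- An FDD is bimonotone if the projections onto all intervals of `ℕ`, finite or cofinite, have
norm at most `1` (so that their supremum, the projection constant, is `1`). -/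
structure IsBimonotoneFDD (H : ℕ → Submodule 𝕜 Z) : Prop extends IsFDD H where
  norm_Ico_le : ∀ (a b : ℕ) (z : Z), ‖∑ n ∈ Finset.Ico a b, toIsFDD.proj n z‖ ≤ ‖z‖
  norm_Ici_le : ∀ (a : ℕ) (z : Z), ‖z - ∑ n ∈ Finset.range a, toIsFDD.proj n z‖ ≤ ‖z‖

end FDD

/-! ### Press down norms -/

/-- Sequences of nonempty sets `J₀ < J₁ < ⋯` with union `ℕ` (they are necessarily finite
intervals). -/
structure IntervalPartition where
  part : ℕ → Finset ℕ
  nonempty : ∀ i, (part i).Nonempty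
  lt : ∀ i, ∀ a ∈ part i, ∀ b ∈ part (i + 1), a < b
  cover : ∀ n, ∃ i, n ∈ part i

instance : Nonempty IntervalPartition :=
  ⟨{ part := fun i => {i}
     nonempty := fun i => Finset.singleton_nonempty i
     lt := fun i a ha b hb => by
       rw [Finset.mem_singleton] at ha hb
       omega
     cover := fun n => ⟨n, Finset.mem_singleton_self n⟩ }⟩

/-- The `ℓ_p`-norm of a sequence (used for `p ≥ 1` and finitely supported sequences of nonnegative
reals). -/
def seqLpNorm (p : ℝ≥0∞) (f : ℕ → ℝ) : ℝ :=
  if p = ∞ then ⨆ i, |f i| else (∑' i, |f i| ^ p.toReal) ^ (1 / p.toReal)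

theorem seqLpNorm_nonneg (p : ℝ≥0∞) (f : ℕ → ℝ) : 0 ≤ seqLpNorm p f := by
  unfold seqLpNorm
  split_ifs
  · exact Real.iSup_nonneg fun i => abs_nonneg _
  · exact Real.rpow_nonneg (tsum_nonneg fun i => Real.rpow_nonneg (abs_nonneg _) _) _

theorem seqLpNorm_smul (p : ℝ≥0∞) (hp : 1 ≤ p) (c : ℝ) (hc : 0 ≤ c) (f : ℕ → ℝ) :
    seqLpNorm p (fun i => c * f i) = c * seqLpNorm p f := by
  unfold seqLpNorm
  split_ifs with h
  · rw [Real.mul_iSup_of_nonneg hc]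
    simp only [abs_mul, abs_of_nonneg hc]
  · have hp0 : p.toReal ≠ 0 := by
      have h0 : p ≠ 0 := fun h0 => by simp [h0] at hp
      exact ENNReal.toReal_ne_zero.2 ⟨h0, h⟩
    simp only [abs_mul, abs_of_nonneg hc, Real.mul_rpow hc (abs_nonneg _)]
    rw [tsum_mul_left, Real.mul_rpow (Real.rpow_nonneg hc _)
      (tsum_nonneg fun i => Real.rpow_nonneg (abs_nonneg _) _), ← Real.rpow_mul hc,
      mul_one_div_cancel hp0, Real.rpow_one]

section PressDown

variable {𝕜 : Type v} [RCLike 𝕜] {Z : Type u} [NormedAddCommGroup Z] [NormedSpace 𝕜 Z]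

/-- `[z]_{∧,p}`, the infimum over all interval partitions `(Jᵢ)` of the `ℓ_p`-norm of
`(‖Jᵢ z‖)ᵢ`; here `c₀₀(H)` is the algebraic direct sum of the `Hₙ`. -/
def pressDownBracket (p : ℝ≥0∞) (H : ℕ → Submodule 𝕜 Z) (z : Π₀ n, H n) : ℝ :=
  ⨅ J : IntervalPartition, seqLpNorm p (fun i => ‖∑ n ∈ J.part i, (z n : Z)‖)

/-- `‖z‖_{∧,p}`, the infimum of `∑ᵢ [zᵢ]_{∧,p}` over the finite decompositions `z = ∑ᵢ zᵢ` in
`c₀₀(H)`. -/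
def pressDownNorm (p : ℝ≥0∞) (H : ℕ → Submodule 𝕜 Z) (z : Π₀ n, H n) : ℝ :=
  sInf {r : ℝ | ∃ (m : ℕ) (w : Fin m → Π₀ n, H n),
    z = ∑ i, w i ∧ r = ∑ i, pressDownBracket p H (w i)}

theorem pressDownBracket_nonneg (p : ℝ≥0∞) (H : ℕ → Submodule 𝕜 Z) (z : Π₀ n, H n) :
    0 ≤ pressDownBracket p H z :=
  Real.iInf_nonneg fun _ => seqLpNorm_nonneg _ _

theorem pressDownBracket_smul (p : ℝ≥0∞) (hp : 1 ≤ p) (H : ℕ → Submodule 𝕜 Z) (c : 𝕜)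
    (z : Π₀ n, H n) : pressDownBracket p H (c • z) = ‖c‖ * pressDownBracket p H z := by
  unfold pressDownBracket
  rw [Real.mul_iInf_of_nonneg (norm_nonneg c)]
  refine congrArg _ (funext fun J => ?_)
  rw [← seqLpNorm_smul p hp ‖c‖ (norm_nonneg c)]
  refine congrArg _ (funext fun i => ?_)
  rw [← norm_smul, Finset.smul_sum]
  simp

theorem pressDownNorm_bddBelow (p : ℝ≥0∞) (H : ℕ → Submodule 𝕜 Z) (z : Π₀ n, H n) :
    BddBelow {r : ℝ | ∃ (m : ℕ) (w : Fin m → Π₀ n, H n),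
      z = ∑ i, w i ∧ r = ∑ i, pressDownBracket p H (w i)} := by
  refine ⟨0, ?_⟩
  rintro r ⟨m, w, -, rfl⟩
  exact Finset.sum_nonneg fun i _ => pressDownBracket_nonneg p H _

theorem pressDownNorm_nonempty (p : ℝ≥0∞) (H : ℕ → Submodule 𝕜 Z) (z : Π₀ n, H n) :
    {r : ℝ | ∃ (m : ℕ) (w : Fin m → Π₀ n, H n),
      z = ∑ i, w i ∧ r = ∑ i, pressDownBracket p H (w i)}.Nonempty :=
  ⟨_, 1, fun _ => z, by simp, rfl⟩

theorem pressDownNorm_zero (p : ℝ≥0∞) (H : ℕ → Submodule 𝕜 Z) :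
    pressDownNorm p H 0 = 0 := by
  refine le_antisymm (csInf_le (pressDownNorm_bddBelow p H 0) ⟨0, Fin.elim0, by simp, by simp⟩)
    (le_csInf (pressDownNorm_nonempty p H 0) ?_)
  rintro r ⟨m, w, -, rfl⟩
  exact Finset.sum_nonneg fun i _ => pressDownBracket_nonneg p H _

theorem pressDownNorm_add_le (p : ℝ≥0∞) (H : ℕ → Submodule 𝕜 Z) (x y : Π₀ n, H n) :
    pressDownNorm p H (x + y) ≤ pressDownNorm p H x + pressDownNorm p H y := by
  refine le_of_forall_pos_le_add fun ε hε => ?_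
  obtain ⟨_, ⟨m, w, hx, rfl⟩, hr⟩ := exists_lt_of_csInf_lt (pressDownNorm_nonempty p H x)
    (lt_add_of_pos_right (pressDownNorm p H x) (half_pos hε))
  obtain ⟨_, ⟨k, t, hy, rfl⟩, hs⟩ := exists_lt_of_csInf_lt (pressDownNorm_nonempty p H y)
    (lt_add_of_pos_right (pressDownNorm p H y) (half_pos hε))
  refine (csInf_le (pressDownNorm_bddBelow p H (x + y))
    ⟨m + k, Fin.append w t, ?_, rfl⟩).trans ?_
  · rw [Fin.sum_univ_add]
    simp only [Fin.append_left, Fin.append_right]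
    rw [hx, hy]
  · rw [Fin.sum_univ_add]
    simp only [Fin.append_left, Fin.append_right]
    linarith

theorem pressDownNorm_smul_le (p : ℝ≥0∞) (hp : 1 ≤ p) (H : ℕ → Submodule 𝕜 Z) (c : 𝕜)
    (x : Π₀ n, H n) : pressDownNorm p H (c • x) ≤ ‖c‖ * pressDownNorm p H x := by
  by_cases hc : ‖c‖ = 0
  · rw [norm_eq_zero] at hc
    have h0 : (0 : 𝕜) • x = 0 := DFinsupp.ext fun n => zero_smul 𝕜 (x n)
    rw [hc, h0, pressDownNorm_zero, norm_zero, zero_mul]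
  · have hc' : 0 < ‖c‖ := lt_of_le_of_ne (norm_nonneg c) (Ne.symm hc)
    rw [← div_le_iff₀' hc']
    refine le_csInf (pressDownNorm_nonempty p H x) ?_
    rintro r ⟨m, w, hx, rfl⟩
    rw [div_le_iff₀' hc', Finset.mul_sum]
    refine csInf_le (pressDownNorm_bddBelow p H (c • x)) ⟨m, fun i => c • w i, ?_, ?_⟩
    · rw [hx, Finset.smul_sum]
    · simp only [pressDownBracket_smul p hp]

/-- `‖·‖_{∧,p}` as a seminorm on `c₀₀(H)`. (It is a norm if `H` is an FDD.) -/
def pressDownSeminorm (p : ℝ≥0∞) [Fact (1 ≤ p)] (H : ℕ → Submodule 𝕜 Z) :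
    Seminorm 𝕜 (Π₀ n, H n) :=
  Seminorm.ofSMulLE (pressDownNorm p H) (pressDownNorm_zero p H) (pressDownNorm_add_le p H)
    (pressDownNorm_smul_le p Fact.out H)

/-- `c₀₀(H)`, to be normed by `‖·‖_{∧,p}`. -/
@[nolint unusedArguments]
def PressDownPre (_p : ℝ≥0∞) (H : ℕ → Submodule 𝕜 Z) : Type u := Π₀ n, H n

instance (p : ℝ≥0∞) (H : ℕ → Submodule 𝕜 Z) : AddCommGroup (PressDownPre p H) :=
  inferInstanceAs (AddCommGroup (Π₀ n, H n))

instance (p : ℝ≥0∞) (H : ℕ → Submodule 𝕜 Z) : Module 𝕜 (PressDownPre p H) :=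
  inferInstanceAs (Module 𝕜 (Π₀ n, H n))

instance (p : ℝ≥0∞) [Fact (1 ≤ p)] (H : ℕ → Submodule 𝕜 Z) :
    SeminormedAddCommGroup (PressDownPre p H) :=
  (show AddGroupSeminorm (PressDownPre p H) from
    (pressDownSeminorm p H).toAddGroupSeminorm).toSeminormedAddCommGroup

instance (p : ℝ≥0∞) [Fact (1 ≤ p)] (H : ℕ → Submodule 𝕜 Z) :
    NormedSpace 𝕜 (PressDownPre p H) where
  norm_smul_le c x := pressDownNorm_smul_le p Fact.out H c x

/-- The Banach space `Z_{∧,p}(H)`: the completion of `c₀₀(H)` for `‖·‖_{∧,p}`. -/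
abbrev PressDown (p : ℝ≥0∞) [Fact (1 ≤ p)] (H : ℕ → Submodule 𝕜 Z) : Type u :=
  UniformSpace.Completion (PressDownPre p H)

theorem PressDownPre.norm_def (p : ℝ≥0∞) [Fact (1 ≤ p)] (H : ℕ → Submodule 𝕜 Z)
    (z : PressDownPre p H) : ‖z‖ = pressDownNorm p H z := rfl

end PressDown

/-! ### Banach-Mazur density and complementably universal spaces -/

/-- The (multiplicative) Banach-Mazur distance, `∞` for non-isomorphic spaces. -/
def banachMazurDist (𝕜 : Type v) [RCLike 𝕜] (E F : Type u) [NormedAddCommGroup E]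
    [NormedSpace 𝕜 E] [NormedAddCommGroup F] [NormedSpace 𝕜 F] : ℝ≥0∞ :=
  ⨅ T : E ≃L[𝕜] F, ENNReal.ofReal (‖(T : E →L[𝕜] F)‖ * ‖(T.symm : F →L[𝕜] E)‖)

/-- The sequence `J` is dense, for the Banach-Mazur distance, in the class of all nonzero finite
dimensional normed spaces. -/
def IsBanachMazurDense (𝕜 : Type v) [RCLike 𝕜] (J : ℕ → Type u) [∀ n, NormedAddCommGroup (J n)]
    [∀ n, NormedSpace 𝕜 (J n)] : Prop :=
  ∀ (F : Type u) [NormedAddCommGroup F] [NormedSpace 𝕜 F] [FiniteDimensional 𝕜 F] [Nontrivial F],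
    ∀ c : ℝ≥0∞, 1 < c → ∃ n, banachMazurDist 𝕜 F (J n) < c

/-- The Banach space `W`, with its sequence `K` of subspaces, is a space `W(J)`: `K` is a
bimonotone FDD of `W` whose terms are (isometric copies of) the spaces `Jₙ`, and each Banach space
`Z` with a bimonotone FDD `H` embeds with constants `1/2`, `2` onto the closed span of some
subsequence of `K`, each `Hₙ` being mapped onto the `n`-th term of the subsequence; this closed
span is `1`-complemented in `W` by the projection `w ↦ ∑ₙ P_{mₙ} w`. -/
structure IsSchechtmanSpace (𝕜 : Type v) [RCLike 𝕜] (J : ℕ → Type u)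
    [∀ n, NormedAddCommGroup (J n)] [∀ n, NormedSpace 𝕜 (J n)]
    {W : Type u} [NormedAddCommGroup W] [NormedSpace 𝕜 W] [CompleteSpace W]
    (K : ℕ → Submodule 𝕜 W) : Prop where
  isBimonotoneFDD : IsBimonotoneFDD K
  isometric : ∀ n, Nonempty (J n ≃ₗᵢ[𝕜] K n)
  universal : ∀ (Z : Type u) [NormedAddCommGroup Z] [NormedSpace 𝕜 Z] [CompleteSpace Z]
    (H : ℕ → Submodule 𝕜 Z), IsBimonotoneFDD H →
    ∃ (m : ℕ → ℕ) (A : Z →L[𝕜] W) (P : W →L[𝕜] W), StrictMono m ∧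
      (∀ n, (H n).map (A : Z →ₗ[𝕜] W) = K (m n)) ∧
      (∀ z, 1 / 2 * ‖z‖ ≤ ‖A z‖ ∧ ‖A z‖ ≤ 2 * ‖z‖) ∧
      LinearMap.range (A : Z →ₗ[𝕜] W) = (⨆ n, K (m n)).topologicalClosure ∧
      ‖P‖ ≤ 1 ∧
      ∀ w, Tendsto (fun N : ℕ => ∑ n ∈ Finset.range N, isBimonotoneFDD.toIsFDD.proj (m n) w)
        atTop (𝓝 (P w))

end

/-!
**Existence.** The space `W(J)` is the completion of the direct sum of the `Jₙ` for the supremum of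
the norms of the branches of a tree of finite bimonotone sums. A branch (`Branch`) is extended by an
index `n` with the norm `max (q x) ‖xₙ‖ (s (x, T xₙ))`, where `T` is a contraction from `Jₙ` to a
term of the sequence and `s` is a bimonotone seminorm that increases neither the norm of the branch
nor the norm of the new space (`Branch.IsAdmissible`). Countably many seminorms `s` are dense
among all these (`Branch.exists_dense_isAdmissible`), and each term of `J` is approximated, in the
Banach-Mazur distance, by infinitely many terms (`IsBanachMazurDense.frequently_isClose`), so
the instructions "extend this branch by a copy of that space with that seminorm, up to this
precision" can all be carried out with distinct indices `n` (`TreeData.exists_rich`). On the sum of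
a branch no other branch has a larger norm (`TreeData.q_le_q_of_supp`), and restricting to a branch
is a contraction. A Banach space `Z` with a bimonotone FDD `H` follows an infinite branch: if a
branch is `C`-isomorphic to the sum of `H₀, …, Hₖ₋₁`, then the norm of `Z` divided by `C` is
admissible, and an approximation of it yields an extension that is isomorphic to the sum of
`H₀, …, Hₖ` with a constant slightly larger than `C` (`IsStage.exists_succ`).

**The isomorphism.** Write `X` for the press down space of `W` and `Z` for `ℓ_p(X)` or `c₀(X)`. By
Pełczyński's decomposition method (`nonempty_equiv_of_complemented`) it is enough that `Z` be
isomorphic to a complemented subspace of `X`, since `Z ≃ Z × Z` and `Z ≃ X × Z`. The terms of `W`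
form a bimonotone FDD of `X` with an upper `p`-estimate for pairs of successive blocks
(`pressDownNorm_add_le_pairLpNorm`); enumerating the terms of all copies of `X` gives an FDD of `Z`
with the same properties (`IsSeqSum.hasUpperEstimate`). Universality embeds `Z` in `W` by an
operator `A` with a projection `P` onto the image. The operator `A⁻¹ P : W → Z` remains bounded for
the press down norm, because of the upper estimate in `Z`
(`norm_le_pressDownNorm_of_hasUpperEstimate`), so it extends to `X → Z`. It is a left inverse of the
composition of `A` with the canonical operator `W → X`.
-/

/-! ### Finite dimensional decompositions -/

section FDD

variable {𝕜 : Type v} [RCLike 𝕜] {Z : Type u} [NormedAddCommGroup Z] [NormedSpace 𝕜 Z]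
  {H : ℕ → Submodule 𝕜 Z}

theorem IsFDD.proj_eq_of_hasExpansion (h : IsFDD H) {x : ∀ n, H n} {z : Z}
    (hx : HasExpansion H x z) (n : ℕ) : h.proj n z = x n := by
  have := (h.existsUnique z).unique (h.existsUnique z).choose_spec.1 hx
  rw [IsFDD.proj, this]

theorem IsFDD.proj_mem (h : IsFDD H) (n : ℕ) (z : Z) : h.proj n z ∈ H n :=
  ((h.existsUnique z).choose n).2

theorem IsFDD.tendsto_sum_proj (h : IsFDD H) (z : Z) :
    Tendsto (fun N : ℕ => ∑ n ∈ Finset.range N, h.proj n z) atTop (𝓝 z) :=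
  (h.existsUnique z).choose_spec.1

theorem IsFDD.proj_eq_of_tendsto (h : IsFDD H) {x : ℕ → Z} (hx : ∀ n, x n ∈ H n) {z : Z}
    (hz : Tendsto (fun N : ℕ => ∑ n ∈ Finset.range N, x n) atTop (𝓝 z)) (n : ℕ) :
    h.proj n z = x n :=
  h.proj_eq_of_hasExpansion (x := fun n => ⟨x n, hx n⟩) hz n

theorem IsFDD.proj_add (h : IsFDD H) (n : ℕ) (y z : Z) :
    h.proj n (y + z) = h.proj n y + h.proj n z := by
  refine h.proj_eq_of_tendsto (x := fun n => h.proj n y + h.proj n z)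
    (fun n => (H n).add_mem (h.proj_mem n y) (h.proj_mem n z)) ?_ n
  simp only [Finset.sum_add_distrib]
  exact (h.tendsto_sum_proj y).add (h.tendsto_sum_proj z)

theorem IsFDD.proj_smul (h : IsFDD H) (n : ℕ) (c : 𝕜) (z : Z) :
    h.proj n (c • z) = c • h.proj n z := by
  refine h.proj_eq_of_tendsto (x := fun n => c • h.proj n z)
    (fun n => (H n).smul_mem c (h.proj_mem n z)) ?_ n
  simp only [← Finset.smul_sum]
  exact (h.tendsto_sum_proj z).const_smul c

theorem IsFDD.proj_sum (h : IsFDD H) (s : Finset ℕ) (y : ℕ → Z) (hy : ∀ n, y n ∈ H n) (n : ℕ) :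
    h.proj n (∑ k ∈ s, y k) = if n ∈ s then y n else 0 := by
  refine h.proj_eq_of_tendsto (x := fun n => if n ∈ s then y n else 0) ?_ ?_ n
  · intro n
    split_ifs
    exacts [hy n, (H n).zero_mem]
  · obtain ⟨M, hM⟩ := s.exists_nat_subset_range
    refine tendsto_const_nhds.congr' ?_
    filter_upwards [eventually_ge_atTop M] with N hN
    rw [← Finset.sum_filter]
    refine Finset.sum_congr ?_ fun _ _ => rfl
    ext k
    simp only [Finset.mem_filter, Finset.mem_range]
    exact ⟨fun hk => ⟨(Finset.mem_range.1 (hM hk)).trans_le hN, hk⟩, fun hk => hk.2⟩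

theorem IsFDD.proj_of_mem (h : IsFDD H) {m : ℕ} {z : Z} (hz : z ∈ H m) (n : ℕ) :
    h.proj n z = if n = m then z else 0 := by
  classical
  have := h.proj_sum {m} (Function.update 0 m z) (fun k => ?_) n
  · rw [Finset.sum_singleton, Function.update_self] at this
    rw [this]
    by_cases hn : n = m
    · subst hn; simp
    · simp [hn]
  · by_cases hk : k = m
    · subst hk; simpa using hz
    · simp [hk]

theorem IsBimonotoneFDD.norm_proj_le (h : IsBimonotoneFDD H) (n : ℕ) (z : Z) :
    ‖h.toIsFDD.proj n z‖ ≤ ‖z‖ := by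
  simpa using h.norm_Ico_le n (n + 1) z

/-- The canonical projections of a bimonotone FDD, as continuous linear maps. -/
noncomputable def IsBimonotoneFDD.projL (h : IsBimonotoneFDD H) (n : ℕ) : Z →L[𝕜] Z :=
  LinearMap.mkContinuous
    { toFun := h.toIsFDD.proj n
      map_add' := h.toIsFDD.proj_add n
      map_smul' := h.toIsFDD.proj_smul n } 1 (fun z => by simpa using h.norm_proj_le n z)

@[simp]
theorem IsBimonotoneFDD.projL_apply (h : IsBimonotoneFDD H) (n : ℕ) (z : Z) :
    h.projL n z = h.toIsFDD.proj n z := rfl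

/-- Uniformly bounded operators that converge pointwise on a dense subspace converge pointwise. -/
theorem tendsto_of_dense_of_bounded {Y : Type*} [NormedAddCommGroup Y] [NormedSpace 𝕜 Y]
    (T : ℕ → Z →L[𝕜] Y) (L : Z →L[𝕜] Y) {C : ℝ} (hT : ∀ N z, ‖T N z‖ ≤ C * ‖z‖)
    {S : Submodule 𝕜 Z} (hS : S.topologicalClosure = ⊤)
    (h : ∀ z ∈ S, Tendsto (fun N => T N z) atTop (𝓝 (L z))) (z : Z) :
    Tendsto (fun N => T N z) atTop (𝓝 (L z)) := by
  rw [Metric.tendsto_atTop]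
  intro ε hε
  have hz : z ∈ closure (S : Set Z) := by
    rw [← Submodule.topologicalClosure_coe, hS]; trivial
  have hK : 0 < |C| + ‖L‖ + 1 := by positivity
  obtain ⟨y, hy, hyz⟩ := Metric.mem_closure_iff.1 hz (ε / 2 / (|C| + ‖L‖ + 1)) (by positivity)
  obtain ⟨N, hN⟩ := Metric.tendsto_atTop.1 (h y hy) (ε / 2) (half_pos hε)
  refine ⟨N, fun n hn => ?_⟩
  have h1 := hN n hn
  rw [dist_eq_norm] at h1 hyz ⊢
  have h2 : T n z - L z = T n (z - y) + (T n y - L y) - L (z - y) := by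
    simp only [map_sub]; abel
  have h3 : ‖T n (z - y)‖ ≤ |C| * ‖z - y‖ :=
    (hT n _).trans (mul_le_mul_of_nonneg_right (le_abs_self C) (norm_nonneg _))
  have h4 := L.le_opNorm (z - y)
  have h5 : (|C| + ‖L‖ + 1) * ‖z - y‖ < ε / 2 := by
    rw [lt_div_iff₀ hK] at hyz
    linarith
  rw [h2]
  have h6 := norm_sub_le (T n (z - y) + (T n y - L y)) (L (z - y))
  have h7 := norm_add_le (T n (z - y)) (T n y - L y)
  have := norm_nonneg (z - y)
  nlinarith

theorem IsFDD.topologicalClosure_iSup (h : IsFDD H) : (⨆ n, H n).topologicalClosure = ⊤ := by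
  refine eq_top_iff.2 fun z _ => ?_
  refine mem_closure_of_tendsto (h.tendsto_sum_proj z) (Eventually.of_forall fun N => ?_)
  exact Submodule.sum_mem _ fun n _ => (le_iSup H n) (h.proj_mem n z)

/-- `P` is a system of projections onto the subspaces `Hₙ` that is biorthogonal, is contractive on
intervals, and belongs to subspaces with dense span. -/
structure IsBimonotoneSystem (H : ℕ → Submodule 𝕜 Z) (P : ℕ → Z →L[𝕜] Z) : Prop where
  mem : ∀ n z, P n z ∈ H n
  apply_of_mem : ∀ n, ∀ z ∈ H n, P n z = z
  apply_of_mem_ne : ∀ m n, m ≠ n → ∀ z ∈ H m, P n z = 0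
  norm_Ico_le : ∀ (a b : ℕ) (z : Z), ‖∑ n ∈ Finset.Ico a b, P n z‖ ≤ ‖z‖
  dense : (⨆ n, H n).topologicalClosure = ⊤

theorem IsBimonotoneFDD.isBimonotoneSystem (h : IsBimonotoneFDD H) :
    IsBimonotoneSystem H h.projL where
  mem n z := h.proj_mem n z
  apply_of_mem n z hz := by simp [h.proj_of_mem hz]
  apply_of_mem_ne m n hmn z hz := by simp [h.proj_of_mem hz, hmn.symm]
  norm_Ico_le a b z := h.norm_Ico_le a b z
  dense := h.topologicalClosure_iSup

variable {P : ℕ → Z →L[𝕜] Z}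

theorem IsBimonotoneSystem.tendsto_sum (h : IsBimonotoneSystem H P) (z : Z) :
    Tendsto (fun N : ℕ => ∑ n ∈ Finset.range N, P n z) atTop (𝓝 z) := by
  have := tendsto_of_dense_of_bounded (fun N => ∑ n ∈ Finset.range N, P n)
    (ContinuousLinearMap.id 𝕜 Z) (C := 1) (fun N z => ?_) h.dense (fun z hz => ?_) z
  · simpa only [FunLike.coe_sum, Finset.sum_apply, ContinuousLinearMap.coe_id',
      id_eq] using this
  · simpa only [FunLike.coe_sum, Finset.sum_apply, Finset.range_eq_Ico,
      one_mul] using h.norm_Ico_le 0 N z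
  · simp only [ContinuousLinearMap.coe_id', id_eq]
    induction hz using Submodule.iSup_induction' with
    | mem m x hx =>
      refine tendsto_const_nhds.congr' ?_
      filter_upwards [eventually_gt_atTop m] with N hN
      rw [FunLike.coe_sum, Finset.sum_apply, Finset.sum_eq_single m, h.apply_of_mem m x hx]
      · exact fun k _ hk => h.apply_of_mem_ne m k hk.symm x hx
      · exact fun hm => (hm (Finset.mem_range.2 hN)).elim
    | zero => simp
    | add x y _ _ hx hy => simpa only [map_add] using hx.add hy

theorem IsBimonotoneSystem.proj_eq (h : IsBimonotoneSystem H P) (hF : IsFDD H) (n : ℕ) (z : Z) :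
    hF.proj n z = P n z :=
  hF.proj_eq_of_tendsto (x := fun n => P n z) (fun n => h.mem n z) (h.tendsto_sum z) n

/-- Nonzero finite dimensional subspaces that admit a bimonotone system of projections form a
bimonotone FDD. -/
theorem IsBimonotoneSystem.isBimonotoneFDD (h : IsBimonotoneSystem H P)
    (hf : ∀ n, FiniteDimensional 𝕜 (H n)) (hb : ∀ n, H n ≠ ⊥) : IsBimonotoneFDD H := by
  have ht := h.tendsto_sum
  have hF : IsFDD H := by
    refine ⟨hf, hb, fun z => ⟨fun n => ⟨P n z, h.mem n z⟩, ht z, fun x hx => ?_⟩⟩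
    funext n
    apply Subtype.ext
    have h1 : Tendsto (fun N : ℕ => P n (∑ k ∈ Finset.range N, (x k : Z))) atTop (𝓝 (P n z)) :=
      ((P n).continuous.tendsto z).comp hx
    have h2 : Tendsto (fun N : ℕ => P n (∑ k ∈ Finset.range N, (x k : Z))) atTop
        (𝓝 (x n : Z)) := by
      refine tendsto_const_nhds.congr' ?_
      filter_upwards [eventually_gt_atTop n] with N hN
      rw [map_sum, Finset.sum_eq_single n, h.apply_of_mem n _ (x n).2]
      · exact fun k _ hk => h.apply_of_mem_ne k n hk _ (x k).2
      · exact fun hm => (hm (Finset.mem_range.2 hN)).elim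
    exact tendsto_nhds_unique h2 h1
  have hP := h.proj_eq hF
  refine ⟨hF, fun a b z => ?_, fun a z => ?_⟩
  · simpa only [hP] using h.norm_Ico_le a b z
  · simp only [hP]
    refine le_of_tendsto ((ht z).sub_const _).norm ?_
    filter_upwards [eventually_ge_atTop a] with N hN
    rw [← Finset.sum_Ico_eq_sub _ hN]
    exact h.norm_Ico_le a N z

end FDD

/-! ### Decompositions of completions -/

section Completion

variable {𝕜 : Type v} [RCLike 𝕜]

theorem denseRange_toComplL {E : Type*} [SeminormedAddCommGroup E] [NormedSpace 𝕜 E] :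
    DenseRange (UniformSpace.Completion.toComplL : E →L[𝕜] UniformSpace.Completion E) :=
  UniformSpace.Completion.denseRange_coe

theorem isUniformInducing_toComplL {E : Type*} [SeminormedAddCommGroup E] [NormedSpace 𝕜 E] :
    IsUniformInducing (UniformSpace.Completion.toComplL : E →L[𝕜] UniformSpace.Completion E) :=
  UniformSpace.Completion.isUniformInducing_coe E

/-- The extension of a continuous linear map to the completion of its domain. -/
noncomputable def extendCompl {E F : Type*} [SeminormedAddCommGroup E] [NormedSpace 𝕜 E]
    [NormedAddCommGroup F] [NormedSpace 𝕜 F] [CompleteSpace F] (f : E →L[𝕜] F) :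
    UniformSpace.Completion E →L[𝕜] F :=
  f.extend UniformSpace.Completion.toComplL

@[simp]
theorem extendCompl_coe {E F : Type*} [SeminormedAddCommGroup E] [NormedSpace 𝕜 E]
    [NormedAddCommGroup F] [NormedSpace 𝕜 F] [CompleteSpace F] (f : E →L[𝕜] F) (x : E) :
    extendCompl f (x : UniformSpace.Completion E) = f x :=
  ContinuousLinearMap.extend_eq f denseRange_toComplL isUniformInducing_toComplL x

/-! The norm of the direct sum of the `Gₙ` is given by a linear bijection `φ` to a seminormed
space. -/

variable {G : ℕ → Type u} [∀ n, NormedAddCommGroup (G n)] [∀ n, NormedSpace 𝕜 (G n)]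
  {E : Type u} [SeminormedAddCommGroup E] [NormedSpace 𝕜 E] (φ : (Π₀ n, G n) ≃ₗ[𝕜] E)

theorem DFinsupp.filter_singleton_eq (n : ℕ) (x : Π₀ n, G n) :
    x.filter (· ∈ Finset.Ico n (n + 1)) = DFinsupp.single n (x n) := by
  ext k
  rw [DFinsupp.filter_apply, DFinsupp.single_apply]
  by_cases h : n = k
  · subst h; simp
  · rw [dif_neg h, if_neg]
    simp only [Finset.mem_Ico]
    omega

theorem DFinsupp.sum_single_apply (s : Finset ℕ) (x : Π₀ n, G n) :
    ∑ n ∈ s, DFinsupp.single n (x n) = x.filter (· ∈ s) := by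
  ext k
  rw [DFinsupp.finsetSum_apply, DFinsupp.filter_apply]
  split_ifs with h
  · rw [Finset.sum_eq_single k _ (fun hk => (hk h).elim), DFinsupp.single_eq_same]
    exact fun m _ hm => DFinsupp.single_eq_of_ne hm.symm
  · refine Finset.sum_eq_zero fun m hm => DFinsupp.single_eq_of_ne ?_
    rintro rfl
    exact h hm

theorem DFinsupp.exists_filter_range_eq (x : Π₀ n, G n) :
    ∃ M : ℕ, ∀ N ≥ M, x.filter (· ∈ Finset.range N) = x := by
  classical
  obtain ⟨M, hM⟩ := x.support.exists_nat_subset_range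
  refine ⟨M, fun N hN => ?_⟩
  ext k
  rw [DFinsupp.filter_apply]
  split_ifs with h
  · rfl
  · by_contra hk
    exact h (Finset.mem_range.2 ((Finset.mem_range.1
      (hM (DFinsupp.mem_support_iff.2 (Ne.symm hk)))).trans_le hN))

/-- The image of the `n`-th term of a direct sum in the completion of the sum. -/
noncomputable def complTerm (n : ℕ) : Submodule 𝕜 (UniformSpace.Completion E) :=
  LinearMap.range ((UniformSpace.Completion.toComplL : E →L[𝕜] _).toLinearMap ∘ₗ
    φ.toLinearMap ∘ₗ DFinsupp.lsingle n)

/-- The norm of `E`, transported to the direct sum, is monotone with respect to restriction to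
intervals. -/
def IsIntervalMonotone : Prop :=
  ∀ (a b : ℕ) (x : Π₀ n, G n), ‖φ (x.filter (· ∈ Finset.Ico a b))‖ ≤ ‖φ x‖

variable {φ}

theorem IsIntervalMonotone.norm_single_le (hφ : IsIntervalMonotone φ) (n : ℕ) (x : Π₀ n, G n) :
    ‖φ (DFinsupp.single n (x n))‖ ≤ ‖φ x‖ := by
  rw [← DFinsupp.filter_singleton_eq]
  exact hφ n (n + 1) x

/-- The projection of `E` onto the `n`-th term. -/
noncomputable def IsIntervalMonotone.coordE (hφ : IsIntervalMonotone φ) (n : ℕ) : E →L[𝕜] E :=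
  LinearMap.mkContinuous
    (φ.toLinearMap ∘ₗ DFinsupp.lsingle n ∘ₗ DFinsupp.lapply n ∘ₗ φ.symm.toLinearMap) 1
    (fun x => by simpa using hφ.norm_single_le n (φ.symm x))

theorem IsIntervalMonotone.coordE_apply (hφ : IsIntervalMonotone φ) (n : ℕ) (x : Π₀ n, G n) :
    hφ.coordE n (φ x) = φ (DFinsupp.single n (x n)) := by
  simp [IsIntervalMonotone.coordE]

/-- The projection of the completion of `E` onto the `n`-th term. -/
noncomputable def IsIntervalMonotone.complProj (hφ : IsIntervalMonotone φ) (n : ℕ) :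
    UniformSpace.Completion E →L[𝕜] UniformSpace.Completion E :=
  extendCompl (UniformSpace.Completion.toComplL.comp (hφ.coordE n))

theorem IsIntervalMonotone.complProj_coe (hφ : IsIntervalMonotone φ) (n : ℕ) (x : Π₀ n, G n) :
    hφ.complProj n (φ x : E) = (φ (DFinsupp.single n (x n)) : E) := by
  rw [IsIntervalMonotone.complProj, extendCompl_coe, ContinuousLinearMap.comp_apply,
    hφ.coordE_apply]
  rfl

theorem IsIntervalMonotone.sum_complProj_coe (hφ : IsIntervalMonotone φ) (s : Finset ℕ)
    (x : Π₀ n, G n) :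
    ∑ n ∈ s, hφ.complProj n (φ x : E) = (φ (x.filter (· ∈ s)) : E) := by
  simp only [hφ.complProj_coe]
  rw [← DFinsupp.sum_single_apply, map_sum]
  exact (map_sum (UniformSpace.Completion.toComplL : E →L[𝕜] _) _ _).symm

theorem mem_complTerm {n : ℕ} {z : UniformSpace.Completion E} :
    z ∈ complTerm φ n ↔ ∃ v : G n, z = (φ (DFinsupp.single n v) : E) := by
  simp [complTerm, LinearMap.mem_range, eq_comm]

theorem complTerm_dense : (⨆ n, complTerm φ n).topologicalClosure = ⊤ := by
  refine eq_top_iff.2 fun z _ => ?_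
  have hz : z ∈ closure (Set.range ((↑) : E → UniformSpace.Completion E)) :=
    UniformSpace.Completion.denseRange_coe z
  refine closure_mono ?_ hz
  rintro _ ⟨x, rfl⟩
  obtain ⟨x, rfl⟩ := φ.surjective x
  obtain ⟨M, hM⟩ := DFinsupp.exists_filter_range_eq x
  rw [← hM M le_rfl, ← DFinsupp.sum_single_apply, map_sum]
  have := map_sum (UniformSpace.Completion.toComplL : E →L[𝕜] _)
    (fun n => φ (DFinsupp.single n (x n))) (Finset.range M)
  rw [UniformSpace.Completion.coe_toComplL] at this
  rw [this]
  exact Submodule.sum_mem _ fun n _ => (le_iSup (complTerm φ) n) (mem_complTerm.2 ⟨x n, rfl⟩)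

instance finiteDimensional_complTerm [∀ n, FiniteDimensional 𝕜 (G n)] (n : ℕ) :
    FiniteDimensional 𝕜 (complTerm φ n) :=
  LinearMap.finiteDimensional_range _

theorem IsIntervalMonotone.isBimonotoneSystem [∀ n, FiniteDimensional 𝕜 (G n)]
    (hφ : IsIntervalMonotone φ) :
    IsBimonotoneSystem (complTerm φ) hφ.complProj where
  mem n z := by
    induction z using UniformSpace.Completion.induction_on with
    | hp =>
      exact (Submodule.closed_of_finiteDimensional (complTerm φ n)).preimage
        (hφ.complProj n).continuous
    | ih x =>
      obtain ⟨x, rfl⟩ := φ.surjective x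
      exact mem_complTerm.2 ⟨x n, hφ.complProj_coe n x⟩
  apply_of_mem n z hz := by
    obtain ⟨v, rfl⟩ := mem_complTerm.1 hz
    rw [hφ.complProj_coe, DFinsupp.single_eq_same]
  apply_of_mem_ne m n hmn z hz := by
    obtain ⟨v, rfl⟩ := mem_complTerm.1 hz
    rw [hφ.complProj_coe, DFinsupp.single_eq_of_ne hmn.symm, DFinsupp.single_zero, map_zero,
      UniformSpace.Completion.coe_zero]
  norm_Ico_le a b z := by
    induction z using UniformSpace.Completion.induction_on with
    | hp => exact isClosed_le (by fun_prop) continuous_norm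
    | ih x =>
      obtain ⟨x, rfl⟩ := φ.surjective x
      rw [hφ.sum_complProj_coe, UniformSpace.Completion.norm_coe, UniformSpace.Completion.norm_coe]
      exact hφ a b x
  dense := complTerm_dense

theorem complTerm_ne_bot [∀ n, Nontrivial (G n)]
    (h0 : ∀ n (v : G n), ‖φ (DFinsupp.single n v)‖ = 0 → v = 0) (n : ℕ) :
    complTerm φ n ≠ ⊥ := by
  obtain ⟨v, hv⟩ := exists_ne (0 : G n)
  intro h
  have : ((φ (DFinsupp.single n v) : E) : UniformSpace.Completion E) ∈ complTerm φ n :=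
    mem_complTerm.2 ⟨v, rfl⟩
  rw [h, Submodule.mem_bot] at this
  apply hv
  apply h0
  rw [← UniformSpace.Completion.norm_coe, this, norm_zero]

end Completion

/-! ### Sequence norms -/

section SeqNorm

/-- The `ℓ_p`-norm of a pair of nonnegative reals. -/
noncomputable def pairLpNorm (p : ℝ≥0∞) (a b : ℝ) : ℝ :=
  if p = ∞ then max a b else (a ^ p.toReal + b ^ p.toReal) ^ (1 / p.toReal)

variable {p : ℝ≥0∞}

theorem toReal_pos_of_one_le [hp : Fact (1 ≤ p)] (h : p ≠ ∞) : 0 < p.toReal :=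
  ENNReal.toReal_pos (zero_lt_one.trans_le hp.out).ne' h

theorem pairLpNorm_mono [Fact (1 ≤ p)] {a b a' b' : ℝ} (ha : 0 ≤ a) (hb : 0 ≤ b) (haa : a ≤ a')
    (hbb : b ≤ b') : pairLpNorm p a b ≤ pairLpNorm p a' b' := by
  unfold pairLpNorm
  split_ifs with h
  · exact max_le_max haa hbb
  · have := toReal_pos_of_one_le h
    gcongr

theorem pairLpNorm_smul [Fact (1 ≤ p)] {a b c : ℝ} (ha : 0 ≤ a) (hb : 0 ≤ b) (hc : 0 ≤ c) :
    pairLpNorm p (c * a) (c * b) = c * pairLpNorm p a b := by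
  unfold pairLpNorm
  split_ifs with h
  · exact (mul_max_of_nonneg a b hc).symm
  · have := toReal_pos_of_one_le h
    rw [Real.mul_rpow hc ha, Real.mul_rpow hc hb, ← mul_add,
      Real.mul_rpow (by positivity) (by positivity), ← Real.rpow_mul hc,
      mul_one_div_cancel this.ne', Real.rpow_one]

theorem pairLpNorm_zero_left [Fact (1 ≤ p)] {b : ℝ} (hb : 0 ≤ b) : pairLpNorm p 0 b = b := by
  unfold pairLpNorm
  split_ifs with h
  · exact max_eq_right hb
  · have := toReal_pos_of_one_le h
    rw [Real.zero_rpow this.ne', zero_add, ← Real.rpow_mul hb, mul_one_div_cancel this.ne',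
      Real.rpow_one]

theorem continuous_pairLpNorm [Fact (1 ≤ p)] :
    Continuous (fun x : ℝ × ℝ => pairLpNorm p x.1 x.2) := by
  unfold pairLpNorm
  split_ifs with h
  · fun_prop
  · have := toReal_pos_of_one_le h
    exact ((continuous_fst.rpow_const fun _ => Or.inr this.le).add
      (continuous_snd.rpow_const fun _ => Or.inr this.le)).rpow_const
        fun _ => Or.inr (by positivity)

theorem summable_abs_rpow (hp : p.toReal ≠ 0) {f : ℕ → ℝ} {N : ℕ} (hf : ∀ i ≥ N, f i = 0) :
    Summable fun i => |f i| ^ p.toReal := by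
  refine summable_of_ne_finset_zero (s := Finset.range N) fun i hi => ?_
  rw [hf i (by simpa using hi), abs_zero, Real.zero_rpow hp]

theorem bddAbove_range_abs {f : ℕ → ℝ} {N : ℕ} (hf : ∀ i ≥ N, f i = 0) :
    BddAbove (Set.range fun i => |f i|) := by
  refine ⟨∑ i ∈ Finset.range N, |f i|, ?_⟩
  rintro _ ⟨i, rfl⟩
  by_cases hi : i < N
  · exact Finset.single_le_sum (f := fun i => |f i|) (fun _ _ => abs_nonneg _)
      (Finset.mem_range.2 hi)
  · simp only [hf i (not_lt.1 hi), abs_zero]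
    exact Finset.sum_nonneg fun _ _ => abs_nonneg _

theorem seqLpNorm_rpow [Fact (1 ≤ p)] (h : p ≠ ∞) (f : ℕ → ℝ) :
    seqLpNorm p f ^ p.toReal = ∑' i, |f i| ^ p.toReal := by
  rw [seqLpNorm, if_neg h, ← Real.rpow_mul (tsum_nonneg fun i => by positivity),
    one_div_mul_cancel (toReal_pos_of_one_le h).ne', Real.rpow_one]

theorem seqLpNorm_mono [Fact (1 ≤ p)] {f g : ℕ → ℝ} {N : ℕ} (hg : ∀ i ≥ N, g i = 0)
    (hfg : ∀ i, |f i| ≤ |g i|) : seqLpNorm p f ≤ seqLpNorm p g := by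
  unfold seqLpNorm
  split_ifs with h
  · exact ciSup_mono (bddAbove_range_abs hg) hfg
  · have hp := toReal_pos_of_one_le h
    have hf : ∀ i ≥ N, f i = 0 := fun i hi => by simpa [hg i hi] using hfg i
    refine Real.rpow_le_rpow (tsum_nonneg fun i => by positivity) ?_ (by positivity)
    exact (summable_abs_rpow hp.ne' hf).tsum_le_tsum
      (fun i => Real.rpow_le_rpow (abs_nonneg _) (hfg i) hp.le) (summable_abs_rpow hp.ne' hg)

theorem seqLpNorm_eq_of_forall_ne_zero [Fact (1 ≤ p)] {f : ℕ → ℝ} (hf : ∀ i ≠ 0, f i = 0) :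
    seqLpNorm p f = |f 0| := by
  unfold seqLpNorm
  split_ifs with h
  · refine le_antisymm (ciSup_le fun i => ?_)
      (le_ciSup (bddAbove_range_abs (N := 1) fun i hi => hf i (by omega)) 0)
    by_cases hi : i = 0
    · rw [hi]
    · simp [hf i hi]
  · have hp := toReal_pos_of_one_le h
    rw [tsum_eq_single 0 fun i hi => by rw [hf i hi, abs_zero, Real.zero_rpow hp.ne'],
      ← Real.rpow_mul (abs_nonneg _), mul_one_div_cancel hp.ne', Real.rpow_one]

theorem abs_le_seqLpNorm [Fact (1 ≤ p)] {f : ℕ → ℝ} {N : ℕ} (hf : ∀ i ≥ N, f i = 0) (i : ℕ) :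
    |f i| ≤ seqLpNorm p f := by
  by_cases h : p = ∞
  · rw [seqLpNorm, if_pos h]
    exact le_ciSup (bddAbove_range_abs hf) i
  · have hp := toReal_pos_of_one_le h
    rw [← Real.rpow_le_rpow_iff (abs_nonneg _) (seqLpNorm_nonneg p f) hp, seqLpNorm_rpow h]
    exact (summable_abs_rpow hp.ne' hf).le_tsum i fun _ _ => by positivity

/-- Concatenation of an initial segment of one sequence with a tail of another one. -/
theorem seqLpNorm_concat_le [Fact (1 ≤ p)] {f a b : ℕ → ℝ} {k l N : ℕ} (ha : ∀ i ≥ N, a i = 0)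
    (hb : ∀ i ≥ N, b i = 0) (hfa : ∀ i < k, f i = a i) (hfb : ∀ j, f (k + j) = b (l + j)) :
    seqLpNorm p f ≤ pairLpNorm p (seqLpNorm p a) (seqLpNorm p b) := by
  by_cases h : p = ∞
  · rw [pairLpNorm, if_pos h]
    conv_lhs => rw [seqLpNorm, if_pos h]
    refine ciSup_le fun i => ?_
    by_cases hi : i < k
    · rw [hfa i hi]
      exact (abs_le_seqLpNorm ha i).trans (le_max_left _ _)
    · obtain ⟨j, rfl⟩ := Nat.exists_eq_add_of_le (not_lt.1 hi)
      rw [hfb]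
      exact (abs_le_seqLpNorm hb _).trans (le_max_right _ _)
  · have hp := toReal_pos_of_one_le h
    rw [pairLpNorm, if_neg h, seqLpNorm_rpow h, seqLpNorm_rpow h, seqLpNorm, if_neg h]
    refine Real.rpow_le_rpow (tsum_nonneg fun i => by positivity) ?_ (by positivity)
    have hf : ∀ i ≥ k + N, f i = 0 := fun i hi => by
      obtain ⟨j, rfl⟩ := Nat.exists_eq_add_of_le ((Nat.le_add_right k N).trans hi)
      rw [hfb, hb _ (by omega)]
    have hb' : ∀ i ≥ N, (fun j => b (j + l)) i = 0 := fun i hi => hb _ (by omega)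
    rw [← (summable_abs_rpow hp.ne' hf).sum_add_tsum_nat_add k,
      ← (summable_abs_rpow hp.ne' hb).sum_add_tsum_nat_add l]
    have h1 : ∑ i ∈ Finset.range k, |f i| ^ p.toReal ≤ ∑' i, |a i| ^ p.toReal := by
      rw [Finset.sum_congr rfl fun i hi => by rw [hfa i (Finset.mem_range.1 hi)]]
      exact (summable_abs_rpow hp.ne' ha).sum_le_tsum _ fun _ _ => by positivity
    have h2 : ∑' i, |f (i + k)| ^ p.toReal = ∑' i, |b (i + l)| ^ p.toReal := by
      refine tsum_congr fun i => ?_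
      rw [add_comm i k, hfb, add_comm l i]
    have h3 : 0 ≤ ∑ i ∈ Finset.range l, |b i| ^ p.toReal :=
      Finset.sum_nonneg fun _ _ => by positivity
    linarith

/-- Iterating `ℓ_p`-norms of pairs yields the `ℓ_p`-norm of a sequence. -/
theorem le_seqLpNorm_of_le_pairLpNorm [Fact (1 ≤ p)] {F f : ℕ → ℝ} {N : ℕ}
    (hf : ∀ i ≥ N, f i = 0) (hf0 : ∀ i, 0 ≤ f i) (hF : ∀ i, 0 ≤ F i) (h0 : F 0 = 0)
    (hs : ∀ i, F (i + 1) ≤ pairLpNorm p (F i) (f i)) (L : ℕ) : F L ≤ seqLpNorm p f := by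
  by_cases h : p = ∞
  · induction L with
    | zero => rw [h0]; exact seqLpNorm_nonneg p f
    | succ L ih =>
      refine (hs L).trans ?_
      rw [pairLpNorm, if_pos h]
      exact max_le ih ((le_abs_self _).trans (abs_le_seqLpNorm hf L))
  · have hp := toReal_pos_of_one_le h
    have key : ∀ L, F L ^ p.toReal ≤ ∑ i ∈ Finset.range L, |f i| ^ p.toReal := by
      intro L
      induction L with
      | zero => simp [h0, Real.zero_rpow hp.ne']
      | succ L ih =>
        have h1 := Real.rpow_le_rpow (hF (L + 1)) (hs L) hp.le
        rw [pairLpNorm, if_neg h, ← Real.rpow_mul (add_nonneg (Real.rpow_nonneg (hF L) _)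
          (Real.rpow_nonneg (hf0 L) _)), one_div_mul_cancel hp.ne', Real.rpow_one] at h1
        rw [Finset.sum_range_succ, abs_of_nonneg (hf0 L)]
        linarith
    rw [← Real.rpow_le_rpow_iff (hF L) (seqLpNorm_nonneg p f) hp, seqLpNorm_rpow h]
    exact (key L).trans ((summable_abs_rpow hp.ne' hf).sum_le_tsum _ fun _ _ => by positivity)

end SeqNorm

/-! ### Interval partitions -/

namespace IntervalPartition

variable (Q : IntervalPartition)

/-- The first element of the `i`-th part. -/
def start (i : ℕ) : ℕ := (Q.part i).min' (Q.nonempty i)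

theorem lt_of_lt {i j a b : ℕ} (hij : i < j) (ha : a ∈ Q.part i) (hb : b ∈ Q.part j) : a < b := by
  induction j generalizing b with
  | zero => omega
  | succ j ih =>
    rcases Nat.lt_succ_iff_lt_or_eq.1 hij with h | rfl
    · obtain ⟨d, hd⟩ := Q.nonempty j
      exact (ih h hd).trans (Q.lt j d hd b hb)
    · exact Q.lt i a ha b hb

theorem start_mem (i : ℕ) : Q.start i ∈ Q.part i := Finset.min'_mem _ _

theorem strictMono_start : StrictMono Q.start :=
  fun i j hij => Q.lt_of_lt hij (Q.start_mem i) (Q.start_mem j)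

theorem start_zero : Q.start 0 = 0 := by
  obtain ⟨i, hi⟩ := Q.cover 0
  rcases Nat.eq_zero_or_pos i with rfl | h
  · exact Nat.le_zero.1 (Finset.min'_le _ _ hi)
  · exact absurd (Q.lt_of_lt h (Q.start_mem 0) hi) (Nat.not_lt_zero _)

theorem part_eq (i : ℕ) : Q.part i = Finset.Ico (Q.start i) (Q.start (i + 1)) := by
  ext n
  rw [Finset.mem_Ico]
  refine ⟨fun hn => ⟨Finset.min'_le _ _ hn, Q.lt i n hn _ (Q.start_mem _)⟩, fun ⟨h1, h2⟩ => ?_⟩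
  obtain ⟨k, hk⟩ := Q.cover n
  rcases lt_trichotomy k i with h | rfl | h
  · exact absurd (Q.lt_of_lt h hk (Q.start_mem i)) (by omega)
  · exact hk
  · have : Q.start (i + 1) ≤ Q.start k := Q.strictMono_start.monotone h
    have : Q.start k ≤ n := Finset.min'_le _ _ hk
    omega

/-- The interval partition with given starting points. -/
def ofStrictMono (e : ℕ → ℕ) (he : StrictMono e) (h0 : e 0 = 0) : IntervalPartition where
  part i := Finset.Ico (e i) (e (i + 1))
  nonempty i := Finset.nonempty_Ico.2 (he i.lt_succ_self)
  lt i a ha b hb := (Finset.mem_Ico.1 ha).2.trans_le (Finset.mem_Ico.1 hb).1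
  cover n := by
    have hex : ∃ i, n < e (i + 1) := ⟨n, (he.le_apply (x := n + 1)).trans_lt' n.lt_succ_self⟩
    refine ⟨Nat.find hex, Finset.mem_Ico.2 ⟨?_, Nat.find_spec hex⟩⟩
    rcases Nat.eq_zero_or_pos (Nat.find hex) with h | h
    · rw [h, h0]; exact Nat.zero_le _
    · have := Nat.find_min hex (Nat.sub_lt h one_pos)
      rw [Nat.sub_add_cancel (show 1 ≤ Nat.find hex from h)] at this
      exact not_lt.1 this

end IntervalPartition

/-! ### Press down norms -/

section PressDown

variable {𝕜 : Type v} [RCLike 𝕜] {Z : Type u} [NormedAddCommGroup Z] [NormedSpace 𝕜 Z]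
  {p : ℝ≥0∞} {H : ℕ → Submodule 𝕜 Z}

theorem exists_forall_ge_eq_zero (z : Π₀ n, H n) : ∃ N, ∀ n ≥ N, z n = 0 := by
  obtain ⟨M, hM⟩ := DFinsupp.exists_filter_range_eq z
  refine ⟨M, fun n hn => ?_⟩
  rw [← hM M le_rfl, DFinsupp.filter_apply, if_neg]
  simpa using hn

theorem sum_Ico_start_eq_zero {z : Π₀ n, H n} {N : ℕ} (hz : ∀ n ≥ N, z n = 0) {e : ℕ → ℕ}
    (he : StrictMono e) : ∀ i ≥ N, ‖∑ n ∈ Finset.Ico (e i) (e (i + 1)), (z n : Z)‖ = 0 := by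
  intro i hi
  rw [norm_eq_zero]
  refine Finset.sum_eq_zero fun n hn => ?_
  rw [hz n (hi.trans (he.le_apply.trans (Finset.mem_Ico.1 hn).1)), ZeroMemClass.coe_zero]

/-! An interval partition is given by the strictly increasing sequence `e` of its starting points,
with `e 0 = 0`. -/

theorem pressDownBracket_le_seqLpNorm (z : Π₀ n, H n) {e : ℕ → ℕ} (he : StrictMono e)
    (h0 : e 0 = 0) : pressDownBracket p H z ≤
      seqLpNorm p fun i => ‖∑ n ∈ Finset.Ico (e i) (e (i + 1)), (z n : Z)‖ :=
  ciInf_le ⟨0, by rintro _ ⟨Q, rfl⟩; exact seqLpNorm_nonneg _ _⟩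
    (IntervalPartition.ofStrictMono e he h0)

theorem exists_seqLpNorm_lt {z : Π₀ n, H n} {r : ℝ} (hr : pressDownBracket p H z < r) :
    ∃ e : ℕ → ℕ, StrictMono e ∧ e 0 = 0 ∧
      (seqLpNorm p fun i => ‖∑ n ∈ Finset.Ico (e i) (e (i + 1)), (z n : Z)‖) < r := by
  obtain ⟨Q, hQ⟩ := exists_lt_of_ciInf_lt hr
  refine ⟨Q.start, Q.strictMono_start, Q.start_zero, ?_⟩
  simpa only [Q.part_eq] using hQ

theorem le_pressDownBracket {z : Π₀ n, H n} {r : ℝ} (h : ∀ e : ℕ → ℕ, StrictMono e → e 0 = 0 →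
    r ≤ seqLpNorm p fun i => ‖∑ n ∈ Finset.Ico (e i) (e (i + 1)), (z n : Z)‖) :
    r ≤ pressDownBracket p H z := by
  by_contra hr
  obtain ⟨e, he, h0, hlt⟩ := exists_seqLpNorm_lt (not_le.1 hr)
  exact absurd (h e he h0) (not_le.2 hlt)

/-- The partition whose first part contains the support shows that pressing down decreases the
norm. -/
theorem pressDownBracket_le_norm [Fact (1 ≤ p)] (z : Π₀ n, H n) {N : ℕ} (hz : ∀ n ≥ N, z n = 0) :
    pressDownBracket p H z ≤ ‖∑ n ∈ Finset.range N, (z n : Z)‖ := by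
  have he : StrictMono fun i : ℕ => if i = 0 then 0 else N + i :=
    strictMono_nat_of_lt_succ fun i => by
      by_cases h : i = 0
      · subst h; simp
      · simp [h]
  refine (pressDownBracket_le_seqLpNorm z he rfl).trans ?_
  rw [seqLpNorm_eq_of_forall_ne_zero]
  · simp only [zero_add, if_true, one_ne_zero, if_false, abs_norm]
    rw [← Finset.range_eq_Ico, Finset.sum_range_succ, hz N le_rfl, ZeroMemClass.coe_zero, add_zero]
  · intro i hi
    simp only [hi, if_false, Nat.succ_ne_zero, norm_eq_zero]
    refine Finset.sum_eq_zero fun n hn => ?_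
    rw [hz n ((Nat.le_add_right N i).trans (Finset.mem_Ico.1 hn).1), ZeroMemClass.coe_zero]

theorem pressDownNorm_le_bracket (z : Π₀ n, H n) :
    pressDownNorm p H z ≤ pressDownBracket p H z :=
  csInf_le (pressDownNorm_bddBelow p H z) ⟨1, fun _ => z, by simp, by simp⟩

theorem pressDownNorm_sum_le {ι : Type*} (s : Finset ι) (w : ι → Π₀ n, H n) :
    pressDownNorm p H (∑ i ∈ s, w i) ≤ ∑ i ∈ s, pressDownBracket p H (w i) := by
  classical
  induction s using Finset.induction_on with
  | empty => simp [pressDownNorm_zero]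
  | insert i s hi ih =>
    rw [Finset.sum_insert hi, Finset.sum_insert hi]
    exact (pressDownNorm_add_le p H _ _).trans (add_le_add (pressDownNorm_le_bracket _) ih)

theorem pressDownBracket_zero [hp : Fact (1 ≤ p)] : pressDownBracket p H 0 = 0 := by
  have := pressDownBracket_smul p hp.out H (0 : 𝕜) 0
  have h0 : (0 : 𝕜) • (0 : Π₀ n, H n) = 0 := DFinsupp.ext fun n => zero_smul 𝕜 _
  simpa [h0] using this

theorem IsBimonotoneFDD.norm_sum_filter_le (h : IsBimonotoneFDD H) (s : Finset ℕ) (a b : ℕ)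
    (z : Π₀ n, H n) :
    ‖∑ n ∈ s, (z.filter (· ∈ Finset.Ico a b) n : Z)‖ ≤ ‖∑ n ∈ s, (z n : Z)‖ := by
  convert h.norm_Ico_le a b (∑ n ∈ s, (z n : Z)) using 2
  simp only [h.proj_sum s (fun n => (z n : Z)) (fun n => (z n).2), DFinsupp.filter_apply]
  rw [← Finset.sum_filter]
  have : ∀ n, ((if n ∈ Finset.Ico a b then z n else 0 : H n) : Z) =
      if n ∈ Finset.Ico a b then (z n : Z) else 0 := fun n => by split_ifs <;> rfl
  simp only [this]
  rw [← Finset.sum_filter, Finset.filter_mem_eq_inter, Finset.filter_mem_eq_inter,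
    Finset.inter_comm]

theorem pressDownBracket_filter_le [Fact (1 ≤ p)] (h : IsBimonotoneFDD H) (a b : ℕ)
    (z : Π₀ n, H n) :
    pressDownBracket p H (z.filter (· ∈ Finset.Ico a b)) ≤ pressDownBracket p H z := by
  obtain ⟨N, hN⟩ := exists_forall_ge_eq_zero z
  refine le_pressDownBracket fun e he h0 => (pressDownBracket_le_seqLpNorm _ he h0).trans ?_
  refine seqLpNorm_mono (sum_Ico_start_eq_zero hN he) fun i => ?_
  rw [abs_norm, abs_norm]
  exact h.norm_sum_filter_le _ a b z

theorem DFinsupp.filter_sum {ι : Type*} (q : ℕ → Prop) [DecidablePred q] (s : Finset ι)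
    (w : ι → Π₀ n, H n) : (∑ i ∈ s, w i).filter q = ∑ i ∈ s, (w i).filter q :=
  map_sum (DFinsupp.filterLinearMap 𝕜 (fun n => H n) q) w s

theorem pressDownNorm_filter_le [Fact (1 ≤ p)] (h : IsBimonotoneFDD H) (a b : ℕ)
    (z : Π₀ n, H n) :
    pressDownNorm p H (z.filter (· ∈ Finset.Ico a b)) ≤ pressDownNorm p H z := by
  refine le_csInf (pressDownNorm_nonempty p H z) ?_
  rintro r ⟨m, w, rfl, rfl⟩
  rw [DFinsupp.filter_sum]
  exact (pressDownNorm_sum_le _ _).trans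
    (Finset.sum_le_sum fun i _ => pressDownBracket_filter_le h a b (w i))

theorem norm_apply_le_pressDownNorm [Fact (1 ≤ p)] (h : IsBimonotoneFDD H) (n : ℕ)
    (z : Π₀ n, H n) : ‖z n‖ ≤ pressDownNorm p H z := by
  have hb : ∀ w : Π₀ n, H n, ‖w n‖ ≤ pressDownBracket p H w := by
    intro w
    obtain ⟨N, hN⟩ := exists_forall_ge_eq_zero w
    refine le_pressDownBracket fun e he h0 => ?_
    obtain ⟨i, hi⟩ := (IntervalPartition.ofStrictMono e he h0).cover n
    refine le_trans ?_ (abs_le_seqLpNorm (sum_Ico_start_eq_zero hN he) i)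
    rw [abs_norm]
    have h1 := h.norm_proj_le n (∑ n ∈ Finset.Ico (e i) (e (i + 1)), (w n : Z))
    rwa [h.proj_sum _ (fun n => (w n : Z)) (fun n => (w n).2),
      if_pos (show n ∈ Finset.Ico (e i) (e (i + 1)) from hi)] at h1
  refine le_csInf (pressDownNorm_nonempty p H z) ?_
  rintro r ⟨m, w, rfl, rfl⟩
  rw [DFinsupp.finsetSum_apply]
  exact (norm_sum_le _ _).trans (Finset.sum_le_sum fun i _ => hb (w i))

/-- Concatenating a partition for `x` and a partition for `y` at the point `c` yields a partition
for `x + y`. -/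
theorem pressDownBracket_add_le [Fact (1 ≤ p)] {x y : Π₀ n, H n} {c : ℕ} (hx : ∀ n ≥ c, x n = 0)
    (hy : ∀ n < c, y n = 0) {a b : ℝ} (ha : pressDownBracket p H x < a)
    (hb : pressDownBracket p H y < b) :
    pressDownBracket p H (x + y) ≤ pairLpNorm p a b := by
  have ha0 := (pressDownBracket_nonneg p H x).trans ha.le
  have hb0 := (pressDownBracket_nonneg p H y).trans hb.le
  rcases Nat.eq_zero_or_pos c with rfl | hc
  · have : x = 0 := DFinsupp.ext fun n => hx n (Nat.zero_le n)
    rw [this, zero_add]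
    exact (hb.le.trans (pairLpNorm_zero_left hb0).ge).trans (pairLpNorm_mono le_rfl hb0 ha0 le_rfl)
  obtain ⟨e, he, he0, hea⟩ := exists_seqLpNorm_lt ha
  obtain ⟨d, hd, hd0, hdb⟩ := exists_seqLpNorm_lt hb
  obtain ⟨N₁, hN₁⟩ := exists_forall_ge_eq_zero x
  obtain ⟨N₂, hN₂⟩ := exists_forall_ge_eq_zero y
  -- the part of the first partition that contains `c - 1`, the part of the second with `c`
  obtain ⟨k, hk⟩ := (IntervalPartition.ofStrictMono e he he0).cover (c - 1)
  obtain ⟨l, hl⟩ := (IntervalPartition.ofStrictMono d hd hd0).cover c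
  obtain ⟨hk1, hk2⟩ := Finset.mem_Ico.1 hk
  obtain ⟨hl1, hl2⟩ := Finset.mem_Ico.1 hl
  -- starting points: those of the first partition up to that part, then `c`, then those of the
  -- second partition
  let g : ℕ → ℕ := fun i => if i ≤ k then e i else if i = k + 1 then c else d (l + (i - (k + 1)))
  have g1 : ∀ i ≤ k, g i = e i := fun i hi => if_pos hi
  have g2 : g (k + 1) = c := by simp [g]
  have g3 : ∀ j, g (k + 1 + (j + 1)) = d (l + (j + 1)) := fun j => by
    simp only [g]
    rw [if_neg (by omega), if_neg (by omega)]
    congr 1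
    omega
  have hg : StrictMono g := by
    refine strictMono_nat_of_lt_succ fun i => ?_
    rcases lt_trichotomy i k with h | rfl | h
    · rw [g1 i h.le, g1 (i + 1) h]; exact he i.lt_succ_self
    · rw [g1 i le_rfl, g2]; omega
    · obtain ⟨j, rfl⟩ := Nat.exists_eq_add_of_le (Nat.succ_le_of_lt h)
      rcases j with _ | j
      · have := g3 0
        simp only [zero_add] at this
        rw [Nat.succ_eq_add_one, add_zero, this, g2]
        exact hl2
      · rw [Nat.succ_eq_add_one, g3 j, add_assoc (k + 1) (j + 1) 1, g3 (j + 1)]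
        exact hd (by omega)
  have hg0 : g 0 = 0 := by rw [g1 0 (Nat.zero_le _), he0]
  refine (pressDownBracket_le_seqLpNorm (x + y) hg hg0).trans (le_trans
    (seqLpNorm_concat_le (k := k + 1) (l := l) (N := max N₁ N₂)
      (sum_Ico_start_eq_zero (fun n hn => hN₁ n (le_of_max_le_left hn)) he)
      (sum_Ico_start_eq_zero (fun n hn => hN₂ n (le_of_max_le_right hn)) hd) ?_ ?_)
    (pairLpNorm_mono (seqLpNorm_nonneg _ _) (seqLpNorm_nonneg _ _) hea.le hdb.le))
  · intro i hi
    congr 1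
    rcases Nat.lt_succ_iff_lt_or_eq.1 hi with h | rfl
    · rw [g1 i h.le, g1 (i + 1) h]
      refine Finset.sum_congr rfl fun n hn => ?_
      have : e (i + 1) ≤ e k := he.monotone h
      have := (Finset.mem_Ico.1 hn).2
      rw [DFinsupp.add_apply, hy n (by omega), add_zero]
    · rw [g1 i le_rfl, g2]
      refine (Finset.sum_congr rfl fun n hn => ?_).trans
        (Finset.sum_subset (Finset.Ico_subset_Ico_right (show c ≤ e (i + 1) by omega)) ?_)
      · rw [DFinsupp.add_apply, hy n (Finset.mem_Ico.1 hn).2, add_zero]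
      · intro n hn hn'
        rw [hx n, ZeroMemClass.coe_zero]
        by_contra h
        exact hn' (Finset.mem_Ico.2 ⟨(Finset.mem_Ico.1 hn).1, not_le.1 h⟩)
  · intro j
    congr 1
    rcases j with _ | j
    · have := g3 0
      simp only [zero_add] at this
      rw [add_zero, this, g2, add_zero]
      refine (Finset.sum_congr rfl fun n hn => ?_).trans
        (Finset.sum_subset (Finset.Ico_subset_Ico_left hl1) ?_)
      · rw [DFinsupp.add_apply, hx n (Finset.mem_Ico.1 hn).1, zero_add]
      · intro n hn hn'
        rw [hy n, ZeroMemClass.coe_zero]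
        by_contra h
        exact hn' (Finset.mem_Ico.2 ⟨not_lt.1 h, (Finset.mem_Ico.1 hn).2⟩)
    · rw [g3 j, add_assoc (k + 1) (j + 1) 1, g3 (j + 1)]
      refine Finset.sum_congr rfl fun n hn => ?_
      have : d (l + 1) ≤ d (l + (j + 1)) := hd.monotone (by omega)
      have := (Finset.mem_Ico.1 hn).1
      rw [DFinsupp.add_apply, hx n (by omega), zero_add]

/-- A vector supported in an interval is a sum of vectors supported there, with positive bounds for
the brackets whose sum is any given number above the norm. -/
theorem exists_decomposition [Fact (1 ≤ p)] (h : IsBimonotoneFDD H) {x : Π₀ n, H n} {A B : ℕ}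
    (hx : x.filter (· ∈ Finset.Ico A B) = x) {a : ℝ} (ha : pressDownNorm p H x < a) :
    ∃ (m : ℕ) (w : Fin m → Π₀ n, H n) (α : Fin m → ℝ), x = ∑ i, w i ∧ ∑ i, α i = a ∧
      (∀ i, pressDownBracket p H (w i) < α i) ∧ ∀ i, ∀ n ∉ Finset.Ico A B, w i n = 0 := by
  obtain ⟨_, ⟨m, w, hw, rfl⟩, hlt⟩ := exists_lt_of_csInf_lt (pressDownNorm_nonempty p H x) ha
  -- a zero vector is added, so that the number of terms that share the slack is not zero
  let w' : Fin (m + 1) → Π₀ n, H n := fun i =>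
    (Fin.cons 0 w : Fin (m + 1) → Π₀ n, H n) i |>.filter (· ∈ Finset.Ico A B)
  have hs : ∑ i, pressDownBracket p H (w' i) ≤ ∑ i, pressDownBracket p H (w i) := by
    rw [Fin.sum_univ_succ]
    simp only [w', Fin.cons_zero, Fin.cons_succ, DFinsupp.filter_zero, pressDownBracket_zero,
      zero_add]
    exact Finset.sum_le_sum fun i _ => pressDownBracket_filter_le h A B (w i)
  refine ⟨m + 1, w', fun i => pressDownBracket p H (w' i) +
    (a - ∑ i, pressDownBracket p H (w' i)) / (m + 1), ?_, ?_, fun i => ?_, fun i n hn => ?_⟩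
  · rw [Fin.sum_univ_succ]
    simp only [w', Fin.cons_zero, Fin.cons_succ, DFinsupp.filter_zero, zero_add]
    rw [← DFinsupp.filter_sum, ← hw, hx]
  · have : (m + 1 : ℝ) ≠ 0 := by positivity
    rw [Finset.sum_add_distrib, Finset.sum_const, Finset.card_univ, Fintype.card_fin, nsmul_eq_mul]
    push_cast
    field_simp
    ring
  · have : 0 < (a - ∑ i, pressDownBracket p H (w' i)) / (m + 1) :=
      div_pos (by linarith) (by positivity)
    linarith
  · simp only [w', DFinsupp.filter_apply, if_neg hn]

/-- The upper `p`-estimate for two successive blocks: the product of a decomposition of `x` and a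
decomposition of `y` is a decomposition of `x + y`. -/
theorem pressDownNorm_add_le_pairLpNorm [hp : Fact (1 ≤ p)] (h : IsBimonotoneFDD H)
    {x y : Π₀ n, H n} {c N : ℕ} (hx : x.filter (· ∈ Finset.Ico 0 c) = x)
    (hy : y.filter (· ∈ Finset.Ico c N) = y) :
    pressDownNorm p H (x + y) ≤ pairLpNorm p (pressDownNorm p H x) (pressDownNorm p H y) := by
  have h0 : ∀ z, 0 ≤ pressDownNorm p H z := fun z => by
    refine Real.sInf_nonneg ?_
    rintro r ⟨m, w, -, rfl⟩
    exact Finset.sum_nonneg fun i _ => pressDownBracket_nonneg p H _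
  have key : ∀ a b : ℝ, pressDownNorm p H x < a → pressDownNorm p H y < b →
      pressDownNorm p H (x + y) ≤ pairLpNorm p a b := by
    intro a b ha hb
    have ha0 : 0 < a := (h0 x).trans_lt ha
    have hb0 : 0 < b := (h0 y).trans_lt hb
    obtain ⟨m, u, α, hu, hα, hu1, hu2⟩ := exists_decomposition h hx ha
    obtain ⟨k, v, β, hv, hβ, hv1, hv2⟩ := exists_decomposition h hy hb
    have hα0 : ∀ i, 0 < α i := fun i => (pressDownBracket_nonneg p H _).trans_lt (hu1 i)
    have hβ0 : ∀ j, 0 < β j := fun j => (pressDownBracket_nonneg p H _).trans_lt (hv1 j)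
    -- `x + y = ∑ᵢⱼ ((βⱼ / b) uᵢ + (αᵢ / a) vⱼ)`, where the term with index `(i, j)` has bracket at
    -- most `αᵢ βⱼ / (a b)` times the norm of the pair `(a, b)`
    have hxy : x + y = ∑ ij ∈ (Finset.univ ×ˢ Finset.univ : Finset (Fin m × Fin k)),
        (((β ij.2 / b : ℝ) : 𝕜) • u ij.1 + ((α ij.1 / a : ℝ) : 𝕜) • v ij.2) := by
      rw [Finset.sum_add_distrib]
      congr 1
      · rw [Finset.sum_product, hu]
        refine Finset.sum_congr rfl fun i _ => ?_
        change u i = ∑ j, ((β j / b : ℝ) : 𝕜) • u i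
        rw [← Finset.sum_smul, ← RCLike.ofReal_sum, ← Finset.sum_div, hβ, div_self hb0.ne',
          RCLike.ofReal_one, one_smul]
      · rw [Finset.sum_product_right, hv]
        refine Finset.sum_congr rfl fun j _ => ?_
        change v j = ∑ i, ((α i / a : ℝ) : 𝕜) • v j
        rw [← Finset.sum_smul, ← RCLike.ofReal_sum, ← Finset.sum_div, hα, div_self ha0.ne',
          RCLike.ofReal_one, one_smul]
    have hsm : ∀ {r : ℝ} (hr : 0 < r) {z : Π₀ n, H n} {t : ℝ}, pressDownBracket p H z < t →
        pressDownBracket p H ((r : 𝕜) • z) < r * t := fun {r} hr {z t} ht => by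
      rw [pressDownBracket_smul p hp.out, RCLike.norm_ofReal, abs_of_pos hr]
      exact mul_lt_mul_of_pos_left ht hr
    rw [hxy]
    calc _ ≤ _ := pressDownNorm_sum_le _ _
      _ ≤ ∑ ij ∈ (Finset.univ ×ˢ Finset.univ : Finset (Fin m × Fin k)),
          (α ij.1 * β ij.2) / (a * b) * pairLpNorm p a b := by
        refine Finset.sum_le_sum fun ij _ => ?_
        have h1 := pressDownBracket_add_le (c := c) (fun n hn => ?_) (fun n hn => ?_)
          (hsm (div_pos (hβ0 ij.2) hb0) (hu1 ij.1)) (hsm (div_pos (hα0 ij.1) ha0) (hv1 ij.2))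
        · refine h1.trans_eq ?_
          rw [← pairLpNorm_smul ha0.le hb0.le (by have := hα0 ij.1; have := hβ0 ij.2; positivity)]
          congr 1 <;> field_simp
        · rw [DFinsupp.smul_apply, hu2 _ n (by simp [hn]), smul_zero]
        · rw [DFinsupp.smul_apply, hv2 _ n (by simp [hn]), smul_zero]
      _ = pairLpNorm p a b := by
        rw [← Finset.sum_mul, ← Finset.sum_div, Finset.sum_product]
        dsimp only
        rw [← Finset.sum_mul_sum, hα, hβ, div_self (by positivity), one_mul]
  have hlim : Tendsto (fun ε : ℝ => pairLpNorm p (pressDownNorm p H x + ε)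
      (pressDownNorm p H y + ε)) (𝓝[>] 0)
      (𝓝 (pairLpNorm p (pressDownNorm p H x) (pressDownNorm p H y))) := by
    have hc : Continuous fun ε : ℝ => pairLpNorm p (pressDownNorm p H x + ε)
        (pressDownNorm p H y + ε) :=
      continuous_pairLpNorm.comp (by fun_prop : Continuous fun ε : ℝ =>
        (pressDownNorm p H x + ε, pressDownNorm p H y + ε))
    have := hc.tendsto 0
    rw [add_zero, add_zero] at this
    exact this.mono_left nhdsWithin_le_nhds
  refine ge_of_tendsto hlim ?_
  filter_upwards [self_mem_nhdsWithin] with ε hε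
  exact key _ _ (lt_add_of_pos_right _ hε) (lt_add_of_pos_right _ hε)

end PressDown

/-! ### Upper estimates -/

section UpperEstimate

variable {𝕜 : Type v} [RCLike 𝕜] {Z : Type u} [NormedAddCommGroup Z] [NormedSpace 𝕜 Z]

/-- The upper `p`-estimate, with constant `1`, for pairs of successive blocks. -/
def HasUpperEstimate (p : ℝ≥0∞) (P : ℕ → Z →L[𝕜] Z) : Prop :=
  ∀ c N, c ≤ N → ∀ z, ‖∑ n ∈ Finset.range N, P n z‖ ≤
    pairLpNorm p ‖∑ n ∈ Finset.range c, P n z‖ ‖∑ n ∈ Finset.Ico c N, P n z‖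

variable {p : ℝ≥0∞} {H : ℕ → Submodule 𝕜 Z}

/-- The identity of `c₀₀(H)`, as a map to the normed space `(c₀₀(H), ‖·‖_{∧,p})`. -/
def pressDownEquiv (p : ℝ≥0∞) (H : ℕ → Submodule 𝕜 Z) : (Π₀ n, H n) ≃ₗ[𝕜] PressDownPre p H :=
  LinearEquiv.refl 𝕜 (Π₀ n, H n)

theorem norm_pressDownEquiv [Fact (1 ≤ p)] (x : Π₀ n, H n) :
    ‖pressDownEquiv p H x‖ = pressDownNorm p H x := rfl

theorem IsBimonotoneFDD.isIntervalMonotone_pressDown [Fact (1 ≤ p)] (h : IsBimonotoneFDD H) :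
    IsIntervalMonotone (pressDownEquiv p H) :=
  fun a b x => pressDownNorm_filter_le h a b x

theorem IsBimonotoneFDD.complTerm_pressDown_ne_bot [Fact (1 ≤ p)] (h : IsBimonotoneFDD H) (n : ℕ) :
    complTerm (pressDownEquiv p H) n ≠ ⊥ := by
  have : ∀ n, Nontrivial (H n) := fun n => Submodule.nontrivial_iff_ne_bot.2 (h.ne_bot n)
  refine complTerm_ne_bot (fun n v hv => ?_) n
  have := norm_apply_le_pressDownNorm (p := p) h n (DFinsupp.single n v)
  rw [norm_pressDownEquiv] at hv
  rw [hv, DFinsupp.single_eq_same] at this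
  exact norm_le_zero_iff.1 this

theorem IsBimonotoneFDD.hasUpperEstimate_pressDown [Fact (1 ≤ p)] (h : IsBimonotoneFDD H) :
    HasUpperEstimate p (h.isIntervalMonotone_pressDown (p := p)).complProj := by
  intro c N hcN z
  induction z using UniformSpace.Completion.induction_on with
  | hp =>
    exact isClosed_le (by fun_prop) (continuous_pairLpNorm.comp (by fun_prop :
      Continuous fun z => (‖∑ n ∈ Finset.range c, h.isIntervalMonotone_pressDown.complProj n z‖,
        ‖∑ n ∈ Finset.Ico c N, h.isIntervalMonotone_pressDown.complProj n z‖)))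
  | ih x =>
    obtain ⟨x, rfl⟩ := (pressDownEquiv p H).surjective x
    simp only [IsIntervalMonotone.sum_complProj_coe, UniformSpace.Completion.norm_coe,
      norm_pressDownEquiv]
    have : x.filter (· ∈ Finset.range N) =
        x.filter (· ∈ Finset.range c) + x.filter (· ∈ Finset.Ico c N) := by
      rw [← DFinsupp.sum_single_apply, ← DFinsupp.sum_single_apply, ← DFinsupp.sum_single_apply,
        Finset.sum_range_add_sum_Ico _ hcN]
    rw [this]
    refine pressDownNorm_add_le_pairLpNorm (c := c) (N := N) h ?_ ?_
    · ext n
      simp only [DFinsupp.filter_apply, Finset.mem_range, Finset.mem_Ico, Nat.zero_le, true_and]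
      split_ifs <;> rfl
    · ext n
      simp only [DFinsupp.filter_apply]
      split_ifs <;> rfl

end UpperEstimate

/-! ### Sums of sequences of copies of a space -/

section SeqSum

variable {𝕜 : Type v} [RCLike 𝕜] {X Z : Type u} [NormedAddCommGroup X] [NormedSpace 𝕜 X]
  [NormedAddCommGroup Z] [NormedSpace 𝕜 Z]

/-- `Z` is a sum of countably many copies of `X` in the sense of `ℓ_p` (or of `c₀` for `p = ∞`),
with canonical embeddings `ι i` and coordinates `π i`. Only the properties common to `ℓ_p(X)` and
`c₀(X)` that the decomposition method needs are recorded. -/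
structure IsSeqSum (p : ℝ≥0∞) (ι : ℕ → X →L[𝕜] Z) (π : ℕ → Z →L[𝕜] X) : Prop where
  coord_embed : ∀ i j x, π i (ι j x) = if i = j then x else 0
  norm_mono : ∀ y z, (∀ i, ‖π i y‖ ≤ ‖π i z‖) → ‖y‖ ≤ ‖z‖
  dense : (⨆ i, LinearMap.range (ι i).toLinearMap).topologicalClosure = ⊤
  upper : ∀ x y z, (∀ i, ‖π i x‖ ≤ pairLpNorm p ‖π i y‖ ‖π i z‖) →
    ‖x‖ ≤ pairLpNorm p ‖y‖ ‖z‖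
  reindex : ∀ e : ℕ → ℕ, Function.Injective e → ∃ R S : Z →L[𝕜] Z,
    (∀ i z, π i (R z) = π (e i) z) ∧ (∀ i z, π (e i) (S z) = π i z) ∧
      ∀ j ∉ Set.range e, ∀ z, π j (S z) = 0

variable {p : ℝ≥0∞} {ι : ℕ → X →L[𝕜] Z} {π : ℕ → Z →L[𝕜] X}

theorem IsSeqSum.ext (h : IsSeqSum p ι π) {y z : Z} (hyz : ∀ i, π i y = π i z) : y = z := by
  rw [← sub_eq_zero, ← norm_le_zero_iff, ← norm_zero (E := Z)]
  exact h.norm_mono _ _ fun i => by simp [hyz]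

variable {G : ℕ → Submodule 𝕜 X} {P : ℕ → X →L[𝕜] X}

/-- The terms of the decompositions of the copies of `X`, enumerated by the pairing function. -/
def sumTerm (ι : ℕ → X →L[𝕜] Z) (G : ℕ → Submodule 𝕜 X) (n : ℕ) : Submodule 𝕜 Z :=
  (G n.unpair.2).map (ι n.unpair.1).toLinearMap

/-- The projections onto the terms `sumTerm`. -/
noncomputable def sumProj (ι : ℕ → X →L[𝕜] Z) (π : ℕ → Z →L[𝕜] X) (P : ℕ → X →L[𝕜] X) (n : ℕ) :
    Z →L[𝕜] Z :=
  (ι n.unpair.1).comp ((P n.unpair.2).comp (π n.unpair.1))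

theorem exists_strictMono_lt_iff {m : ℕ → ℕ} (hm : StrictMono m) (a : ℕ) :
    ∃ c, ∀ k, m k < a ↔ k < c := by
  have hex : ∃ k, a ≤ m k := ⟨a, hm.le_apply⟩
  refine ⟨Nat.find hex, fun k => ⟨fun hk => ?_, fun hk => not_le.1 (Nat.find_min hex hk)⟩⟩
  by_contra h
  exact absurd (hk.trans_le (Nat.find_spec hex)) (not_lt.2 (hm.monotone (not_lt.1 h)))

/-- The trace of an initial segment of `ℕ` on a row of the pairing function is an initial
segment. -/
theorem exists_pair_lt_iff (i a : ℕ) : ∃ c, ∀ k, Nat.pair i k < a ↔ k < c :=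
  exists_strictMono_lt_iff (fun _ _ => Nat.pair_lt_pair_right i) a

theorem IsSeqSum.coord_sumProj (h : IsSeqSum p ι π) (i n : ℕ) (z : Z) :
    π i (sumProj ι π P n z) = if n.unpair.1 = i then P n.unpair.2 (π i z) else 0 := by
  simp only [sumProj, ContinuousLinearMap.comp_apply, h.coord_embed]
  by_cases hi : n.unpair.1 = i
  · subst hi; simp
  · simp [hi, Ne.symm hi]

theorem IsSeqSum.coord_sum_Ico (h : IsSeqSum p ι π) {i a b ca cb : ℕ}
    (ha : ∀ k, Nat.pair i k < a ↔ k < ca) (hb : ∀ k, Nat.pair i k < b ↔ k < cb) (z : Z) :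
    π i (∑ n ∈ Finset.Ico a b, sumProj ι π P n z) = ∑ k ∈ Finset.Ico ca cb, P k (π i z) := by
  simp only [map_sum, h.coord_sumProj]
  rw [← Finset.sum_filter]
  refine Finset.sum_nbij' (fun n => n.unpair.2) (fun k => Nat.pair i k) ?_ ?_ ?_ ?_ ?_
  · intro n hn
    obtain ⟨hab, rfl⟩ := Finset.mem_filter.1 hn
    obtain ⟨h1, h2⟩ := Finset.mem_Ico.1 hab
    rw [Finset.mem_Ico, ← hb, Nat.pair_unpair, ← not_lt, ← ha, Nat.pair_unpair]
    exact ⟨not_lt.2 h1, h2⟩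
  · intro k hk
    obtain ⟨h1, h2⟩ := Finset.mem_Ico.1 hk
    rw [Finset.mem_filter, Finset.mem_Ico, Nat.unpair_pair, hb, ← not_lt, ha]
    exact ⟨⟨not_lt.2 h1, h2⟩, rfl⟩
  · intro n hn
    obtain ⟨-, rfl⟩ := Finset.mem_filter.1 hn
    exact Nat.pair_unpair n
  · intro k _
    simp
  · intro n _
    rfl

theorem IsSeqSum.isBimonotoneSystem (h : IsSeqSum p ι π) (hP : IsBimonotoneSystem G P) :
    IsBimonotoneSystem (sumTerm ι G) (sumProj ι π P) where
  mem n z := Submodule.mem_map_of_mem (hP.mem _ _)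
  apply_of_mem n z hz := by
    obtain ⟨x, hx, rfl⟩ := hz
    simp only [sumProj, ContinuousLinearMap.comp_apply, ContinuousLinearMap.coe_coe,
      h.coord_embed, if_true, hP.apply_of_mem _ x hx]
  apply_of_mem_ne m n hmn z hz := by
    obtain ⟨x, hx, rfl⟩ := hz
    simp only [sumProj, ContinuousLinearMap.comp_apply, ContinuousLinearMap.coe_coe,
      h.coord_embed]
    by_cases h1 : n.unpair.1 = m.unpair.1
    · rw [if_pos h1, hP.apply_of_mem_ne m.unpair.2 n.unpair.2 _ x hx, map_zero]
      intro h2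
      exact hmn (by rw [← Nat.pair_unpair m, ← Nat.pair_unpair n, h1, h2])
    · rw [if_neg h1, map_zero, map_zero]
  norm_Ico_le a b z := by
    refine h.norm_mono _ _ fun i => ?_
    obtain ⟨ca, hca⟩ := exists_pair_lt_iff i a
    obtain ⟨cb, hcb⟩ := exists_pair_lt_iff i b
    rw [h.coord_sum_Ico hca hcb]
    exact hP.norm_Ico_le ca cb _
  dense := by
    rw [eq_top_iff, ← h.dense]
    refine Submodule.topologicalClosure_minimal _ (iSup_le fun i => ?_)
      (Submodule.isClosed_topologicalClosure _)
    rintro _ ⟨x, rfl⟩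
    have hx : x ∈ (⨆ k, G k).topologicalClosure := by rw [hP.dense]; trivial
    have h1 : (⨆ k, G k).topologicalClosure.map (ι i).toLinearMap ≤
        ((⨆ k, G k).map (ι i).toLinearMap).topologicalClosure :=
      Submodule.topologicalClosure_map (ι i) _
    refine Submodule.topologicalClosure_mono ?_ (h1 (Submodule.mem_map_of_mem hx))
    rw [Submodule.map_iSup]
    refine iSup_le fun k => ?_
    have h2 : (G k).map (ι i).toLinearMap = sumTerm ι G (Nat.pair i k) := by simp [sumTerm]
    rw [h2]
    exact le_iSup (sumTerm ι G) _

theorem IsSeqSum.hasUpperEstimate (h : IsSeqSum p ι π) (hP : HasUpperEstimate p P) :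
    HasUpperEstimate p (sumProj ι π P) := by
  intro c N hcN z
  refine h.upper _ _ _ fun i => ?_
  obtain ⟨c', hc'⟩ := exists_pair_lt_iff i c
  obtain ⟨N', hN'⟩ := exists_pair_lt_iff i N
  have h0 : ∀ k, Nat.pair i k < 0 ↔ k < 0 := by simp
  have hcN' : c' ≤ N' := by
    by_contra hlt
    exact absurd ((hN' N').1 (((hc' N').2 (not_le.1 hlt)).trans_le hcN)) (lt_irrefl _)
  rw [Finset.range_eq_Ico, Finset.range_eq_Ico, h.coord_sum_Ico h0 hN', h.coord_sum_Ico h0 hc',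
    h.coord_sum_Ico hc' hN']
  simpa only [Finset.range_eq_Ico] using hP c' N' hcN' (π i z)

theorem IsSeqSum.isBimonotoneFDD (h : IsSeqSum p ι π) (hP : IsBimonotoneSystem G P)
    (hf : ∀ n, FiniteDimensional 𝕜 (G n)) (hb : ∀ n, G n ≠ ⊥) :
    IsBimonotoneFDD (sumTerm ι G) := by
  refine (h.isBimonotoneSystem hP).isBimonotoneFDD (fun n => ?_) fun n hn => hb n.unpair.2 ?_
  · have := hf n.unpair.2
    unfold sumTerm
    infer_instance
  · refine (Submodule.eq_bot_iff _).2 fun x hx => ?_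
    have h1 : ι n.unpair.1 x ∈ sumTerm ι G n := Submodule.mem_map_of_mem hx
    rw [hn, Submodule.mem_bot] at h1
    have := h.coord_embed n.unpair.1 n.unpair.1 x
    rw [h1, map_zero, if_pos rfl] at this
    exact this.symm

/-- A space of sequences is isomorphic to its square, by splitting into even and odd
coordinates. -/
theorem IsSeqSum.nonempty_prod_self (h : IsSeqSum p ι π) : Nonempty ((Z × Z) ≃L[𝕜] Z) := by
  obtain ⟨R₁, S₁, hR₁, hS₁, hS₁'⟩ := h.reindex (fun i => 2 * i) fun a b hab => by
    simpa using hab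
  obtain ⟨R₂, S₂, hR₂, hS₂, hS₂'⟩ := h.reindex (fun i => 2 * i + 1) fun a b hab => by
    simpa using hab
  have e1 : ∀ i, 2 * i ∉ Set.range fun i => 2 * i + 1 := by
    rintro i ⟨j, hj⟩
    dsimp only at hj
    omega
  have e2 : ∀ i, 2 * i + 1 ∉ Set.range fun i => 2 * i := by
    rintro i ⟨j, hj⟩
    dsimp only at hj
    omega
  refine ⟨ContinuousLinearEquiv.equivOfInverse
    (S₁.comp (ContinuousLinearMap.fst 𝕜 Z Z) + S₂.comp (ContinuousLinearMap.snd 𝕜 Z Z))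
    (R₁.prod R₂) ?_ ?_⟩
  · rintro ⟨y, z⟩
    refine Prod.ext (h.ext fun i => ?_) (h.ext fun i => ?_)
    · simp [hR₁, hS₁, hS₂' _ (e1 i)]
    · simp [hR₂, hS₂, hS₁' _ (e2 i)]
  · intro z
    refine h.ext fun i => ?_
    rcases Nat.even_or_odd' i with ⟨j, rfl | rfl⟩
    · simp [hR₁, hS₁, hS₂' _ (e1 j)]
    · simp [hR₂, hS₂, hS₁' _ (e2 j)]

/-- Splitting off the first coordinate of a space of sequences. -/
theorem IsSeqSum.nonempty_prod (h : IsSeqSum p ι π) : Nonempty ((X × Z) ≃L[𝕜] Z) := by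
  obtain ⟨R, S, hR, hS, hS'⟩ := h.reindex Nat.succ Nat.succ_injective
  have h0 : 0 ∉ Set.range Nat.succ := by
    rintro ⟨j, hj⟩
    exact Nat.succ_ne_zero j hj
  refine ⟨ContinuousLinearEquiv.equivOfInverse
    ((ι 0).comp (ContinuousLinearMap.fst 𝕜 X Z) + S.comp (ContinuousLinearMap.snd 𝕜 X Z))
    ((π 0).prod R) ?_ ?_⟩
  · rintro ⟨x, z⟩
    refine Prod.ext ?_ (h.ext fun i => ?_)
    · simp [h.coord_embed, hS' 0 h0]
    · have := hS i z
      rw [Nat.succ_eq_add_one] at this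
      simp [h.coord_embed, hR, this]
  · intro z
    refine h.ext fun i => ?_
    rcases i with _ | i
    · simp [h.coord_embed, hS' 0 h0]
    · have := hS i (R z)
      rw [Nat.succ_eq_add_one] at this
      simp [h.coord_embed, hR, this]

end SeqSum

/-! ### The spaces `ℓ_p(X)` and `c₀(X)` -/

section ExtendByZero

variable {𝕜 : Type v} [RCLike 𝕜] {X : Type u} [NormedAddCommGroup X] [NormedSpace 𝕜 X]

/-- Moving the terms of a sequence along `e`, with zeros elsewhere. -/
noncomputable def extendByZero (𝕜 : Type v) [RCLike 𝕜] (X : Type u) [NormedAddCommGroup X]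
    [NormedSpace 𝕜 X] (e : ℕ → ℕ) : (ℕ → X) →ₗ[𝕜] (ℕ → X) where
  toFun x := Function.extend e x 0
  map_add' x y := by simpa using Function.extend_add e x y 0 0
  map_smul' c x := by simpa using Function.extend_smul c e x 0

theorem extendByZero_apply {e : ℕ → ℕ} (he : Function.Injective e) (x : ℕ → X) (i : ℕ) :
    extendByZero 𝕜 X e x (e i) = x i :=
  he.extend_apply x (0 : ℕ → X) i

theorem extendByZero_apply_of_notMem {e : ℕ → ℕ} {j : ℕ} (hj : j ∉ Set.range e) (x : ℕ → X) :
    extendByZero 𝕜 X e x j = 0 :=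
  Function.extend_apply' x (0 : ℕ → X) j (by simpa using hj)

end ExtendByZero

section Lp

variable {𝕜 : Type v} [RCLike 𝕜] {X : Type u} [NormedAddCommGroup X] [NormedSpace 𝕜 X]
  {p : ℝ≥0∞} [Fact (1 ≤ p)]

/-- A continuous linear map on a space `ℓ_p(X)`, given by a linear map on sequences that does not
increase sums of powers of norms. -/
theorem exists_lp_map (hp : p ≠ ∞) (T : (ℕ → X) →ₗ[𝕜] (ℕ → X))
    (hT : ∀ (x : ℕ → X) (s : Finset ℕ), ∃ t : Finset ℕ,
      ∑ i ∈ s, ‖T x i‖ ^ p.toReal ≤ ∑ i ∈ t, ‖x i‖ ^ p.toReal) :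
    ∃ R : lp (fun _ : ℕ => X) p →L[𝕜] lp (fun _ : ℕ => X) p,
      ∀ x i, R x i = T x i := by
  have hp' := toReal_pos_of_one_le hp
  have hb : ∀ (x : lp (fun _ : ℕ => X) p) (s : Finset ℕ),
      ∑ i ∈ s, ‖T x i‖ ^ p.toReal ≤ ‖x‖ ^ p.toReal := fun x s => by
    obtain ⟨t, ht⟩ := hT x s
    exact ht.trans (lp.sum_rpow_le_norm_rpow hp' x t)
  refine ⟨LinearMap.mkContinuous
    { toFun := fun x => ⟨T x, memℓp_gen' (hb x)⟩
      map_add' := fun x y => lp.ext (T.map_add x y)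
      map_smul' := fun c x => lp.ext (T.map_smul c x) } 1 fun x => ?_, fun x i => rfl⟩
  rw [one_mul]
  exact lp.norm_le_of_forall_sum_le hp' (norm_nonneg x) (hb x)

theorem isSeqSum_lp (hp : p ≠ ∞) :
    IsSeqSum p (fun i => lp.singleContinuousLinearMap 𝕜 (fun _ : ℕ => X) p i)
      (fun i => lp.evalCLM 𝕜 (fun _ : ℕ => X) p i) where
  coord_embed i j x := by
    change (lp.single p j x : lp (fun _ : ℕ => X) p) i = _
    rw [lp.single_apply, Pi.single_apply]
  norm_mono y z h := lp.norm_mono (zero_lt_one.trans_le Fact.out).ne' h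
  dense := by
    refine eq_top_iff.2 fun z _ => ?_
    refine mem_closure_of_tendsto (lp.hasSum_single hp z) (Eventually.of_forall fun s => ?_)
    exact Submodule.sum_mem _ fun i _ => (le_iSup (fun i => LinearMap.range
      (lp.singleContinuousLinearMap 𝕜 (fun _ : ℕ => X) p i).toLinearMap) i) ⟨z i, rfl⟩
  upper x y z h := by
    have hp' := toReal_pos_of_one_le hp
    rw [pairLpNorm, if_neg hp]
    have h0 : 0 ≤ ‖y‖ ^ p.toReal + ‖z‖ ^ p.toReal := by positivity
    refine lp.norm_le_of_forall_sum_le hp' (Real.rpow_nonneg h0 _) fun s => ?_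
    rw [← Real.rpow_mul h0, one_div_mul_cancel hp'.ne', Real.rpow_one]
    refine le_trans ?_ (add_le_add (lp.sum_rpow_le_norm_rpow hp' y s)
      (lp.sum_rpow_le_norm_rpow hp' z s))
    rw [← Finset.sum_add_distrib]
    refine Finset.sum_le_sum fun i _ => ?_
    have h1 := Real.rpow_le_rpow (norm_nonneg _) (h i) hp'.le
    rw [pairLpNorm, if_neg hp, ← Real.rpow_mul (by positivity), one_div_mul_cancel hp'.ne',
      Real.rpow_one] at h1
    exact h1
  reindex e he := by
    have hp' := toReal_pos_of_one_le hp
    obtain ⟨R, hR⟩ := exists_lp_map (p := p) (X := X) hp (LinearMap.funLeft 𝕜 X e) fun x s =>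
      ⟨s.map ⟨e, he⟩, by simp [LinearMap.funLeft_apply]⟩
    obtain ⟨S, hS⟩ := exists_lp_map (p := p) (X := X) hp (extendByZero 𝕜 X e) fun x s => by
      refine ⟨s.preimage e he.injOn, le_of_eq ?_⟩
      rw [← Finset.sum_preimage e s he.injOn]
      · simp [extendByZero_apply he]
      · intro i _ hi
        rw [extendByZero_apply_of_notMem hi, norm_zero, Real.zero_rpow hp'.ne']
    refine ⟨R, S, fun i z => hR z i, fun i z => ?_, fun j hj z => ?_⟩
    · change S z (e i) = z i
      rw [hS, extendByZero_apply he]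
    · change S z j = 0
      rw [hS, extendByZero_apply_of_notMem hj]

end Lp

section CZero

variable {𝕜 : Type v} [RCLike 𝕜] {X : Type u} [NormedAddCommGroup X] [NormedSpace 𝕜 X]

theorem ZeroAtInftyContinuousMap.norm_le_iff {f : C₀(ℕ, X)} {C : ℝ} (hC : 0 ≤ C) :
    ‖f‖ ≤ C ↔ ∀ i, ‖f i‖ ≤ C :=
  BoundedContinuousFunction.norm_le hC (f := f.toBCF)

theorem ZeroAtInftyContinuousMap.norm_apply_le (f : C₀(ℕ, X)) (i : ℕ) : ‖f i‖ ≤ ‖f‖ :=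
  (ZeroAtInftyContinuousMap.norm_le_iff (norm_nonneg f)).1 le_rfl i

/-- A sequence tending to zero, as an element of `c₀`. -/
def ofTendstoZero (f : ℕ → X) (hf : Tendsto f cofinite (𝓝 0)) : C₀(ℕ, X) where
  toFun := f
  continuous_toFun := continuous_of_discreteTopology
  zero_at_infty' := by rwa [cocompact_eq_cofinite]

@[simp]
theorem ofTendstoZero_apply (f : ℕ → X) (hf : Tendsto f cofinite (𝓝 0)) (i : ℕ) :
    ofTendstoZero f hf i = f i := rfl

theorem ZeroAtInftyContinuousMap.tendsto_cofinite (f : C₀(ℕ, X)) : Tendsto f cofinite (𝓝 0) := by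
  rw [← cocompact_eq_cofinite]
  exact f.zero_at_infty'

/-- A continuous linear map into `c₀(X)`, given by a contractive linear map to sequences. -/
theorem exists_cZero_map {Y : Type*} [NormedAddCommGroup Y] [NormedSpace 𝕜 Y]
    (T : Y →ₗ[𝕜] (ℕ → X)) (hT : ∀ y, Tendsto (T y) cofinite (𝓝 0))
    (hb : ∀ y i, ‖T y i‖ ≤ ‖y‖) : ∃ R : Y →L[𝕜] C₀(ℕ, X), ∀ y i, R y i = T y i := by
  refine ⟨LinearMap.mkContinuous
    { toFun := fun y => ofTendstoZero (T y) (hT y)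
      map_add' := fun x y => ZeroAtInftyContinuousMap.ext fun i => by simp
      map_smul' := fun c x => ZeroAtInftyContinuousMap.ext fun i => by simp } 1 fun y => ?_,
    fun y i => rfl⟩
  rw [one_mul]
  exact (ZeroAtInftyContinuousMap.norm_le_iff (norm_nonneg y)).2 (hb y)

/-- The underlying sequence of an element of `c₀`, as a linear map. -/
def cZeroCoe (𝕜 : Type v) [RCLike 𝕜] (X : Type u) [NormedAddCommGroup X] [NormedSpace 𝕜 X] :
    C₀(ℕ, X) →ₗ[𝕜] (ℕ → X) where
  toFun f := f
  map_add' _ _ := rfl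
  map_smul' _ _ := rfl

theorem exists_isSeqSum_cZero :
    ∃ (ι : ℕ → X →L[𝕜] C₀(ℕ, X)) (π : ℕ → C₀(ℕ, X) →L[𝕜] X), IsSeqSum ∞ ι π := by
  have hι : ∀ i, ∃ R : X →L[𝕜] C₀(ℕ, X), ∀ x j, R x j = (Pi.single i x : ℕ → X) j := by
    intro i
    refine exists_cZero_map (LinearMap.single 𝕜 (fun _ => X) i) (fun x => ?_) (fun x j => ?_)
    · refine tendsto_const_nhds.congr' ?_
      filter_upwards [(Set.finite_singleton i).compl_mem_cofinite] with j hj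
      simp [Pi.single_eq_of_ne (show j ≠ i from hj)]
    · by_cases h : j = i
      · subst h; simp
      · simp [h]
  choose ι hι using hι
  let π : ℕ → C₀(ℕ, X) →L[𝕜] X := fun i => LinearMap.mkContinuous
    (LinearMap.proj i ∘ₗ cZeroCoe 𝕜 X) 1 fun f => by
      rw [one_mul]; exact f.norm_apply_le i
  have hπ : ∀ i f, π i f = f i := fun _ _ => rfl
  refine ⟨ι, π, ?_, ?_, ?_, ?_, ?_⟩
  · intro i j x
    rw [hπ, hι, Pi.single_apply]
  · intro y z h
    exact (ZeroAtInftyContinuousMap.norm_le_iff (norm_nonneg z)).2 fun i =>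
      (h i).trans (z.norm_apply_le i)
  · refine eq_top_iff.2 fun z _ => Metric.mem_closure_iff.2 fun ε hε => ?_
    have h1 := z.tendsto_cofinite.eventually (Metric.ball_mem_nhds 0 (half_pos hε))
    let s := Set.Finite.toFinset (Filter.eventually_cofinite.1 h1)
    refine ⟨∑ i ∈ s, ι i (z i), Submodule.sum_mem _ fun i _ => (le_iSup (fun i => LinearMap.range
      (ι i).toLinearMap) i) ⟨z i, rfl⟩, ?_⟩
    rw [dist_eq_norm]
    refine lt_of_le_of_lt ((ZeroAtInftyContinuousMap.norm_le_iff (half_pos hε).le).2 fun i => ?_)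
      (half_lt_self hε)
    rw [← hπ, map_sub, map_sum]
    simp only [hπ, hι, Pi.single_apply]
    rw [Finset.sum_ite_eq]
    split_ifs with hi
    · rw [sub_self, norm_zero]; exact (half_pos hε).le
    · rw [sub_zero]
      simp only [s, Set.Finite.mem_toFinset, Set.mem_ofPred_eq, not_not, dist_zero_right] at hi
      exact hi.le
  · intro x y z h
    rw [pairLpNorm, if_pos rfl]
    refine (ZeroAtInftyContinuousMap.norm_le_iff ((norm_nonneg y).trans (le_max_left _ _))).2
      fun i => (h i).trans ?_
    rw [pairLpNorm, if_pos rfl]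
    exact max_le_max (y.norm_apply_le i) (z.norm_apply_le i)
  · intro e he
    obtain ⟨R, hR⟩ := exists_cZero_map (LinearMap.funLeft 𝕜 X e ∘ₗ cZeroCoe 𝕜 X)
      (fun f => f.tendsto_cofinite.comp he.tendsto_cofinite) (fun f i => f.norm_apply_le (e i))
    have h0 : ∀ f : C₀(ℕ, X), Tendsto (extendByZero 𝕜 X e f) cofinite (𝓝 0) := by
      intro f
      rw [Metric.tendsto_nhds]
      intro ε hε
      have h1 := Metric.tendsto_nhds.1 f.tendsto_cofinite ε hε
      refine ((Filter.eventually_cofinite.1 h1).image e).subset fun j hj => ?_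
      by_cases hje : j ∈ Set.range e
      · obtain ⟨i, rfl⟩ := hje
        refine ⟨i, ?_, rfl⟩
        simpa [extendByZero_apply he] using hj
      · exact absurd hj (by simp [extendByZero_apply_of_notMem (𝕜 := 𝕜) hje, hε])
    have hb : ∀ (f : C₀(ℕ, X)) i, ‖extendByZero 𝕜 X e f i‖ ≤ ‖f‖ := by
      intro f i
      by_cases hje : i ∈ Set.range e
      · obtain ⟨i, rfl⟩ := hje
        simpa [extendByZero_apply he] using f.norm_apply_le i
      · simp [extendByZero_apply_of_notMem hje]
    obtain ⟨S, hS⟩ := exists_cZero_map (extendByZero 𝕜 X e ∘ₗ cZeroCoe 𝕜 X) h0 hb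
    exact ⟨R, S, fun i z => hR z i, fun i z =>
      (hS z (e i)).trans (extendByZero_apply (𝕜 := 𝕜) he _ i),
      fun j hj z => (hS z j).trans (extendByZero_apply_of_notMem (𝕜 := 𝕜) hj _)⟩

end CZero

/-! ### The decomposition method -/

section Decomposition

variable {𝕜 : Type v} [RCLike 𝕜]

/-- Pełczyński's decomposition method: `X ≃ Y × Z ≃ Y × Z × Z ≃ X × Z ≃ Z`. -/
theorem nonempty_equiv_of_complemented {X Z : Type u} [NormedAddCommGroup X] [NormedSpace 𝕜 X]
    [NormedAddCommGroup Z] [NormedSpace 𝕜 Z] (α : Z →L[𝕜] X) (β : X →L[𝕜] Z)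
    (h : ∀ z, β (α z) = z) (e₁ : (Z × Z) ≃L[𝕜] Z) (e₂ : (X × Z) ≃L[𝕜] Z) :
    Nonempty (Z ≃L[𝕜] X) := by
  let e := ContinuousLinearEquiv.equivOfRightInverse β α h
  exact ⟨(e.trans (((e₁.symm.prodCongr (.refl 𝕜 _)).trans (.prodAssoc 𝕜 Z Z _)).trans
    ((((ContinuousLinearEquiv.refl 𝕜 Z).prodCongr e.symm).trans
      (.prodComm 𝕜 Z X)).trans e₂))).symm⟩

variable {W : Type u} [NormedAddCommGroup W] [NormedSpace 𝕜 W] {K : ℕ → Submodule 𝕜 W}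
  {p : ℝ≥0∞} [Fact (1 ≤ p)]

/-- The sum in `W` of an element of `c₀₀(K)`. -/
noncomputable def sumMap (K : ℕ → Submodule 𝕜 W) : (Π₀ n, K n) →ₗ[𝕜] W :=
  DFinsupp.lsum ℕ fun n => (K n).subtype

theorem sumMap_single (n : ℕ) (v : K n) : sumMap K (DFinsupp.single n v) = v := by
  simp [sumMap]

theorem sumMap_eq_sum {x : Π₀ n, K n} {N : ℕ} (hx : ∀ n ≥ N, x n = 0) :
    sumMap K x = ∑ n ∈ Finset.range N, (x n : W) := by
  have h : x = ∑ n ∈ Finset.range N, DFinsupp.single n (x n) := by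
    rw [DFinsupp.sum_single_apply]
    ext n
    rw [DFinsupp.filter_apply]
    split_ifs with hn
    · rfl
    · rw [hx n (by simpa using hn)]
  conv_lhs => rw [h]
  simp only [map_sum, sumMap_single]

theorem pressDownNorm_le_norm_sumMap (x : Π₀ n, K n) :
    pressDownNorm p K x ≤ ‖sumMap K x‖ := by
  obtain ⟨N, hN⟩ := exists_forall_ge_eq_zero x
  rw [sumMap_eq_sum hN]
  exact (pressDownNorm_le_bracket x).trans (pressDownBracket_le_norm x hN)

/-- The canonical operator `W → W_{∧,p}(K)`, which is the identity on `c₀₀(K)`. -/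
theorem exists_toPressDown [CompleteSpace W] (h : IsBimonotoneFDD K) :
    ∃ j : W →L[𝕜] PressDown p K, ∀ w, Tendsto (fun N : ℕ =>
      ((pressDownEquiv p K (∑ n ∈ Finset.range N, DFinsupp.single n ⟨h.proj n w, h.proj_mem n w⟩) :
        PressDownPre p K) : PressDown p K)) atTop (𝓝 (j w)) := by
  let t : Finset ℕ → W →ₗ[𝕜] PressDown p K := fun s =>
    (UniformSpace.Completion.toComplL : PressDownPre p K →L[𝕜] _).toLinearMap ∘ₗ
      (pressDownEquiv p K).toLinearMap ∘ₗ
        ∑ n ∈ s, DFinsupp.lsingle n ∘ₗ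
          (h.projL n).toLinearMap.codRestrict (K n) (fun w => h.proj_mem n w)
  have ht : ∀ s w, t s w = ((pressDownEquiv p K (∑ n ∈ s,
      DFinsupp.single n ⟨h.proj n w, h.proj_mem n w⟩) : PressDownPre p K) : PressDown p K) := by
    intro s w
    simp only [t, LinearMap.comp_apply, LinearMap.sum_apply]
    rfl
  have hn : ∀ s w, ‖t s w‖ ≤ ‖∑ n ∈ s, h.proj n w‖ := by
    intro s w
    rw [ht, UniformSpace.Completion.norm_coe, norm_pressDownEquiv]
    refine (pressDownNorm_le_norm_sumMap _).trans_eq ?_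
    simp only [map_sum, sumMap_single]
  let T : ℕ → W →L[𝕜] PressDown p K := fun N => (t (Finset.range N)).mkContinuous 1 fun w => by
    rw [one_mul, Finset.range_eq_Ico]
    exact (hn _ w).trans (h.norm_Ico_le 0 N w)
  have hT : ∀ N w, T N w = t (Finset.range N) w := fun _ _ => rfl
  have hdiff : ∀ M N w, M ≤ N → T N w - T M w = t (Finset.Ico M N) w := by
    intro M N w hMN
    rw [hT, hT, sub_eq_iff_eq_add']
    simp only [t, LinearMap.comp_apply, LinearMap.sum_apply]
    rw [← Finset.sum_range_add_sum_Ico _ hMN, map_add, map_add]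
  have hcau : ∀ w, CauchySeq fun N => T N w := by
    intro w
    refine Metric.cauchySeq_iff'.2 fun ε hε => ?_
    obtain ⟨M, hM⟩ := Metric.cauchySeq_iff'.1 (h.tendsto_sum_proj w).cauchySeq ε hε
    refine ⟨M, fun N hN => ?_⟩
    have := hM N hN
    rw [dist_eq_norm] at this ⊢
    rw [hdiff M N w hN]
    rw [← Finset.sum_Ico_eq_sub _ hN] at this
    exact (hn _ w).trans_lt this
  choose f hf using fun w => cauchySeq_tendsto_of_complete (hcau w)
  refine ⟨continuousLinearMapOfTendsto T (f := f) (tendsto_pi_nhds.2 hf), fun w => ?_⟩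
  simp only [← ht]
  exact hf w

/-- An operator into a space with an upper `p`-estimate that maps a subsequence of the
decomposition `K` to the decomposition `H` and vanishes on the other terms of `K` is bounded for
the press down norm. -/
theorem norm_le_pressDownNorm_of_hasUpperEstimate {Z : Type u} [NormedAddCommGroup Z]
    [NormedSpace 𝕜 Z] {H : ℕ → Submodule 𝕜 Z} {Q : ℕ → Z →L[𝕜] Z} (hQ : IsBimonotoneSystem H Q)
    (hU : HasUpperEstimate p Q) {m : ℕ → ℕ} (hm : StrictMono m) (β : W →L[𝕜] Z) {C : ℝ}
    (hC : 0 ≤ C) (hβ : ∀ w, ‖β w‖ ≤ C * ‖w‖) (h1 : ∀ n, ∀ w ∈ K (m n), β w ∈ H n)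
    (h2 : ∀ k ∉ Set.range m, ∀ w ∈ K k, β w = 0) (x : Π₀ n, K n) :
    ‖β (sumMap K x)‖ ≤ C * pressDownNorm p K x := by
  -- the partial sums of the expansion of the image of a term
  have hsum : ∀ {a c : ℕ}, (∀ k, m k < a ↔ k < c) → ∀ k, ∀ w ∈ K k,
      ∑ n ∈ Finset.range c, Q n (β w) = if k < a then β w else 0 := by
    intro a c hac k w hw
    by_cases hk : k ∈ Set.range m
    · obtain ⟨i, rfl⟩ := hk
      have hz := h1 i w hw
      have : ∀ n, Q n (β w) = if i = n then β w else 0 := fun n => by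
        by_cases hin : i = n
        · subst hin; rw [if_pos rfl, hQ.apply_of_mem i _ hz]
        · rw [if_neg hin, hQ.apply_of_mem_ne i n hin _ hz]
      simp only [this, Finset.sum_ite_eq, Finset.mem_range, hac]
    · simp [h2 k hk w hw]
  have hseg : ∀ {a c b : ℕ}, a ≤ b → (∀ k, m k < a ↔ k < c) → ∀ y : Π₀ n, K n,
      ∑ n ∈ Finset.range c, Q n (β (∑ k ∈ Finset.range b, (y k : W))) =
        β (∑ k ∈ Finset.range a, (y k : W)) := by
    intro a c b hab hac y
    simp only [map_sum]
    rw [Finset.sum_comm]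
    simp only [hsum hac _ _ (y _).2]
    rw [← Finset.sum_filter]
    congr 1
    ext k
    simp only [Finset.mem_filter, Finset.mem_range]
    omega
  have hbr : ∀ y : Π₀ n, K n, ‖β (sumMap K y)‖ ≤ C * pressDownBracket p K y := by
    intro y
    rcases hC.eq_or_lt with rfl | hC'
    · simpa using hβ (sumMap K y)
    rw [← div_le_iff₀' hC']
    refine le_pressDownBracket fun e he h0 => ?_
    obtain ⟨N, hN⟩ := exists_forall_ge_eq_zero y
    rw [div_le_iff₀' hC', ← seqLpNorm_smul p Fact.out C hC]
    have hfin : ∀ n ≥ e N, y n = 0 := fun n hn => hN n (he.le_apply.trans hn)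
    rw [sumMap_eq_sum hfin]
    refine le_seqLpNorm_of_le_pairLpNorm (N := N)
      (F := fun i => ‖β (∑ n ∈ Finset.range (e i), (y n : W))‖)
      (fun i hi => by rw [sum_Ico_start_eq_zero hN he i hi, mul_zero])
      (fun i => by positivity) (fun i => norm_nonneg _) (by simp [h0]) (fun i => ?_) N
    obtain ⟨c, hc⟩ := exists_strictMono_lt_iff hm (e i)
    obtain ⟨d, hd⟩ := exists_strictMono_lt_iff hm (e (i + 1))
    have hei : e i ≤ e (i + 1) := (he i.lt_succ_self).le
    have hcd : c ≤ d := by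
      by_contra hlt
      exact absurd ((hd d).1 (((hc d).2 (not_le.1 hlt)).trans_le hei)) (lt_irrefl _)
    have := hU c d hcd (β (∑ n ∈ Finset.range (e (i + 1)), (y n : W)))
    rw [Finset.sum_Ico_eq_sub _ hcd, hseg le_rfl hd, hseg hei hc, ← map_sub,
      ← Finset.sum_Ico_eq_sub _ hei] at this
    exact this.trans (pairLpNorm_mono (norm_nonneg _) (norm_nonneg _) le_rfl (hβ _))
  rcases hC.eq_or_lt with rfl | hC'
  · simpa using hβ (sumMap K x)
  rw [← div_le_iff₀' hC']
  refine le_csInf (pressDownNorm_nonempty p K x) ?_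
  rintro r ⟨l, w, rfl, rfl⟩
  rw [div_le_iff₀' hC', Finset.mul_sum, map_sum, map_sum]
  exact (norm_sum_le _ _).trans (Finset.sum_le_sum fun i _ => hbr (w i))

/-- If `Z` is an `ℓ_p`-sum or a `c₀`-sum of copies of the press down space of a complementably
universal space `W`, then `W` itself serves as a link: it contains `Z` as a complemented subspace,
and the projection onto `Z` factors through the press down space. -/
theorem IsSchechtmanSpace.nonempty_equiv_pressDown {J : ℕ → Type u} [∀ n, NormedAddCommGroup (J n)]
    [∀ n, NormedSpace 𝕜 (J n)] [CompleteSpace W] (hK : IsSchechtmanSpace 𝕜 J K)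
    {Z : Type u} [NormedAddCommGroup Z] [NormedSpace 𝕜 Z] [CompleteSpace Z]
    {ι : ℕ → PressDown p K →L[𝕜] Z} {π : ℕ → Z →L[𝕜] PressDown p K} (hZ : IsSeqSum p ι π) :
    Nonempty (Z ≃L[𝕜] PressDown p K) := by
  have hB := hK.isBimonotoneFDD
  have hfd : ∀ n, FiniteDimensional 𝕜 (K n) := hB.finiteDimensional
  have hX := (hB.isIntervalMonotone_pressDown (p := p)).isBimonotoneSystem
  have hXu := hB.hasUpperEstimate_pressDown (p := p)
  have hQ := hZ.isBimonotoneSystem hX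
  have hU := hZ.hasUpperEstimate hXu
  obtain ⟨m, A, P, hm, hmap, hA, hran, hP1, hP⟩ := hK.universal Z _
    (hZ.isBimonotoneFDD hX (fun n => inferInstance) hB.complTerm_pressDown_ne_bot)
  have hinj : Function.Injective A := by
    refine (injective_iff_map_eq_zero A).2 fun z hz => ?_
    have := (hA z).1
    rw [hz, norm_zero] at this
    exact norm_le_zero_iff.1 (by linarith)
  have hPran : ∀ w, P w ∈ LinearMap.range (A : Z →ₗ[𝕜] W) := by
    intro w
    rw [hran]
    refine mem_closure_of_tendsto (hP w) (Eventually.of_forall fun N => ?_)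
    exact Submodule.sum_mem _ fun n _ => (le_iSup (fun n => K (m n)) n) (hB.proj_mem _ _)
  have hPK : ∀ k, ∀ w ∈ K k, k ∉ Set.range m → P w = 0 := by
    intro k w hw hk
    refine tendsto_nhds_unique (hP w) ?_
    have : ∀ n, hB.proj (m n) w = 0 := fun n => by
      rw [hB.proj_of_mem hw, if_neg]
      exact fun h => hk ⟨n, h⟩
    simp [this]
  have hPK' : ∀ n, ∀ w ∈ K (m n), P w = w := by
    intro n w hw
    refine tendsto_nhds_unique (hP w) (tendsto_const_nhds.congr' ?_)
    filter_upwards [eventually_gt_atTop n] with N hN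
    simp only [hB.proj_of_mem hw, hm.injective.eq_iff]
    rw [Finset.sum_ite_eq' , if_pos (Finset.mem_range.2 hN)]
  -- `β₀ = A⁻¹ P` is defined on `W`, and `β` is its extension to the press down space
  let E : Z ≃ₗ[𝕜] LinearMap.range (A : Z →ₗ[𝕜] W) := LinearEquiv.ofInjective (A : Z →ₗ[𝕜] W) hinj
  have hE : ∀ y, A (E.symm y) = y := fun y => by
    have := LinearEquiv.apply_symm_apply E y
    exact congrArg Subtype.val this
  let β₀' : W →ₗ[𝕜] Z := E.symm.toLinearMap ∘ₗ (P : W →ₗ[𝕜] W).codRestrict _ hPran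
  have hAβ' : ∀ w, A (β₀' w) = P w := fun w => hE _
  have hb : ∀ w, ‖β₀' w‖ ≤ 2 * ‖w‖ := by
    intro w
    have h1 := (hA (β₀' w)).1
    have h2 := P.le_of_opNorm_le hP1 w
    rw [hAβ'] at h1
    linarith
  let β₀ : W →L[𝕜] Z := β₀'.mkContinuous 2 hb
  have hAβ : ∀ w, A (β₀ w) = P w := hAβ'
  have hβ1 : ∀ n, ∀ w ∈ K (m n), β₀ w ∈ sumTerm ι (complTerm (pressDownEquiv p K)) n := by
    intro n w hw
    rw [← hmap n] at hw
    obtain ⟨z, hz, rfl⟩ := hw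
    have : β₀ (A z) = z := hinj (by
      rw [hAβ, hPK' n]
      rw [← hmap n]
      exact Submodule.mem_map_of_mem hz)
    simpa [this] using hz
  have hβ2 : ∀ k ∉ Set.range m, ∀ w ∈ K k, β₀ w = 0 := by
    intro k hk w hw
    exact hinj (by rw [hAβ, hPK k w hw hk, map_zero])
  have hbd := norm_le_pressDownNorm_of_hasUpperEstimate hQ hU hm β₀ zero_le_two hb hβ1 hβ2
  let β : PressDown p K →L[𝕜] Z := extendCompl (LinearMap.mkContinuous
    ((β₀ : W →ₗ[𝕜] Z) ∘ₗ sumMap K ∘ₗ (pressDownEquiv p K).symm.toLinearMap) 2 fun x =>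
      hbd ((pressDownEquiv p K).symm x))
  have hβ : ∀ x : Π₀ n, K n, β (pressDownEquiv p K x : PressDownPre p K) = β₀ (sumMap K x) :=
    fun x => extendCompl_coe _ _
  obtain ⟨j, hj⟩ := exists_toPressDown (p := p) hB
  have hβj : ∀ w, β (j w) = β₀ w := by
    intro w
    have h1 := (β.continuous.tendsto _).comp (hj w)
    have h2 := (β₀.continuous.tendsto _).comp (hB.tendsto_sum_proj w)
    refine tendsto_nhds_unique h1 (h2.congr fun N => ?_)
    simp only [Function.comp_apply, hβ]
    simp only [map_sum, sumMap_single]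
  have hPA : ∀ z, P (A z) = A z := by
    have hle : (⨆ n, sumTerm ι (complTerm (pressDownEquiv p K)) n).topologicalClosure ≤
        LinearMap.eqLocus ((P : W →ₗ[𝕜] W) ∘ₗ (A : Z →ₗ[𝕜] W)) (A : Z →ₗ[𝕜] W) := by
      refine Submodule.topologicalClosure_minimal _ (iSup_le fun n z hz => ?_) ?_
      · refine hPK' n _ ?_
        rw [← hmap n]
        exact Submodule.mem_map_of_mem hz
      · exact isClosed_eq (P.continuous.comp A.continuous) A.continuous
    rw [hQ.dense] at hle
    exact fun z => hle (Submodule.mem_top (x := z))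
  obtain ⟨e₁⟩ := hZ.nonempty_prod_self
  obtain ⟨e₂⟩ := hZ.nonempty_prod
  refine nonempty_equiv_of_complemented (j.comp A) β (fun z => ?_) e₁ e₂
  rw [ContinuousLinearMap.comp_apply, hβj]
  exact hinj (by rw [hAβ, hPA])

end Decomposition

/-! ### Approximation of finite dimensional spaces -/

section Close

variable {𝕜 : Type v} [RCLike 𝕜]

/-- The spaces `(E, r)` and `(F, s)` are isomorphic with distortion at most `c`; the isomorphism is
normalized to be a contraction. -/
def IsClose {E F : Type*} [AddCommGroup E] [Module 𝕜 E] [AddCommGroup F] [Module 𝕜 F] (c : ℝ)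
    (r : Seminorm 𝕜 E) (s : Seminorm 𝕜 F) : Prop :=
  ∃ T : E ≃ₗ[𝕜] F, ∀ v, s (T v) ≤ r v ∧ r v ≤ c * s (T v)

section

variable {E F G : Type*} [AddCommGroup E] [Module 𝕜 E] [AddCommGroup F] [Module 𝕜 F]
  [AddCommGroup G] [Module 𝕜 G] {r : Seminorm 𝕜 E} {s : Seminorm 𝕜 F} {t : Seminorm 𝕜 G} {c d : ℝ}

theorem IsClose.mono (h : IsClose c r s) (hcd : c ≤ d) : IsClose d r s := by
  obtain ⟨T, hT⟩ := h
  exact ⟨T, fun v => ⟨(hT v).1, (hT v).2.trans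
    (mul_le_mul_of_nonneg_right hcd (apply_nonneg s _))⟩⟩

theorem IsClose.trans (h : IsClose c r s) (h' : IsClose d s t) (hc : 0 ≤ c) :
    IsClose (c * d) r t := by
  obtain ⟨T, hT⟩ := h
  obtain ⟨S, hS⟩ := h'
  refine ⟨T.trans S, fun v => ⟨(hS _).1.trans (hT v).1, (hT v).2.trans ?_⟩⟩
  rw [mul_assoc]
  exact mul_le_mul_of_nonneg_left (hS _).2 hc

theorem IsClose.symm (h : IsClose c r s) (hc : 0 < c) : IsClose c s r := by
  obtain ⟨T, hT⟩ := h
  have hc' : ((c : ℝ) : 𝕜)⁻¹ ≠ 0 := inv_ne_zero (RCLike.ofReal_ne_zero.2 hc.ne')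
  refine ⟨T.symm.trans (LinearEquiv.smulOfNeZero 𝕜 E _ hc'), fun w => ?_⟩
  have h1 := hT (T.symm w)
  rw [LinearEquiv.apply_symm_apply] at h1
  have h2 : r ((T.symm.trans (LinearEquiv.smulOfNeZero 𝕜 E _ hc')) w) = c⁻¹ * r (T.symm w) := by
    rw [LinearEquiv.trans_apply, LinearEquiv.smulOfNeZero_apply, map_smul_eq_mul, norm_inv,
      RCLike.norm_ofReal, abs_of_pos hc]
  rw [h2, mul_inv_cancel_left₀ hc.ne', inv_mul_le_iff₀ hc]
  exact ⟨h1.2, h1.1⟩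

theorem isClose_of_le {r s : Seminorm 𝕜 E} (h1 : ∀ v, s v ≤ r v) (h2 : ∀ v, r v ≤ c * s v) :
    IsClose c r s :=
  ⟨LinearEquiv.refl 𝕜 E, fun v => ⟨h1 v, h2 v⟩⟩

end

theorem IsBanachMazurDense.exists_isClose {J : ℕ → Type u} [∀ n, NormedAddCommGroup (J n)]
    [∀ n, NormedSpace 𝕜 (J n)] (hJ : IsBanachMazurDense 𝕜 J) {E : Type u} [AddCommGroup E]
    [Module 𝕜 E] [FiniteDimensional 𝕜 E] [Nontrivial E] (r : Seminorm 𝕜 E)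
    (hr : ∀ v, r v = 0 → v = 0) {c : ℝ} (hc : 1 < c) :
    ∃ n, IsClose c r (normSeminorm 𝕜 (J n)) := by
  let _ : NormedAddCommGroup E := AddGroupNorm.toNormedAddCommGroup
    { r.toAddGroupSeminorm with eq_zero_of_map_eq_zero' := hr }
  let _ : NormedSpace 𝕜 E := { norm_smul_le := fun a v => (map_smul_eq_mul r a v).le }
  have hn : ∀ v : E, ‖v‖ = r v := fun _ => rfl
  obtain ⟨n, hlt⟩ := hJ E (ENNReal.ofReal c) (by simpa using hc)
  obtain ⟨T, hT⟩ := iInf_lt_iff.1 hlt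
  refine ⟨n, ?_⟩
  have hT' := (ENNReal.ofReal_lt_ofReal_iff (zero_lt_one.trans hc)).1 hT
  have hT0 : 0 < ‖(T : E →L[𝕜] J n)‖ := by
    obtain ⟨v, hv⟩ := exists_ne (0 : E)
    rw [norm_pos_iff]
    intro h0
    apply hv
    rw [← T.symm_apply_apply v]
    have : T v = 0 := by
      rw [← ContinuousLinearEquiv.coe_coe, h0]; rfl
    rw [this, map_zero]
  have ha : ((‖(T : E →L[𝕜] J n)‖ : ℝ) : 𝕜)⁻¹ ≠ 0 := inv_ne_zero (RCLike.ofReal_ne_zero.2 hT0.ne')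
  refine ⟨T.toLinearEquiv.trans (LinearEquiv.smulOfNeZero 𝕜 (J n) _ ha), fun v => ?_⟩
  have h2 : (normSeminorm 𝕜 (J n)) ((T.toLinearEquiv.trans
      (LinearEquiv.smulOfNeZero 𝕜 (J n) _ ha)) v) = ‖(T : E →L[𝕜] J n)‖⁻¹ * ‖T v‖ := by
    rw [LinearEquiv.trans_apply, LinearEquiv.smulOfNeZero_apply, map_smul_eq_mul, norm_inv,
      RCLike.norm_ofReal, abs_norm]
    rfl
  rw [h2, ← hn, inv_mul_le_iff₀ hT0]
  refine ⟨(T : E →L[𝕜] J n).le_opNorm v, ?_⟩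
  have h3 : ‖v‖ ≤ ‖(T.symm : J n →L[𝕜] E)‖ * ‖T v‖ := by
    simpa using (T.symm : J n →L[𝕜] E).le_opNorm (T v)
  calc ‖v‖ ≤ ‖(T.symm : J n →L[𝕜] E)‖ * ‖T v‖ := h3
    _ = (‖(T : E →L[𝕜] J n)‖ * ‖(T.symm : J n →L[𝕜] E)‖) *
        (‖(T : E →L[𝕜] J n)‖⁻¹ * ‖T v‖) := by field_simp
    _ ≤ _ := mul_le_mul_of_nonneg_right hT'.le (by positivity)

/-- One-dimensional normed spaces are isometric. -/
theorem isClose_one_of_finrank_eq_one {E F : Type*} [NormedAddCommGroup E] [NormedSpace 𝕜 E]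
    [NormedAddCommGroup F] [NormedSpace 𝕜 F] (hE : Module.finrank 𝕜 E = 1)
    (hF : Module.finrank 𝕜 F = 1) : IsClose 1 (normSeminorm 𝕜 E) (normSeminorm 𝕜 F) := by
  have : FiniteDimensional 𝕜 E := Module.finite_of_finrank_pos (by omega)
  have : FiniteDimensional 𝕜 F := Module.finite_of_finrank_pos (by omega)
  obtain ⟨u, hu, hspan⟩ := finrank_eq_one_iff'.1 hE
  let T : E ≃ₗ[𝕜] F := LinearEquiv.ofFinrankEq E F (hE.trans hF.symm)
  have hTu : 0 < ‖T u‖ := norm_pos_iff.2 fun h => hu (by simpa using h)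
  have hu' : 0 < ‖u‖ := norm_pos_iff.2 hu
  have ha : ((‖u‖ / ‖T u‖ : ℝ) : 𝕜) ≠ 0 := RCLike.ofReal_ne_zero.2 (div_pos hu' hTu).ne'
  refine ⟨T.trans (LinearEquiv.smulOfNeZero 𝕜 F _ ha), fun v => ?_⟩
  obtain ⟨a, rfl⟩ := hspan v
  have : (normSeminorm 𝕜 F) ((T.trans (LinearEquiv.smulOfNeZero 𝕜 F _ ha)) (a • u)) =
      ‖a • u‖ := by
    rw [LinearEquiv.trans_apply, LinearEquiv.smulOfNeZero_apply, map_smul_eq_mul,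
      RCLike.norm_ofReal, abs_of_pos (div_pos hu' hTu), map_smul, map_smul_eq_mul, norm_smul]
    simp only [coe_normSeminorm]
    field_simp
  rw [this, one_mul]
  exact ⟨le_rfl, le_rfl⟩

section Hypot

variable {E : Type*} [AddCommGroup E] [Module 𝕜 E]

/-- The seminorm `√(r² + s²)`. -/
noncomputable def hypotSeminorm (r s : Seminorm 𝕜 E) : Seminorm 𝕜 E :=
  Seminorm.of (fun v => √(r v ^ 2 + s v ^ 2))
    (fun v w => by
      have hv := Real.sq_sqrt (show 0 ≤ r v ^ 2 + s v ^ 2 by positivity)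
      have hw := Real.sq_sqrt (show 0 ≤ r w ^ 2 + s w ^ 2 by positivity)
      have h1 : r v * r w + s v * s w ≤ √(r v ^ 2 + s v ^ 2) * √(r w ^ 2 + s w ^ 2) := by
        rw [← Real.sqrt_mul (by positivity)]
        refine Real.le_sqrt_of_sq_le ?_
        nlinarith [sq_nonneg (r v * s w - s v * r w)]
      have h2 := pow_le_pow_left₀ (apply_nonneg r _) (map_add_le_add r v w) 2
      have h3 := pow_le_pow_left₀ (apply_nonneg s _) (map_add_le_add s v w) 2
      refine Real.sqrt_le_iff.2 ⟨by positivity, ?_⟩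
      nlinarith)
    (fun a v => by
      rw [map_smul_eq_mul, map_smul_eq_mul, mul_pow, mul_pow, ← mul_add,
        Real.sqrt_mul (by positivity), Real.sqrt_sq (norm_nonneg a)])

theorem hypotSeminorm_sq (r s : Seminorm 𝕜 E) (v : E) :
    hypotSeminorm r s v ^ 2 = r v ^ 2 + s v ^ 2 :=
  Real.sq_sqrt (by positivity)

theorem le_hypotSeminorm (r s : Seminorm 𝕜 E) (v : E) : r v ≤ hypotSeminorm r s v :=
  Real.le_sqrt_of_sq_le (le_add_of_nonneg_right (sq_nonneg _))

theorem hypotSeminorm_le (r s : Seminorm 𝕜 E) (v : E) : hypotSeminorm r s v ≤ r v + s v := by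
  have hr := apply_nonneg r v
  have hs := apply_nonneg s v
  refine Real.sqrt_le_iff.2 ⟨add_nonneg hr hs, ?_⟩
  nlinarith

end Hypot

/-- A norm whose sphere contains a segment is not arbitrarily close to a norm that satisfies a
quantitative form of strict convexity. -/
theorem exists_not_isClose_of_segment {E : Type*} [AddCommGroup E] [Module 𝕜 E]
    {r₀ r q : Seminorm 𝕜 E} {κ ρ : ℝ} (hκ : 0 < κ) (hq : ∀ v, κ * r v ≤ q v)
    (hr : ∀ v w, r (v + w) ^ 2 + q (v - w) ^ 2 ≤ 2 * (r v ^ 2 + r w ^ 2)) {x y : E}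
    (hx : r₀ (x + y) = ρ) (hx' : r₀ (x - y) = ρ) (hx0 : r₀ x = ρ) (hy : 0 < r₀ y) :
    ∃ d, 1 < d ∧ ¬ IsClose d r r₀ := by
  by_contra! h
  have key : ∀ d : ℝ, 1 < d → (κ * r₀ y) ^ 2 ≤ (d ^ 2 - 1) * ρ ^ 2 := by
    intro d hd
    obtain ⟨T, hT⟩ := h d hd
    have hρ : 0 ≤ ρ := hx0 ▸ apply_nonneg r₀ x
    have h1 := hT (T.symm (x + y))
    have h2 := hT (T.symm (x - y))
    have h3 := hT (T.symm (x + y) + T.symm (x - y))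
    have h4 := hT (T.symm (x + y) - T.symm (x - y))
    have e3 : T.symm (x + y) + T.symm (x - y) = T.symm ((2 : 𝕜) • x) := by
      rw [← map_add]; congr 1; rw [two_smul]; abel
    have e4 : T.symm (x + y) - T.symm (x - y) = T.symm ((2 : 𝕜) • y) := by
      rw [← map_sub]; congr 1; rw [two_smul]; abel
    rw [LinearEquiv.apply_symm_apply] at h1 h2
    rw [e3, LinearEquiv.apply_symm_apply, map_smul_eq_mul, RCLike.norm_two, hx0] at h3
    rw [e4, LinearEquiv.apply_symm_apply, map_smul_eq_mul, RCLike.norm_two] at h4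
    rw [hx] at h1
    rw [hx'] at h2
    have h5 := hr (T.symm (x + y)) (T.symm (x - y))
    rw [e3, e4] at h5
    have h6 := hq (T.symm ((2 : 𝕜) • y))
    have h7 : κ * (2 * r₀ y) ≤ q (T.symm ((2 : 𝕜) • y)) :=
      (mul_le_mul_of_nonneg_left h4.1 hκ.le).trans h6
    have h8 := pow_le_pow_left₀ (by positivity) h7 2
    have h9 := pow_le_pow_left₀ (by positivity) h3.1 2
    have h10 := pow_le_pow_left₀ (apply_nonneg r _) h1.2 2
    have h11 := pow_le_pow_left₀ (apply_nonneg r _) h2.2 2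
    nlinarith
  have hlim : Tendsto (fun d : ℝ => (d ^ 2 - 1) * ρ ^ 2) (𝓝[>] 1) (𝓝 0) := by
    have hc : Continuous fun d : ℝ => (d ^ 2 - 1) * ρ ^ 2 := by fun_prop
    have := hc.tendsto 1
    simp only [one_pow, sub_self, zero_mul] at this
    exact this.mono_left nhdsWithin_le_nhds
  have := ge_of_tendsto hlim (b := (κ * r₀ y) ^ 2) (by
    filter_upwards [self_mem_nhdsWithin] with d hd using key d hd)
  have : 0 < (κ * r₀ y) ^ 2 := by positivity
  linarith

end Close

/-! ### Terms of a dense sequence recur -/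

section Recurrence

variable {𝕜 : Type v} [RCLike 𝕜]

/-- A norm on a space of dimension at least two can be approximated by norms whose spheres contain
segments. -/
theorem exists_segment_norm {E : Type*} [NormedAddCommGroup E] [NormedSpace 𝕜 E]
    [FiniteDimensional 𝕜 E] (hE : 2 ≤ Module.finrank 𝕜 E) {ε : ℝ} (hε : 0 < ε) :
    ∃ (r : Seminorm 𝕜 E) (x y : E), (∀ v, ‖v‖ ≤ r v) ∧ (∀ v, r v ≤ (1 + ε) * ‖v‖) ∧
      r (x + y) = r x ∧ r (x - y) = r x ∧ y ≠ 0 := by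
  have : Nontrivial E := Module.nontrivial_of_finrank_pos (R := 𝕜) (by omega)
  obtain ⟨x, hx⟩ := exists_ne (0 : E)
  obtain ⟨g, hg, hgx⟩ := exists_dual_vector 𝕜 x (norm_ne_zero_iff.2 hx)
  have hker : LinearMap.ker (g : E →ₗ[𝕜] 𝕜) ≠ ⊥ := by
    intro hbot
    have h1 := LinearMap.finrank_range_add_finrank_ker (g : E →ₗ[𝕜] 𝕜)
    have h2 := Submodule.finrank_le (LinearMap.range (g : E →ₗ[𝕜] 𝕜))
    rw [hbot, finrank_bot, Module.finrank_self] at *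
    omega
  obtain ⟨y, hy, hy0⟩ := Submodule.exists_mem_ne_zero_of_ne_bot hker
  have hgy : g y = 0 := hy
  have hx' : 0 < ‖x‖ := norm_pos_iff.2 hx
  have hy' : 0 < ‖y‖ := norm_pos_iff.2 hy0
  let f : E →ₗ[𝕜] 𝕜 := ((1 + ε : ℝ) : 𝕜) • (g : E →ₗ[𝕜] 𝕜)
  have hf : ∀ v, ‖f v‖ = (1 + ε) * ‖g v‖ := fun v => by
    change ‖((1 + ε : ℝ) : 𝕜) • g v‖ = _
    rw [norm_smul, RCLike.norm_ofReal, abs_of_pos (by positivity)]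
  let r : Seminorm 𝕜 E := normSeminorm 𝕜 E ⊔ (normSeminorm 𝕜 𝕜).comp f
  have hr : ∀ v, r v = max ‖v‖ ((1 + ε) * ‖g v‖) := fun v => by
    rw [← hf]; rfl
  -- a vector in the kernel of the functional, small enough to be negligible near `x`
  let t : 𝕜 := ((ε * ‖x‖ / ‖y‖ : ℝ) : 𝕜)
  have ht : ‖t • y‖ = ε * ‖x‖ := by
    rw [norm_smul, RCLike.norm_ofReal, abs_of_pos (by positivity), div_mul_cancel₀ _ hy'.ne']
  have hgx' : ‖g x‖ = ‖x‖ := by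
    rw [hgx, RCLike.norm_ofReal, abs_norm]
  have hval : ∀ v, ‖v‖ ≤ (1 + ε) * ‖x‖ → g v = g x → r v = (1 + ε) * ‖x‖ := by
    intro v hv hgv
    rw [hr, hgv, hgx', max_eq_right hv]
  have hrx : r x = (1 + ε) * ‖x‖ := hval x (by nlinarith) rfl
  refine ⟨r, x, t • y, fun v => ?_, fun v => ?_, ?_, ?_, ?_⟩
  · rw [hr]; exact le_max_left _ _
  · rw [hr]
    refine max_le (by nlinarith [norm_nonneg v]) (mul_le_mul_of_nonneg_left ?_ (by positivity))
    simpa [hg] using g.le_opNorm v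
  · rw [hrx]
    refine hval _ ((norm_add_le _ _).trans_eq ?_) (by simp [hgy])
    rw [ht]; ring
  · rw [hrx]
    refine hval _ ((norm_sub_le _ _).trans_eq ?_) (by simp [hgy])
    rw [ht]; ring
  · intro h0
    rw [h0, norm_zero] at ht
    exact absurd ht (by positivity)

/-- Each finite dimensional space is approximated by infinitely many terms of the sequence. In
dimension at least two, a space with only finitely many approximants would be approximated by
norms `rₜ → r₀`, where the sphere of `r₀` contains a segment and the `rₜ` are uniformly convex. By
the pigeonhole principle some `rₜ` would be almost isometric to `r₀`. -/
theorem IsBanachMazurDense.frequently_isClose {J : ℕ → Type u} [∀ n, NormedAddCommGroup (J n)]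
    [∀ n, NormedSpace 𝕜 (J n)] (hJ : IsBanachMazurDense 𝕜 J)
    (hJ1 : {n | Module.finrank 𝕜 (J n) = 1}.Infinite) {E : Type u} [NormedAddCommGroup E]
    [NormedSpace 𝕜 E] [FiniteDimensional 𝕜 E] [Nontrivial E] {c : ℝ} (hc : 1 < c) (N : ℕ) :
    ∃ n ≥ N, IsClose c (normSeminorm 𝕜 E) (normSeminorm 𝕜 (J n)) := by
  rcases (Nat.succ_le_of_lt (Module.finrank_pos (R := 𝕜) (M := E))).eq_or_lt with hE | hE
  · obtain ⟨n, hn, hN⟩ := hJ1.exists_gt N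
    exact ⟨n, hN.le, (isClose_one_of_finrank_eq_one hE.symm hn).mono hc.le⟩
  by_contra! hcon
  -- `r₀` is within `1 + ε` of the norm, and the perturbations of `r₀` within `1 + 2 ε = d`
  set d := √c with hd
  have hd1 : 1 < d := Real.lt_sqrt_of_sq_lt (by simpa using hc)
  have hdd : d * d = c := Real.mul_self_sqrt (by linarith)
  set ε := (d - 1) / 2 with hε
  have hε0 : 0 < ε := by simp only [hε]; linarith
  obtain ⟨r₀, x, y, hr1, hr2, hxy, hxy', hy⟩ := exists_segment_norm (𝕜 := 𝕜) hE hε0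
  -- a Hilbert norm on `E`
  let φ : E ≃L[𝕜] EuclideanSpace 𝕜 (Fin (Module.finrank 𝕜 E)) :=
    ContinuousLinearEquiv.ofFinrankEq (by simp)
  let q : Seminorm 𝕜 E := (normSeminorm 𝕜 _).comp φ.toLinearEquiv.toLinearMap
  have hq : ∀ v, q v = ‖φ v‖ := fun _ => rfl
  set κ := ‖(φ : E →L[𝕜] EuclideanSpace 𝕜 (Fin (Module.finrank 𝕜 E)))‖ with hκ
  set μ := ‖(φ.symm : EuclideanSpace 𝕜 (Fin (Module.finrank 𝕜 E)) →L[𝕜] E)‖ with hμ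
  have hκ0 : 0 ≤ κ := norm_nonneg _
  have hμ0 : 0 ≤ μ := norm_nonneg _
  have hq1 : ∀ v, q v ≤ κ * ‖v‖ := fun v =>
    (φ : E →L[𝕜] EuclideanSpace 𝕜 (Fin (Module.finrank 𝕜 E))).le_opNorm v
  have hq2 : ∀ v, ‖v‖ ≤ μ * q v := fun v => by
    have h := (φ.symm : EuclideanSpace 𝕜 (Fin (Module.finrank 𝕜 E)) →L[𝕜] E).le_opNorm (φ v)
    simp only [ContinuousLinearEquiv.coe_coe, ContinuousLinearEquiv.symm_apply_apply] at h
    exact h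
  -- `qt i = τᵢ q` is at most `ε / (i + 1)` times the norm, so
  -- `r i = √(r₀² + (τᵢ q)²)` tends to `r₀`
  let τ : ℕ → ℝ := fun i => ε / (κ + 1) / (i + 1)
  have hτ0 : ∀ i, 0 < τ i := fun i => by positivity
  have hτ1 : ∀ i, τ i * κ ≤ ε / (i + 1) := fun i => by
    have h1 : κ / (κ + 1) ≤ 1 := (div_le_one (by positivity)).2 (by linarith)
    calc τ i * κ = ε / (i + 1) * (κ / (κ + 1)) := by simp only [τ]; field_simp
      _ ≤ ε / (i + 1) * 1 := mul_le_mul_of_nonneg_left h1 (by positivity)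
      _ = _ := mul_one _
  let qt : ℕ → Seminorm 𝕜 E := fun i => (τ i).toNNReal • q
  have hqt : ∀ i v, qt i v = τ i * q v := fun i v => by
    change (τ i).toNNReal • q v = _
    rw [NNReal.smul_def, Real.coe_toNNReal _ (hτ0 i).le, smul_eq_mul]
  let r : ℕ → Seminorm 𝕜 E := fun i => hypotSeminorm r₀ (qt i)
  have hr0 : ∀ i v, r₀ v ≤ r i v := fun i v => le_hypotSeminorm _ _ _
  have hr_le : ∀ i v, r i v ≤ (1 + ε / (i + 1)) * r₀ v := by
    intro i v
    refine (hypotSeminorm_le _ _ v).trans ?_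
    rw [hqt]
    have h1 : τ i * q v ≤ ε / (i + 1) * r₀ v :=
      calc τ i * q v ≤ τ i * (κ * ‖v‖) := mul_le_mul_of_nonneg_left (hq1 v) (hτ0 i).le
        _ = τ i * κ * ‖v‖ := by ring
        _ ≤ ε / (i + 1) * r₀ v :=
          mul_le_mul (hτ1 i) (hr1 v) (norm_nonneg _) (by positivity)
    linarith
  have hr_le' : ∀ i v, r i v ≤ d * ‖v‖ := by
    intro i v
    refine (hypotSeminorm_le _ _ v).trans ?_
    rw [hqt]
    have h0 : ε / (i + 1) ≤ ε := div_le_self hε0.le (by linarith [(Nat.cast_nonneg i : (0:ℝ) ≤ i)])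
    have h1 : τ i * q v ≤ ε * ‖v‖ :=
      calc τ i * q v ≤ τ i * (κ * ‖v‖) := mul_le_mul_of_nonneg_left (hq1 v) (hτ0 i).le
        _ = τ i * κ * ‖v‖ := by ring
        _ ≤ ε * ‖v‖ := mul_le_mul_of_nonneg_right ((hτ1 i).trans h0) (norm_nonneg _)
    have h2 : (1 + ε) * ‖v‖ + ε * ‖v‖ = d * ‖v‖ := by rw [hε]; ring
    linarith [hr2 v]
  have hd0 : 0 < d := by linarith
  -- approximants of the perturbed norms have small index
  have hfin : ∀ i, ∃ n < N, ∀ e, 1 < e → IsClose e (r i) (normSeminorm 𝕜 (J n)) := by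
    intro i
    by_contra! hno
    have h1 : ∀ n ∈ Finset.range N, ∀ᶠ e in 𝓝[>] (1 : ℝ),
        ¬ IsClose e (r i) (normSeminorm 𝕜 (J n)) := by
      intro n hn
      obtain ⟨e, he, hne⟩ := hno n (Finset.mem_range.1 hn)
      filter_upwards [Ioc_mem_nhdsGT he] with e' he' hcl
      exact hne (hcl.mono he'.2)
    have h2 := (eventually_all_finset _).2 h1
    obtain ⟨e, he, he'⟩ := (h2.and (Ioc_mem_nhdsGT hd1)).exists
    obtain ⟨n, hn⟩ := hJ.exists_isClose (r i)
      (fun v hv => norm_le_zero_iff.1 (hv ▸ (hr1 v).trans (hr0 i v))) he'.1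
    by_cases hnN : n < N
    · exact he n (Finset.mem_range.2 hnN) hn
    · refine hcon n (not_lt.1 hnN) ?_
      have h3 : IsClose d (r i) (normSeminorm 𝕜 E) :=
        isClose_of_le (fun v => (hr1 v).trans (hr0 i v)) (hr_le' i)
      rw [← hdd]
      exact (h3.symm hd0).trans (hn.mono he'.2) hd0.le
  choose n hnN hn using hfin
  obtain ⟨k, hk⟩ := Finite.exists_infinite_fiber fun i => (⟨n i, hnN i⟩ : Fin N)
  have hk' := Set.infinite_coe_iff.1 hk
  obtain ⟨i₀, hi₀⟩ := hk'.nonempty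
  have hn0 : ∀ i, i ∈ (fun i => (⟨n i, hnN i⟩ : Fin N)) ⁻¹' {k} → n i = k := fun i hi =>
    congrArg Fin.val hi
  -- one of the perturbed norms is almost isometric to `r₀`
  have hall : ∀ e, 1 < e → IsClose e (r i₀) r₀ := by
    intro e he
    obtain ⟨s, hs1, hse⟩ : ∃ s : ℝ, 1 < s ∧ s * (s * s) ≤ e := by
      have hcont : Continuous fun s : ℝ => s * (s * s) := by fun_prop
      have h1 := (hcont.tendsto 1).eventually (eventually_le_nhds (b := e) (by simpa using he))
      have h2 : ∀ᶠ s in 𝓝[>] (1 : ℝ), s * (s * s) ≤ e := h1.filter_mono nhdsWithin_le_nhds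
      obtain ⟨s, hs, hs'⟩ := (h2.and self_mem_nhdsWithin).exists
      exact ⟨s, hs', hs⟩
    obtain ⟨M, hM⟩ := exists_nat_gt (ε / (s - 1))
    obtain ⟨i, hi, hMi⟩ := hk'.exists_gt M
    have hs0 : 0 < s := by linarith
    have hlt : 1 + ε / (i + 1) ≤ s := by
      have : (M : ℝ) < i := by exact_mod_cast hMi
      rw [div_lt_iff₀ (by linarith)] at hM
      have h1 : ε / (i + 1) ≤ s - 1 := by
        rw [div_le_iff₀ (by positivity)]
        nlinarith
      linarith
    have h1 : IsClose s (r i) r₀ := isClose_of_le (hr0 i) fun v =>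
      (hr_le i v).trans (mul_le_mul_of_nonneg_right hlt (apply_nonneg r₀ v))
    have h2 := (hn i s hs1).symm hs0
    rw [hn0 i hi] at h2
    have h3 := hn i₀ s hs1
    rw [hn0 i₀ hi₀] at h3
    exact (h3.trans (h2.trans h1 hs0.le) hs0.le).mono hse
  have hμ1 : 0 < μ := by
    by_contra h0
    have : μ = 0 := le_antisymm (not_lt.1 h0) hμ0
    have := hq2 y
    rw [‹μ = 0›, zero_mul] at this
    exact hy (norm_le_zero_iff.1 this)
  have hbd : ∀ v, τ i₀ / (d * μ) * r i₀ v ≤ qt i₀ v := by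
    intro v
    rw [hqt, div_mul_eq_mul_div, div_le_iff₀ (by positivity), mul_assoc]
    refine mul_le_mul_of_nonneg_left ?_ (hτ0 _).le
    calc r i₀ v ≤ d * ‖v‖ := hr_le' i₀ v
      _ ≤ d * (μ * q v) := mul_le_mul_of_nonneg_left (hq2 v) hd0.le
      _ = q v * (d * μ) := by ring
  have hpar : ∀ v w, r i₀ (v + w) ^ 2 + qt i₀ (v - w) ^ 2 ≤ 2 * (r i₀ v ^ 2 + r i₀ w ^ 2) := by
    intro v w
    have hpar := parallelogram_law_with_norm 𝕜 (φ v) (φ w)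
    rw [← map_add, ← map_sub, ← hq, ← hq, ← hq, ← hq] at hpar
    have h1 := map_add_le_add r₀ v w
    have h2 := pow_le_pow_left₀ (apply_nonneg r₀ _) h1 2
    simp only [r, hypotSeminorm_sq, hqt]
    have h3 := congrArg (τ i₀ ^ 2 * ·) hpar
    nlinarith [sq_nonneg (r₀ v - r₀ w)]
  obtain ⟨e, he, hne⟩ := exists_not_isClose_of_segment (div_pos (hτ0 i₀) (mul_pos hd0 hμ1)) hbd
    hpar hxy hxy' rfl ((norm_pos_iff.2 hy).trans_le (hr1 y))
  exact hne (hall e he)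

end Recurrence

/-! ### Separability of spaces of norms -/

section DenseSeq

variable {𝕜 : Type v} [RCLike 𝕜]

/-- Bounded families of seminorms on a finite dimensional space are separable for uniform
convergence on the unit ball. -/
theorem exists_dense_seq_seminorm {V : Type*} [NormedAddCommGroup V] [NormedSpace 𝕜 V]
    [FiniteDimensional 𝕜 V] {ι : Type*} [Nonempty ι] (s : ι → Seminorm 𝕜 V) {C : ℝ}
    (hC : ∀ i v, s i v ≤ C * ‖v‖) :
    ∃ f : ℕ → ι, ∀ i, ∀ δ > 0, ∃ n, ∀ v, |s i v - s (f n) v| ≤ δ * ‖v‖ := by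
  have := FiniteDimensional.proper 𝕜 V
  have hcont : ∀ i, Continuous (s i) := fun i =>
    (LipschitzWith.of_le_add_mul (Real.toNNReal C) fun v w => by
      have h1 := map_add_le_add (s i) w (v - w)
      rw [add_sub_cancel] at h1
      rw [dist_eq_norm]
      exact h1.trans (by
        gcongr
        exact (hC i _).trans (mul_le_mul_of_nonneg_right (Real.le_coe_toNNReal C)
          (norm_nonneg _)))).continuous
  let Φ : ι → C(Metric.closedBall (0 : V) 1, ℝ) := fun i =>
    ⟨fun v => s i v, (hcont i).comp continuous_subtype_val⟩
  have hne : Nonempty (Set.range Φ) := (Set.range_nonempty Φ).to_subtype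
  let g := TopologicalSpace.denseSeq (Set.range Φ)
  choose f hf using fun n => (g n).2
  refine ⟨f, fun i δ hδ => ?_⟩
  obtain ⟨n, hn⟩ := (TopologicalSpace.denseRange_denseSeq (Set.range Φ)).exists_dist_lt
    ⟨Φ i, i, rfl⟩ hδ
  refine ⟨n, fun v => ?_⟩
  rcases eq_or_ne v 0 with rfl | hv
  · simp
  have hv' : 0 < ‖v‖ := norm_pos_iff.2 hv
  let a : 𝕜 := ((‖v‖⁻¹ : ℝ) : 𝕜)
  have ha : ‖a‖ = ‖v‖⁻¹ := by rw [RCLike.norm_ofReal, abs_of_pos (inv_pos.2 hv')]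
  have hav : a • v ∈ Metric.closedBall (0 : V) 1 := by
    rw [mem_closedBall_zero_iff, norm_smul, ha, inv_mul_cancel₀ hv'.ne']
  have h1 : dist (Φ i) (Φ (f n)) < δ := by
    rw [hf n]; exact hn
  have h2 := (ContinuousMap.dist_apply_le_dist (f := Φ i) (g := Φ (f n)) ⟨a • v, hav⟩).trans h1.le
  simp only [Φ, ContinuousMap.coe_mk, Real.dist_eq, map_smul_eq_mul, ha] at h2
  rw [← mul_sub, abs_mul, abs_of_pos (inv_pos.2 hv'), inv_mul_le_iff₀ hv', mul_comm] at h2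
  exact h2

end DenseSeq

/-! ### Branches -/

section Branch

variable {𝕜 : Type v} [RCLike 𝕜] {J : ℕ → Type u} [∀ n, NormedAddCommGroup (J n)]
  [∀ n, NormedSpace 𝕜 (J n)]

open Classical in
/-- The restriction of a sequence to a set of indices: the other terms are replaced by zero. -/
noncomputable def restr (𝕜 : Type v) [RCLike 𝕜] {J : ℕ → Type u} [∀ n, NormedAddCommGroup (J n)]
    [∀ n, NormedSpace 𝕜 (J n)] (I : Set ℕ) : (∀ n, J n) →ₗ[𝕜] (∀ n, J n) where
  toFun x n := if n ∈ I then x n else 0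
  map_add' x y := by
    ext n
    by_cases h : n ∈ I <;> simp [h]
  map_smul' c x := by
    ext n
    by_cases h : n ∈ I <;> simp [h]

theorem restr_of_mem {I : Set ℕ} {n : ℕ} (h : n ∈ I) (x : ∀ n, J n) : restr 𝕜 I x n = x n :=
  if_pos h

theorem restr_of_notMem {I : Set ℕ} {n : ℕ} (h : n ∉ I) (x : ∀ n, J n) : restr 𝕜 I x n = 0 :=
  if_neg h

variable (𝕜 J) in
/-- A branch with indices below `M`: a finite set of indices and a bimonotone norm on the sum of
the corresponding spaces `Jₖ` that extends the norms of the `Jₖ`. The norm is encoded as a seminorm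
on the space of all sequences that depends only on the terms with index in `supp`. -/
structure Branch (M : ℕ) where
  supp : Finset ℕ
  lt_of_mem : ∀ k ∈ supp, k < M
  q : Seminorm 𝕜 (∀ n, J n)
  q_congr : ∀ x y, (∀ k ∈ supp, x k = y k) → q x = q y
  q_Ico : ∀ a b x, q (restr 𝕜 (Set.Ico a b) x) ≤ q x
  q_single : ∀ k ∈ supp, ∀ v, q (Pi.single k v) = ‖v‖

/-- The branch without indices. -/
def Branch.root : Branch 𝕜 J 0 where
  supp := ∅
  lt_of_mem k hk := absurd hk (Finset.notMem_empty k)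
  q := 0
  q_congr _ _ _ := rfl
  q_Ico _ _ _ := le_rfl
  q_single k hk := absurd hk (Finset.notMem_empty k)

namespace Branch

variable {M : ℕ} (B : Branch 𝕜 J M)

theorem norm_le {k : ℕ} (hk : k ∈ B.supp) (x : ∀ n, J n) : ‖x k‖ ≤ B.q x := by
  rw [← B.q_single k hk]
  convert B.q_Ico k (k + 1) x using 2
  ext n
  by_cases hn : n = k
  · subst hn
    rw [Pi.single_eq_same, restr_of_mem (Set.mem_Ico.2 ⟨le_rfl, n.lt_succ_self⟩)]
  · rw [Pi.single_eq_of_ne hn, restr_of_notMem]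
    rintro ⟨h1, h2⟩
    omega

theorem q_le_sum (x : ∀ n, J n) {s : Finset ℕ} (hs : ∀ k ∈ B.supp, k ∉ s → x k = 0) :
    B.q x ≤ ∑ k ∈ s, ‖x k‖ := by
  have h1 : B.q x = B.q (∑ k ∈ s, Pi.single k (x k)) := by
    refine B.q_congr _ _ fun k hk => ?_
    rw [Finset.sum_apply]
    by_cases hks : k ∈ s
    · rw [Finset.sum_eq_single k (fun m _ hm => Pi.single_eq_of_ne hm.symm _)
        (fun h => absurd hks h), Pi.single_eq_same]
    · rw [hs k hk hks]
      refine (Finset.sum_eq_zero fun m hm => Pi.single_eq_of_ne ?_ _).symm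
      rintro rfl
      exact hks hm
  rw [h1]
  refine (Finset.le_sum_of_subadditive B.q (map_zero B.q).le (map_add_le_add B.q) _ _).trans
    (Finset.sum_le_sum fun k _ => ?_)
  by_cases hk : k ∈ B.supp
  · exact (B.q_single k hk _).le
  · rw [B.q_congr _ 0, map_zero]
    · exact norm_nonneg _
    · intro m hm
      refine Pi.single_eq_of_ne ?_ _
      rintro rfl
      exact hk hm

/-- A seminorm on the sum of a branch and a space `F`, placed after the branch, by which the norm of
the branch can be extended: it depends only on the terms of the branch, is bounded by the given
norms on the two summands, and is monotone for the restriction to intervals. -/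
structure IsAdmissible {F : Type u} [NormedAddCommGroup F] [NormedSpace 𝕜 F]
    (s : Seminorm 𝕜 ((∀ n, J n) × F)) : Prop where
  congr : ∀ x y v, (∀ k ∈ B.supp, x k = y k) → s (x, v) = s (y, v)
  left_le : ∀ x, s (x, 0) ≤ B.q x
  right_le : ∀ v, s (0, v) ≤ ‖v‖
  Ico_le : ∀ a b x v, s (restr 𝕜 (Set.Ico a b) x, 0) ≤ s (x, v)
  Ici_le : ∀ a x v, s (restr 𝕜 (Set.Ici a) x, v) ≤ s (x, v)

variable {B} in
theorem IsAdmissible.le_add {F : Type u} [NormedAddCommGroup F] [NormedSpace 𝕜 F]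
    {s : Seminorm 𝕜 ((∀ n, J n) × F)} (h : B.IsAdmissible s) (x : ∀ n, J n) (v : F) :
    s (x, v) ≤ B.q x + ‖v‖ := by
  have : (x, v) = (x, 0) + (0, v) := by simp
  rw [this]
  exact (map_add_le_add s _ _).trans (add_le_add (h.left_le x) (h.right_le v))

theorem isAdmissible_zero {F : Type u} [NormedAddCommGroup F] [NormedSpace 𝕜 F] :
    B.IsAdmissible (0 : Seminorm 𝕜 ((∀ n, J n) × F)) where
  congr _ _ _ _ := rfl
  left_le x := apply_nonneg B.q x
  right_le v := norm_nonneg v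
  Ico_le _ _ _ _ := le_rfl
  Ici_le _ _ _ := le_rfl

/-- The extension of a branch by the index `n`, with the norm
`max (q x) ‖xₙ‖ (s (x, T xₙ))`. -/
def extend {F : Type u} [NormedAddCommGroup F] [NormedSpace 𝕜 F] {n : ℕ} (hn : M ≤ n)
    (T : J n →ₗ[𝕜] F) (hT : ∀ v, ‖T v‖ ≤ ‖v‖)
    (s : {s : Seminorm 𝕜 ((∀ n, J n) × F) // B.IsAdmissible s}) : Branch 𝕜 J (n + 1) where
  supp := insert n B.supp
  lt_of_mem k hk := by
    rcases Finset.mem_insert.1 hk with rfl | hk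
    · exact k.lt_succ_self
    · have := B.lt_of_mem k hk
      omega
  q := (B.q ⊔ (normSeminorm 𝕜 (J n)).comp (LinearMap.proj n)) ⊔
    s.1.comp (LinearMap.prod LinearMap.id (T ∘ₗ LinearMap.proj n))
  q_congr x y h := by
    have h1 := h n (Finset.mem_insert_self n _)
    have h2 : ∀ k ∈ B.supp, x k = y k := fun k hk => h k (Finset.mem_insert_of_mem hk)
    change max (max (B.q x) ‖x n‖) (s.1 (x, T (x n))) = max (max (B.q y) ‖y n‖) (s.1 (y, T (y n)))
    rw [B.q_congr x y h2, h1, s.2.congr x y _ h2]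
  q_Ico a b x := by
    change max (max (B.q _) ‖restr 𝕜 (Set.Ico a b) x n‖)
      (s.1 (restr 𝕜 (Set.Ico a b) x, T (restr 𝕜 (Set.Ico a b) x n))) ≤
        max (max (B.q x) ‖x n‖) (s.1 (x, T (x n)))
    by_cases hnI : n ∈ Set.Ico a b
    · refine max_le_max (max_le_max (B.q_Ico a b x) (by rw [restr_of_mem hnI])) ?_
      rw [restr_of_mem hnI, s.2.congr _ (restr 𝕜 (Set.Ici a) x)]
      · exact s.2.Ici_le a x _
      · intro k hk
        have h1 := B.lt_of_mem k hk
        have h2 := hnI.2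
        by_cases hka : a ≤ k
        · rw [restr_of_mem (Set.mem_Ico.2 ⟨hka, by omega⟩), restr_of_mem (Set.mem_Ici.2 hka)]
        · rw [restr_of_notMem (I := Set.Ico a b) (fun h => hka (Set.mem_Ico.1 h).1),
            restr_of_notMem (I := Set.Ici a) (fun h => hka (Set.mem_Ici.1 h))]
    · rw [restr_of_notMem hnI, map_zero, norm_zero]
      exact max_le_max (max_le_max (B.q_Ico a b x) (norm_nonneg _)) (s.2.Ico_le a b x _)
  q_single k hk v := by
    change max (max (B.q (Pi.single k v)) ‖(Pi.single k v : ∀ n, J n) n‖)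
      (s.1 (Pi.single k v, T ((Pi.single k v : ∀ n, J n) n))) = ‖v‖
    have hnB : n ∉ B.supp := fun h => absurd (B.lt_of_mem n h) (by omega)
    by_cases hkn : k = n
    · subst hkn
      have h0 : ∀ m ∈ B.supp, (Pi.single k v : ∀ n, J n) m = (0 : ∀ n, J n) m := by
        intro m hm
        refine Pi.single_eq_of_ne ?_ _
        rintro rfl
        exact hnB hm
      rw [B.q_congr _ 0 h0, map_zero, Pi.single_eq_same, s.2.congr _ 0 _ h0,
        max_eq_right (norm_nonneg v)]
      exact max_eq_left ((s.2.right_le _).trans (hT v))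
    · have hkB : k ∈ B.supp := (Finset.mem_insert.1 hk).resolve_left hkn
      rw [B.q_single k hkB, Pi.single_eq_of_ne (Ne.symm hkn), map_zero, norm_zero,
        max_eq_left (norm_nonneg v)]
      exact max_eq_left ((s.2.left_le _).trans (B.q_single k hkB v).le)

/-- Countably many admissible seminorms suffice to approximate all of them. -/
theorem exists_dense_isAdmissible [∀ n, FiniteDimensional 𝕜 (J n)] (F : Type u)
    [NormedAddCommGroup F] [NormedSpace 𝕜 F] [FiniteDimensional 𝕜 F] :
    ∃ f : ℕ → {s : Seminorm 𝕜 ((∀ n, J n) × F) // B.IsAdmissible s}, ∀ s, B.IsAdmissible s →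
      ∀ δ > 0, ∃ i, ∀ x v, |s (x, v) - (f i).1 (x, v)| ≤ δ * max (B.q x) ‖v‖ := by
  have : Nonempty {s : Seminorm 𝕜 ((∀ n, J n) × F) // B.IsAdmissible s} :=
    ⟨0, B.isAdmissible_zero⟩
  -- extension by zero from the support of the branch
  let e : (∀ k : B.supp, J k) →ₗ[𝕜] (∀ n, J n) :=
    { toFun := fun y n => if h : n ∈ B.supp then y ⟨n, h⟩ else 0
      map_add' := fun y z => by ext n; by_cases h : n ∈ B.supp <;> simp [h]
      map_smul' := fun c y => by ext n; by_cases h : n ∈ B.supp <;> simp [h] }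
  have he : ∀ y (k : ℕ) (hk : k ∈ B.supp), e y k = y ⟨k, hk⟩ := fun y k hk => dif_pos hk
  let E : ((∀ k : B.supp, J k) × F) →ₗ[𝕜] (∀ n, J n) × F := e.prodMap LinearMap.id
  obtain ⟨f, hf⟩ := exists_dense_seq_seminorm
    (fun s : {s : Seminorm 𝕜 ((∀ n, J n) × F) // B.IsAdmissible s} => s.1.comp E)
    (C := B.supp.card + 1) (fun s w => by
      obtain ⟨y, v⟩ := w
      change s.1 (e y, v) ≤ _
      refine (s.2.le_add _ _).trans ?_
      rw [add_mul, one_mul]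
      refine add_le_add ?_ (norm_snd_le (y, v))
      refine (B.q_le_sum _ (s := B.supp) fun k hk hk' => absurd hk hk').trans ?_
      rw [← nsmul_eq_mul, ← Finset.sum_const]
      refine Finset.sum_le_sum fun k hk => ?_
      rw [he y k hk]
      exact (norm_le_pi_norm y ⟨k, hk⟩).trans (norm_fst_le (y, v)))
  refine ⟨f, fun s hs δ hδ => ?_⟩
  obtain ⟨i, hi⟩ := hf ⟨s, hs⟩ δ hδ
  refine ⟨i, fun x v => ?_⟩
  let y : ∀ k : B.supp, J k := fun k => x k
  have hxy : ∀ k ∈ B.supp, x k = e y k := fun k hk => (he y k hk).symm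
  have h1 := hi (y, v)
  change |s (e y, v) - (f i).1 (e y, v)| ≤ _ at h1
  rw [← hs.congr x _ v hxy, ← (f i).2.congr x _ v hxy] at h1
  refine h1.trans (mul_le_mul_of_nonneg_left ?_ hδ.le)
  rw [Prod.norm_def]
  refine max_le_max ?_ le_rfl
  exact (pi_norm_le_iff_of_nonneg (apply_nonneg B.q x)).2 fun k => B.norm_le k.2 x

end Branch

end Branch

/-! ### The tree of branches -/

section Tree

variable {𝕜 : Type v} [RCLike 𝕜] {J : ℕ → Type u} [∀ n, NormedAddCommGroup (J n)]
  [∀ n, NormedSpace 𝕜 (J n)]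

/-- A countable family that is dense among the admissible seminorms. -/
noncomputable def Branch.denseAdmissible [∀ n, FiniteDimensional 𝕜 (J n)] {M : ℕ}
    (B : Branch 𝕜 J M) (F : Type u) [NormedAddCommGroup F] [NormedSpace 𝕜 F]
    [FiniteDimensional 𝕜 F] :
    ℕ → {s : Seminorm 𝕜 ((∀ n, J n) × F) // B.IsAdmissible s} :=
  (B.exists_dense_isAdmissible F).choose

theorem Branch.exists_denseAdmissible [∀ n, FiniteDimensional 𝕜 (J n)] {M : ℕ}
    (B : Branch 𝕜 J M) (F : Type u) [NormedAddCommGroup F] [NormedSpace 𝕜 F]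
    [FiniteDimensional 𝕜 F] {s : Seminorm 𝕜 ((∀ n, J n) × F)} (hs : B.IsAdmissible s) {δ : ℝ}
    (hδ : 0 < δ) :
    ∃ i, ∀ x v, |s (x, v) - (B.denseAdmissible F i).1 (x, v)| ≤ δ * max (B.q x) ‖v‖ :=
  (B.exists_dense_isAdmissible F).choose_spec s hs δ hδ

variable (𝕜 J) in
/-- Instructions for growing a tree of branches. Step `n` extends the branch made before step
`par n` by the index `n`; the space `Jₙ` is compared by `T n` with the space of index `target n`,
and the norm is taken from number `code n` in the list of admissible seminorms. -/
structure TreeData where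
  par : ℕ → ℕ
  par_le : ∀ n, par n ≤ n
  target : ℕ → ℕ
  code : ℕ → ℕ
  T : ∀ n, J n ≃ₗ[𝕜] J (target n)
  norm_T_le : ∀ n v, ‖T n v‖ ≤ ‖v‖

theorem DFinsupp.coe_filter_Ico (a b : ℕ) (x : Π₀ n, J n) :
    ⇑(x.filter (· ∈ Finset.Ico a b)) = restr 𝕜 (Set.Ico a b) x := by
  ext n
  rw [DFinsupp.filter_apply]
  split_ifs with h
  · exact (restr_of_mem (Set.mem_Ico.2 (Finset.mem_Ico.1 h)) _).symm
  · exact (restr_of_notMem (fun h' => h (Finset.mem_Ico.2 (Set.mem_Ico.1 h'))) _).symm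

namespace TreeData

/-- Each instruction is carried out, with each precision. -/
def Rich (D : TreeData 𝕜 J) : Prop :=
  ∀ M j i, ∀ c : ℝ, 1 < c →
    ∃ n, D.par n = M ∧ D.target n = j ∧ D.code n = i ∧ ∀ v, ‖v‖ ≤ c * ‖D.T n v‖

theorem exists_rich (h : ∀ j, ∀ c : ℝ, 1 < c → ∀ N, ∃ n ≥ N,
    IsClose c (normSeminorm 𝕜 (J n)) (normSeminorm 𝕜 (J j))) :
    ∃ D : TreeData 𝕜 J, D.Rich := by
  -- the tasks: a branch, a target, a seminorm and a precision
  let e : ℕ → ℕ × ℕ × ℕ × ℕ := Denumerable.ofNat (ℕ × ℕ × ℕ × ℕ)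
  have hfreq : ∀ t, ∃ᶠ n in atTop, (e t).1 ≤ n ∧
      IsClose (1 + 1 / ((e t).2.2.2 + 1 : ℝ)) (normSeminorm 𝕜 (J n))
        (normSeminorm 𝕜 (J (e t).2.1)) := by
    intro t
    refine frequently_atTop.2 fun N => ?_
    obtain ⟨n, hn, hc⟩ := h (e t).2.1 (1 + 1 / ((e t).2.2.2 + 1 : ℝ))
      (lt_add_of_pos_right 1 (by positivity)) (max N (e t).1)
    exact ⟨n, (le_max_left _ _).trans hn, (le_max_right _ _).trans hn, hc⟩
  obtain ⟨σ, hσ, hP⟩ := extraction_forall_of_frequently hfreq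
  have key : ∀ n, ∃ (M : ℕ) (_ : M ≤ n) (j : ℕ) (i : ℕ) (T : J n ≃ₗ[𝕜] J j),
      (∀ v, ‖T v‖ ≤ ‖v‖) ∧ ∀ t, σ t = n → M = (e t).1 ∧ j = (e t).2.1 ∧ i = (e t).2.2.1 ∧
        ∀ v, ‖v‖ ≤ (1 + 1 / ((e t).2.2.2 + 1 : ℝ)) * ‖T v‖ := by
    intro n
    by_cases hn : ∃ t, σ t = n
    · obtain ⟨t, rfl⟩ := hn
      obtain ⟨hM, T, hT⟩ := hP t
      refine ⟨(e t).1, hM, (e t).2.1, (e t).2.2.1, T, fun v => (hT v).1, fun t' ht' => ?_⟩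
      obtain rfl := hσ.injective ht'
      exact ⟨rfl, rfl, rfl, fun v => (hT v).2⟩
    -- an index without a task extends the empty branch
    · exact ⟨0, n.zero_le, n, 0, LinearEquiv.refl 𝕜 _, fun v => le_rfl,
        fun t ht => absurd ⟨t, ht⟩ hn⟩
  choose par hpar target code T hT hrich using key
  refine ⟨⟨par, hpar, target, code, T, hT⟩, fun M j i c hc => ?_⟩
  obtain ⟨l, hl⟩ := exists_nat_one_div_lt (sub_pos.2 hc)
  obtain ⟨t, ht⟩ : ∃ t, e t = (M, j, i, l) :=
    ⟨Encodable.encode (M, j, i, l), Denumerable.ofNat_encode _⟩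
  obtain ⟨h1, h2, h3, h4⟩ := hrich (σ t) t rfl
  rw [ht] at h1 h2 h3 h4
  refine ⟨σ t, h1, h2, h3, fun v => (h4 v).trans ?_⟩
  exact mul_le_mul_of_nonneg_right (by linarith) (norm_nonneg _)

variable [∀ n, FiniteDimensional 𝕜 (J n)] (D : TreeData 𝕜 J)

/-- The branch made at step `n`, with number `n + 1`; number `0` is the empty branch. -/
noncomputable def node : ∀ M, Branch 𝕜 J M
  | 0 => Branch.root
  | n + 1 => (node (D.par n)).extend (D.par_le n) (D.T n).toLinearMap (D.norm_T_le n)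
      ((node (D.par n)).denseAdmissible (J (D.target n)) (D.code n))
termination_by M => M
decreasing_by all_goals exact Nat.lt_succ_of_le (D.par_le n)

theorem node_zero : D.node 0 = Branch.root := by rw [node]

theorem node_succ (n : ℕ) : D.node (n + 1) =
    (D.node (D.par n)).extend (D.par_le n) (D.T n).toLinearMap (D.norm_T_le n)
      ((D.node (D.par n)).denseAdmissible (J (D.target n)) (D.code n)) := by rw [node]

theorem supp_node_succ (n : ℕ) :
    (D.node (n + 1)).supp = insert n (D.node (D.par n)).supp := by
  rw [node_succ]; rfl

theorem q_node_succ (n : ℕ) (x : ∀ n, J n) :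
    (D.node (n + 1)).q x = max (max ((D.node (D.par n)).q x) ‖x n‖)
      (((D.node (D.par n)).denseAdmissible (J (D.target n)) (D.code n)).1 (x, D.T n (x n))) := by
  rw [node_succ]; rfl

theorem q_par_le (n : ℕ) (x : ∀ n, J n) : (D.node (D.par n)).q x ≤ (D.node (n + 1)).q x := by
  rw [q_node_succ]
  exact (le_max_left _ _).trans (le_max_left _ _)

/-- The norm of a branch dominates the norms of the shorter branches that it extends. -/
theorem q_le_of_mem_supp {n : ℕ} (x : ∀ n, J n) (M : ℕ) (hn : n ∈ (D.node M).supp) :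
    (D.node (n + 1)).q x ≤ (D.node M).q x := by
  induction M using Nat.strong_induction_on with
  | _ M ih =>
    cases M with
    | zero =>
      rw [node_zero] at hn
      exact absurd hn (Finset.notMem_empty n)
    | succ m =>
      rw [supp_node_succ, Finset.mem_insert] at hn
      rcases hn with rfl | hn
      · exact le_rfl
      · exact (ih _ (Nat.lt_succ_of_le (D.par_le m)) hn).trans (D.q_par_le m x)

/-- On the sum of a branch, no other branch has a larger norm: the tree gives each branch
isometrically. -/
theorem q_le_q_of_supp (M : ℕ) (x : ∀ n, J n) (hx : ∀ k ∉ (D.node M).supp, x k = 0) (M' : ℕ) :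
    (D.node M').q x ≤ (D.node M).q x := by
  induction M' using Nat.strong_induction_on with
  | _ M' ih =>
    cases M' with
    | zero =>
      rw [node_zero]
      exact apply_nonneg (D.node M).q x
    | succ n =>
      by_cases hn : n ∈ (D.node M).supp
      · exact D.q_le_of_mem_supp x M hn
      · have h1 := ih _ (Nat.lt_succ_of_le (D.par_le n))
        rw [q_node_succ, hx n hn, map_zero, norm_zero]
        refine max_le (max_le h1 (apply_nonneg (D.node M).q x)) (le_trans ?_ h1)
        exact (Branch.denseAdmissible _ _ _).2.left_le x

/-! ### The space of the tree -/

theorem exists_forall_q_le (x : Π₀ n, J n) : ∃ C, ∀ M, (D.node M).q x ≤ C := by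
  classical
  exact ⟨∑ k ∈ x.support, ‖x k‖, fun M => (D.node M).q_le_sum x fun k _ hk =>
    DFinsupp.notMem_support_iff.1 hk⟩

/-- The norm of the tree: the supremum of the norms of the branches. -/
noncomputable def treeSeminorm : Seminorm 𝕜 (Π₀ n, J n) :=
  ⨆ M, (D.node M).q.comp (DFinsupp.coeFnLinearMap 𝕜)

theorem bddAbove_q : BddAbove (Set.range fun M =>
    (D.node M).q.comp (DFinsupp.coeFnLinearMap 𝕜 : (Π₀ n, J n) →ₗ[𝕜] ∀ n, J n)) := by
  rw [Seminorm.bddAbove_range_iff]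
  intro x
  obtain ⟨C, hC⟩ := D.exists_forall_q_le x
  refine ⟨C, ?_⟩
  rintro _ ⟨M, rfl⟩
  exact hC M

theorem treeSeminorm_le {x : Π₀ n, J n} {C : ℝ} (h : ∀ M, (D.node M).q x ≤ C) :
    D.treeSeminorm x ≤ C := by
  rw [treeSeminorm, Seminorm.iSup_apply D.bddAbove_q]
  exact ciSup_le h

theorem q_le_treeSeminorm (x : Π₀ n, J n) (M : ℕ) : (D.node M).q x ≤ D.treeSeminorm x := by
  obtain ⟨C, hC⟩ := D.exists_forall_q_le x
  rw [treeSeminorm, Seminorm.iSup_apply D.bddAbove_q]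
  refine le_ciSup (f := fun M => ((D.node M).q.comp (DFinsupp.coeFnLinearMap 𝕜)) x) ⟨C, ?_⟩ M
  rintro _ ⟨M, rfl⟩
  exact hC M

theorem treeSeminorm_eq (M : ℕ) (x : Π₀ n, J n) (hx : ∀ k ∉ (D.node M).supp, x k = 0) :
    D.treeSeminorm x = (D.node M).q x :=
  le_antisymm (D.treeSeminorm_le (D.q_le_q_of_supp M x hx)) (D.q_le_treeSeminorm x M)

theorem treeSeminorm_single (n : ℕ) (v : J n) : D.treeSeminorm (DFinsupp.single n v) = ‖v‖ := by
  have hn : n ∈ (D.node (n + 1)).supp := by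
    rw [supp_node_succ]
    exact Finset.mem_insert_self n _
  rw [D.treeSeminorm_eq (n + 1), ← (D.node (n + 1)).q_single n hn v, DFinsupp.single_eq_pi_single]
  intro k hk
  refine DFinsupp.single_eq_of_ne ?_
  rintro rfl
  exact hk hn

/-- The restriction to a branch is a contraction. -/
theorem treeSeminorm_filter_supp_le (M : ℕ) (x : Π₀ n, J n) :
    D.treeSeminorm (x.filter (· ∈ (D.node M).supp)) ≤ D.treeSeminorm x := by
  rw [D.treeSeminorm_eq M _ fun k hk => DFinsupp.filter_apply_neg _ hk,
    (D.node M).q_congr _ x fun k hk => DFinsupp.filter_apply_pos _ hk]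
  exact D.q_le_treeSeminorm x M

/-- The direct sum of the `Jₙ`, to be normed by the norm of the tree. -/
@[nolint unusedArguments]
def TreePre (_D : TreeData 𝕜 J) : Type u := Π₀ n, J n

instance : AddCommGroup D.TreePre := inferInstanceAs (AddCommGroup (Π₀ n, J n))

instance : Module 𝕜 D.TreePre := inferInstanceAs (Module 𝕜 (Π₀ n, J n))

noncomputable instance : SeminormedAddCommGroup D.TreePre :=
  (show AddGroupSeminorm D.TreePre from
    D.treeSeminorm.toAddGroupSeminorm).toSeminormedAddCommGroup

noncomputable instance : NormedSpace 𝕜 D.TreePre where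
  norm_smul_le c x := (map_smul_eq_mul D.treeSeminorm c x).le

/-- The identity of the direct sum of the `Jₙ`. -/
def treeEquiv : (Π₀ n, J n) ≃ₗ[𝕜] D.TreePre := LinearEquiv.refl 𝕜 (Π₀ n, J n)

theorem norm_treeEquiv (x : Π₀ n, J n) : ‖D.treeEquiv x‖ = D.treeSeminorm x := rfl

theorem isIntervalMonotone : IsIntervalMonotone D.treeEquiv := by
  intro a b x
  rw [norm_treeEquiv, norm_treeEquiv]
  refine D.treeSeminorm_le fun M => ?_
  rw [DFinsupp.coe_filter_Ico (𝕜 := 𝕜)]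
  exact ((D.node M).q_Ico a b x).trans (D.q_le_treeSeminorm x M)

theorem isBimonotoneFDD [∀ n, Nontrivial (J n)] : IsBimonotoneFDD (complTerm D.treeEquiv) :=
  D.isIntervalMonotone.isBimonotoneSystem.isBimonotoneFDD
    (fun _ => inferInstance) (complTerm_ne_bot fun n v h => by
      rwa [norm_treeEquiv, treeSeminorm_single, norm_eq_zero] at h)

theorem nonempty_isometry (n : ℕ) : Nonempty (J n ≃ₗᵢ[𝕜] complTerm D.treeEquiv n) := by
  let f : J n →ₗᵢ[𝕜] UniformSpace.Completion D.TreePre :=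
    ⟨(UniformSpace.Completion.toComplL : D.TreePre →L[𝕜] _).toLinearMap ∘ₗ
      D.treeEquiv.toLinearMap ∘ₗ DFinsupp.lsingle n, fun v => by
        change ‖((D.treeEquiv (DFinsupp.single n v) : D.TreePre) :
          UniformSpace.Completion D.TreePre)‖ = ‖v‖
        rw [UniformSpace.Completion.norm_coe, norm_treeEquiv, treeSeminorm_single]⟩
  exact ⟨f.equivRange⟩

end TreeData

end Tree

/-! ### Following a decomposition along the tree -/

section Stage

variable {𝕜 : Type v} [RCLike 𝕜] {J : ℕ → Type u} [∀ n, NormedAddCommGroup (J n)]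
  [∀ n, NormedSpace 𝕜 (J n)]

theorem restr_Ico_eq_sub {a b : ℕ} (hab : a ≤ b) (x : ∀ n, J n) :
    restr 𝕜 (Set.Ico a b) x = restr 𝕜 (Set.Iio b) x - restr 𝕜 (Set.Iio a) x := by
  ext n
  rw [Pi.sub_apply]
  by_cases ha : n < a
  · rw [restr_of_mem (I := Set.Iio b) (ha.trans_le hab), restr_of_mem (I := Set.Iio a) ha,
      restr_of_notMem (fun h => absurd (Set.mem_Ico.1 h).1 (by omega)), sub_self]
  · rw [restr_of_notMem (I := Set.Iio a) ha, sub_zero]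
    by_cases hb : n < b
    · rw [restr_of_mem (Set.mem_Ico.2 ⟨by omega, hb⟩), restr_of_mem (I := Set.Iio b) hb]
    · rw [restr_of_notMem (I := Set.Iio b) hb,
        restr_of_notMem (fun h => hb (Set.mem_Ico.1 h).2)]

theorem restr_Ici_eq_sub (a : ℕ) (x : ∀ n, J n) :
    restr 𝕜 (Set.Ici a) x = x - restr 𝕜 (Set.Iio a) x := by
  ext n
  rw [Pi.sub_apply]
  by_cases ha : n < a
  · rw [restr_of_mem (I := Set.Iio a) ha,
      restr_of_notMem (fun h => absurd (Set.mem_Ici.1 h) (by omega)), sub_self]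
  · rw [restr_of_notMem (I := Set.Iio a) ha, sub_zero, restr_of_mem (Set.mem_Ici.2 (by omega))]

variable [∀ n, FiniteDimensional 𝕜 (J n)]
  {Z : Type u} [NormedAddCommGroup Z] [NormedSpace 𝕜 Z] {H : ℕ → Submodule 𝕜 Z}

/-- The map `R` is a `C`-isomorphism from the sum of the branch number `M` onto the sum of the first
`k` terms of the decomposition `H`, and it takes initial segments to initial segments. -/
structure IsStage (D : TreeData 𝕜 J) (hH : IsBimonotoneFDD H) (k : ℕ) (C : ℝ) (M : ℕ)
    (R : (∀ n, J n) →ₗ[𝕜] Z) : Prop where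
  congr : ∀ x y, (∀ i ∈ (D.node M).supp, x i = y i) → R x = R y
  sum_proj : ∀ x, ∑ i ∈ Finset.range k, hH.projL i (R x) = R x
  cut : ∃ c : ℕ → ℕ, Monotone c ∧ (∀ a, c a ≤ k) ∧
    ∀ a x, R (restr 𝕜 (Set.Iio a) x) = ∑ i ∈ Finset.range (c a), hH.projL i (R x)
  q_le : ∀ x, (D.node M).q x ≤ C * ‖R x‖
  norm_le : ∀ x, ‖R x‖ ≤ C * (D.node M).q x

theorem isStage_zero (D : TreeData 𝕜 J) (hH : IsBimonotoneFDD H) (C : ℝ) :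
    IsStage D hH 0 C 0 0 where
  congr _ _ _ := rfl
  sum_proj x := by simp
  cut := ⟨fun _ => 0, monotone_const, fun _ => le_rfl, fun a x => by simp⟩
  q_le x := by
    rw [D.node_zero]
    simp [Branch.root]
  norm_le x := by
    rw [D.node_zero]
    simp [Branch.root]

theorem sum_projL_of_mem (hH : IsBimonotoneFDD H) {k : ℕ} {z : Z} (hz : z ∈ H k) {s : Finset ℕ}
    (hk : k ∉ s) : ∑ i ∈ s, hH.projL i z = 0 :=
  Finset.sum_eq_zero fun i hi =>
    hH.isBimonotoneSystem.apply_of_mem_ne k i (fun h => hk (h ▸ hi)) z hz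

variable {D : TreeData 𝕜 J} {hH : IsBimonotoneFDD H} {k M : ℕ} {C : ℝ}
  {R : (∀ n, J n) →ₗ[𝕜] Z}

/-- The norm of `Z`, pulled back to the sum of the branch and of a space that is mapped into the
next term of the decomposition, is admissible up to the constant of the stage. -/
theorem IsStage.exists_isAdmissible (h : IsStage D hH k C M R) (hC : 1 ≤ C) {F : Type u}
    [NormedAddCommGroup F] [NormedSpace 𝕜 F] (U : F →ₗ[𝕜] Z) (hU : ∀ v, U v ∈ H k)
    (hU' : ∀ v, ‖U v‖ ≤ ‖v‖) :
    ∃ s : Seminorm 𝕜 ((∀ n, J n) × F), (D.node M).IsAdmissible s ∧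
      ∀ x v, s (x, v) = C⁻¹ * ‖R x + U v‖ := by
  have hC0 : 0 < C := by linarith
  have hCi : 0 ≤ C⁻¹ := inv_nonneg.2 hC0.le
  obtain ⟨c, hcm, hck, hc⟩ := h.cut
  have hP : ∀ a x v, ∑ i ∈ Finset.range (c a), hH.projL i (R x + U v) =
      R (restr 𝕜 (Set.Iio a) x) := by
    intro a x v
    simp only [map_add, Finset.sum_add_distrib]
    rw [sum_projL_of_mem hH (hU v), add_zero, hc]
    rw [Finset.mem_range]
    have := hck a
    omega
  let s : Seminorm 𝕜 ((∀ n, J n) × F) :=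
    (normSeminorm 𝕜 Z).comp (((C⁻¹ : ℝ) : 𝕜) • R.coprod U)
  have hs : ∀ x v, s (x, v) = C⁻¹ * ‖R x + U v‖ := by
    intro x v
    change ‖((C⁻¹ : ℝ) : 𝕜) • (R x + U v)‖ = _
    rw [norm_smul, RCLike.norm_ofReal, abs_of_nonneg hCi]
  refine ⟨s, ⟨fun x y v hxy => ?_, fun x => ?_, fun v => ?_, fun a b x v => ?_,
    fun a x v => ?_⟩, hs⟩
  · rw [hs, hs, h.congr x y hxy]
  · rw [hs, map_zero, add_zero, inv_mul_le_iff₀ hC0]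
    exact h.norm_le x
  · rw [hs, map_zero, zero_add, inv_mul_le_iff₀ hC0]
    exact (hU' v).trans (le_mul_of_one_le_left (norm_nonneg v) hC)
  · rw [hs, hs, map_zero, add_zero]
    refine mul_le_mul_of_nonneg_left ?_ hCi
    rcases le_total a b with hab | hab
    · rw [restr_Ico_eq_sub hab, map_sub, ← hP b x v, ← hP a x v,
        ← Finset.sum_Ico_eq_sub _ (hcm hab)]
      exact hH.norm_Ico_le _ _ _
    · have h0 : restr 𝕜 (Set.Ico a b) x = 0 := by
        ext n
        exact restr_of_notMem (by simp [Set.Ico_eq_empty_of_le hab]) x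
      rw [h0, map_zero, norm_zero]
      exact norm_nonneg _
  · rw [hs, hs]
    refine mul_le_mul_of_nonneg_left ?_ hCi
    rw [restr_Ici_eq_sub, map_sub, ← hP a x v, sub_add_eq_add_sub]
    exact hH.norm_Ici_le _ _

/-- Each stage can be continued by one more term of the decomposition, with a slightly larger
constant. -/
theorem IsStage.exists_succ (hD : D.Rich)
    (hJ : ∀ (E : Type u) [NormedAddCommGroup E] [NormedSpace 𝕜 E] [FiniteDimensional 𝕜 E]
      [Nontrivial E], ∀ c : ℝ, 1 < c →
        ∃ n, IsClose c (normSeminorm 𝕜 (J n)) (normSeminorm 𝕜 E))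
    (h : IsStage D hH k C M R) {C' : ℝ} (hC : 1 ≤ C) (hCC' : C < C') (hC'1 : 3 / 2 ≤ C')
    (hC'2 : C' ≤ 2) :
    ∃ (n : ℕ) (T : J n ≃ₗ[𝕜] H k), D.par n = M ∧
      IsStage D hH (k + 1) C' (n + 1)
        (R + (H k).subtype ∘ₗ T.toLinearMap ∘ₗ LinearMap.proj n) := by
  have hfin := hH.finiteDimensional k
  have hnt : Nontrivial (H k) := Submodule.nontrivial_iff_ne_bot.2 (hH.ne_bot k)
  obtain ⟨j, U, hU⟩ := hJ (H k) (6 / 5) (by norm_num)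
  replace hU : ∀ v, ‖U v‖ ≤ ‖v‖ ∧ ‖v‖ ≤ 6 / 5 * ‖U v‖ := hU
  obtain ⟨s, hs, hsR⟩ := h.exists_isAdmissible hC ((H k).subtype ∘ₗ U.toLinearMap)
    (fun v => (U v).2) (fun v => (hU v).1)
  -- `δ` is small enough for `C (1 + δ) ≤ C'` and `1 + 2 δ ≤ C'`, and `(6 / 5) ^ 2 ≤ 3 / 2 ≤ C'`
  set δ : ℝ := (C' - C) / 4 with hδ
  have hδ0 : 0 < δ := by linarith
  obtain ⟨i, hi⟩ := (D.node M).exists_denseAdmissible (J j) hs hδ0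
  obtain ⟨n, rfl, rfl, rfl, hn⟩ := hD M j i (6 / 5) (by norm_num)
  let T : J n ≃ₗ[𝕜] H k := (D.T n).trans U
  let R' : (∀ n, J n) →ₗ[𝕜] Z := R + (H k).subtype ∘ₗ T.toLinearMap ∘ₗ LinearMap.proj n
  have hR' : ∀ x, R' x = R x + (T (x n) : Z) := fun x => rfl
  have hsup := D.supp_node_succ n
  have hlt : ∀ i ∈ (D.node (D.par n)).supp, i < n := fun i hi =>
    ((D.node (D.par n)).lt_of_mem i hi).trans_le (D.par_le n)
  have hT0 : ∀ x c, c ≤ k → ∑ i ∈ Finset.range c, hH.projL i (T x : Z) = 0 := fun x c hc =>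
    sum_projL_of_mem hH (T x).2 (by rw [Finset.mem_range]; omega)
  have hRk : ∀ x, hH.projL k (R x) = 0 := by
    intro x
    rw [← h.sum_proj x, hH.projL_apply]
    exact (hH.proj_sum _ _ (fun i => hH.proj_mem i _) k).trans (if_neg (by simp))
  have hTk : ∀ x, hH.projL k (T x : Z) = T x := fun x =>
    hH.isBimonotoneSystem.apply_of_mem k _ (T x).2
  have hsum : ∀ x, ∑ i ∈ Finset.range k, hH.projL i (R' x) = R x := by
    intro x
    rw [hR']
    simp only [map_add, Finset.sum_add_distrib]
    rw [hT0 _ k le_rfl, add_zero, h.sum_proj]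
  have hlast : ∀ x, hH.projL k (R' x) = T (x n) := by
    intro x
    rw [hR', map_add, hRk, hTk, zero_add]
  have hRle : ∀ x, ‖R x‖ ≤ ‖R' x‖ := by
    intro x
    rw [← hsum x, Finset.range_eq_Ico]
    exact hH.norm_Ico_le 0 k (R' x)
  have hTle : ∀ x, ‖(T (x n) : Z)‖ ≤ ‖R' x‖ := by
    intro x
    rw [← hlast x]
    exact hH.norm_proj_le k (R' x)
  have hDT : ∀ x : ∀ n, J n, ‖D.T n (x n)‖ ≤ 6 / 5 * ‖R' x‖ := fun x =>
    (hU _).2.trans (mul_le_mul_of_nonneg_left (hTle x) (by norm_num))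
  have hqx : ∀ x, (D.node (D.par n)).q x ≤ C * ‖R' x‖ := fun x =>
    (h.q_le x).trans (mul_le_mul_of_nonneg_left (hRle x) (by linarith))
  have hsx : ∀ x : ∀ n, J n, s (x, D.T n (x n)) = C⁻¹ * ‖R' x‖ := fun x => hsR x _
  refine ⟨n, T, rfl, ⟨fun x y hxy => ?_, fun x => ?_, ?_, fun x => ?_, fun x => ?_⟩⟩
  · change R' x = R' y
    rw [hR', hR', h.congr x y fun i hi => hxy i (by
      rw [hsup]; exact Finset.mem_insert_of_mem hi), hxy n (by
      rw [hsup]; exact Finset.mem_insert_self _ _)]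
  · change ∑ i ∈ Finset.range (k + 1), hH.projL i (R' x) = R' x
    rw [Finset.sum_range_succ, hsum, hlast, hR']
  · obtain ⟨c, hcm, hck, hc⟩ := h.cut
    refine ⟨fun a => if a ≤ n then c a else k + 1, fun a b hab => ?_, fun a => ?_, fun a x => ?_⟩
    · have h1 := hcm hab
      have h2 := hck a
      dsimp only
      split_ifs <;> omega
    · have h2 := hck a
      dsimp only
      split_ifs <;> omega
    · change R' (restr 𝕜 (Set.Iio a) x) = ∑ i ∈ Finset.range (if a ≤ n then c a else k + 1),
        hH.projL i (R' x)
      by_cases ha : a ≤ n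
      · rw [if_pos ha, hR', restr_of_notMem (I := Set.Iio a) (not_lt.2 ha), map_zero, hR', hc]
        simp only [map_add, Finset.sum_add_distrib, hT0 _ _ (hck a)]
        simp
      · rw [if_neg ha, Finset.sum_range_succ, hsum, hlast, hR',
          restr_of_mem (I := Set.Iio a) (not_le.1 ha)]
        congr 1
        refine h.congr _ _ fun i hi => restr_of_mem (I := Set.Iio a) ?_ x
        exact (hlt i hi).trans (not_le.1 ha)
  · change (D.node (n + 1)).q x ≤ C' * ‖R' x‖
    rw [D.q_node_succ]
    have h0 := norm_nonneg (R' x)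
    refine max_le (max_le ((hqx x).trans (by gcongr)) ?_) ?_
    · calc ‖x n‖ ≤ 6 / 5 * (6 / 5 * ‖R' x‖) :=
            (hn _).trans (mul_le_mul_of_nonneg_left (hDT x) (by norm_num))
        _ ≤ C' * ‖R' x‖ := by nlinarith
    · have h1 := (abs_sub_le_iff.1 (hi x (D.T n (x n)))).2
      have h2 : max ((D.node (D.par n)).q x) ‖D.T n (x n)‖ ≤ 2 * ‖R' x‖ :=
        max_le ((hqx x).trans (by gcongr; linarith)) ((hDT x).trans (by gcongr; norm_num))
      have h3 : C⁻¹ * ‖R' x‖ ≤ C * ‖R' x‖ := by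
        gcongr
        exact (inv_le_one_of_one_le₀ hC).trans hC
      rw [hsx] at h1
      have h4 := mul_le_mul_of_nonneg_left h2 hδ0.le
      rw [hδ] at h4 h1
      nlinarith [mul_nonneg (sub_nonneg.2 hCC'.le) h0]
  · change ‖R' x‖ ≤ C' * (D.node (n + 1)).q x
    have h1 := (abs_sub_le_iff.1 (hi x (D.T n (x n)))).1
    have h2 := D.q_node_succ n x
    have h3 : max ((D.node (D.par n)).q x) ‖D.T n (x n)‖ ≤ (D.node (n + 1)).q x := by
      rw [h2]
      refine le_trans ?_ (le_max_left _ _)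
      exact max_le_max le_rfl (D.norm_T_le n _)
    have h4 : ((D.node (D.par n)).denseAdmissible (J (D.target n)) (D.code n)).1
        (x, D.T n (x n)) ≤ (D.node (n + 1)).q x := by
      rw [h2]
      exact le_max_right _ _
    have hq0 := apply_nonneg (D.node (n + 1)).q x
    have hC0 : 0 < C := by linarith
    rw [hsx] at h1
    have h5 : C⁻¹ * ‖R' x‖ ≤ (1 + δ) * (D.node (n + 1)).q x := by
      have := mul_le_mul_of_nonneg_left h3 hδ0.le
      linarith
    rw [inv_mul_le_iff₀ hC0, ← mul_assoc] at h5
    refine h5.trans (mul_le_mul_of_nonneg_right ?_ hq0)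
    rw [hδ]
    nlinarith

/-- Every bimonotone decomposition follows an infinite branch of a rich tree: the first `k` terms
are mapped, with constant `2`, to the branch with indices `m 0, …, m (k - 1)`. -/
theorem TreeData.Rich.exists_branch (hD : D.Rich)
    (hJ : ∀ (E : Type u) [NormedAddCommGroup E] [NormedSpace 𝕜 E] [FiniteDimensional 𝕜 E]
      [Nontrivial E], ∀ c : ℝ, 1 < c →
        ∃ n, IsClose c (normSeminorm 𝕜 (J n)) (normSeminorm 𝕜 E))
    (hH : IsBimonotoneFDD H) :
    ∃ (m : ℕ → ℕ) (T : ∀ k, J (m k) ≃ₗ[𝕜] H k), StrictMono m ∧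
      ∀ k, ∃ M, (D.node M).supp = (Finset.range k).image m ∧ ∀ x : ∀ n, J n,
        (D.node M).q x ≤ 2 * ‖∑ i ∈ Finset.range k, (T i (x (m i)) : Z)‖ ∧
        ‖∑ i ∈ Finset.range k, (T i (x (m i)) : Z)‖ ≤ 2 * (D.node M).q x := by
  -- the constants of the stages increase from `1` towards `2`
  let c : ℕ → ℝ := fun k => 2 - 1 / (k + 1)
  have hc1 : ∀ k, 1 ≤ c k := by
    intro k
    have : (1 : ℝ) / (k + 1) ≤ 1 := by
      rw [div_le_one (by positivity)]
      linarith [Nat.cast_nonneg (α := ℝ) k]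
    change 1 ≤ 2 - 1 / ((k : ℝ) + 1)
    linarith
  have hc2 : ∀ k, c k ≤ 2 := fun k => sub_le_self _ (by positivity)
  have hc3 : ∀ k, c k < c (k + 1) := by
    intro k
    refine sub_lt_sub_left (one_div_lt_one_div_of_lt (by positivity) ?_) 2
    push_cast
    linarith
  have hc4 : ∀ k, 3 / 2 ≤ c (k + 1) := by
    intro k
    have : (1 : ℝ) / ((k + 1 : ℕ) + 1) ≤ 1 / 2 := by
      refine one_div_le_one_div_of_le (by norm_num) ?_
      push_cast
      linarith [Nat.cast_nonneg (α := ℝ) k]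
    change 3 / 2 ≤ 2 - 1 / (((k + 1 : ℕ) : ℝ) + 1)
    linarith
  let St : ℕ → Type _ := fun k =>
    {s : ℕ × ((∀ n, J n) →ₗ[𝕜] Z) // IsStage D hH k (c k) s.1 s.2}
  have step : ∀ k (s : St k), ∃ (n : ℕ) (T : J n ≃ₗ[𝕜] H k) (s' : St (k + 1)),
      D.par n = s.1.1 ∧ s'.1.1 = n + 1 ∧
        s'.1.2 = s.1.2 + (H k).subtype ∘ₗ T.toLinearMap ∘ₗ LinearMap.proj n := by
    intro k s
    obtain ⟨n, T, hn, hs⟩ := s.2.exists_succ hD hJ (hc1 k) (hc3 k) (hc4 k) (hc2 (k + 1))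
    exact ⟨n, T, ⟨(n + 1, _), hs⟩, hn, rfl, rfl⟩
  choose n T next hpar hM hR using step
  let st : ∀ k, St k := fun k => Nat.rec ⟨(0, 0), isStage_zero D hH _⟩ next k
  have hst : ∀ k, st (k + 1) = next k (st k) := fun k => rfl
  have hR' : ∀ k x, (st k).1.2 x = ∑ i ∈ Finset.range k, (T i (st i) (x (n i (st i))) : Z) := by
    intro k x
    induction k with
    | zero => rfl
    | succ k ih =>
      rw [Finset.sum_range_succ, ← ih, hst, hR]
      rfl
  refine ⟨fun k => n k (st k), fun k => T k (st k), strictMono_nat_of_lt_succ fun k => ?_,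
    fun k => ⟨(st k).1.1, ?_, fun x => ?_⟩⟩
  · have h1 := hM k (st k)
    have h2 := hpar (k + 1) (st (k + 1))
    have h3 := D.par_le (n (k + 1) (st (k + 1)))
    rw [hst] at h2 h3 ⊢
    omega
  · induction k with
    | zero =>
      change (D.node 0).supp = _
      rw [D.node_zero]
      rfl
    | succ k ih =>
      rw [hst, hM, D.supp_node_succ, hpar, ih, Finset.range_add_one, Finset.image_insert]
  · have h1 := (st k).2.q_le x
    have h2 := (st k).2.norm_le x
    rw [hR'] at h1 h2
    exact ⟨h1.trans (mul_le_mul_of_nonneg_right (hc2 k) (norm_nonneg _)),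
      h2.trans (mul_le_mul_of_nonneg_right (hc2 k) (apply_nonneg _ _))⟩

end Stage

/-! ### Universality of the space of a rich tree -/

section Universal

variable {𝕜 : Type v} [RCLike 𝕜]

/-- Uniformly bounded operators `Tₙ` converge pointwise if `Tₙ Qₖ = Tₖ` for `k ≤ n`, where the `Qₖ`
approximate the identity. -/
theorem exists_tendsto_of_bounded {Z Y : Type*} [NormedAddCommGroup Z] [NormedSpace 𝕜 Z]
    [CompleteSpace Z] [NormedAddCommGroup Y] [NormedSpace 𝕜 Y] [CompleteSpace Y]
    (T : ℕ → Z →L[𝕜] Y) {C : ℝ} (hT : ∀ n z, ‖T n z‖ ≤ C * ‖z‖) (Q : ℕ → Z → Z)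
    (hQ : ∀ z, Tendsto (fun n => Q n z) atTop (𝓝 z))
    (h : ∀ k n, k ≤ n → ∀ z, T n (Q k z) = T k z) :
    ∃ L : Z →L[𝕜] Y, ∀ z, Tendsto (fun n => T n z) atTop (𝓝 (L z)) := by
  have key : ∀ z, ∃ y, Tendsto (fun n => T n z) atTop (𝓝 y) := by
    intro z
    have hdist : ∀ k n, k ≤ n → dist (T n z) (T k z) ≤ C * ‖z - Q k z‖ := by
      intro k n hkn
      rw [dist_eq_norm, ← h k n hkn z, ← map_sub]
      exact hT n _
    refine cauchySeq_tendsto_of_complete (cauchySeq_of_le_tendsto_0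
      (fun k => C * ‖z - Q k z‖ + C * ‖z - Q k z‖) (fun n m k hn hm => ?_) ?_)
    · exact (dist_triangle_right _ _ (T k z)).trans (add_le_add (hdist k n hn) (hdist k m hm))
    · have h0 : Tendsto (fun k => C * ‖z - Q k z‖) atTop (𝓝 0) := by
        have := ((tendsto_const_nhds (x := z)).sub (hQ z)).norm.const_mul C
        simpa using this
      simpa using h0.add h0
  choose f hf using key
  exact ⟨continuousLinearMapOfTendsto T (tendsto_pi_nhds.2 hf), hf⟩

variable {J : ℕ → Type u} [∀ n, NormedAddCommGroup (J n)] [∀ n, NormedSpace 𝕜 (J n)]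
  [∀ n, FiniteDimensional 𝕜 (J n)] (D : TreeData 𝕜 J)

/-- The subspaces that belong to a branch of the tree are complemented by a contraction. -/
theorem TreeData.exists_projection [∀ n, Nontrivial (J n)] {m : ℕ → ℕ} (hm : StrictMono m)
    (hsupp : ∀ k, ∃ M, (D.node M).supp = (Finset.range k).image m) :
    ∃ P : UniformSpace.Completion D.TreePre →L[𝕜] UniformSpace.Completion D.TreePre, ‖P‖ ≤ 1 ∧
      ∀ w, Tendsto (fun N : ℕ => ∑ n ∈ Finset.range N, D.isBimonotoneFDD.toIsFDD.proj (m n) w)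
        atTop (𝓝 (P w)) := by
  let p := D.isIntervalMonotone.complProj
  have hsys := D.isIntervalMonotone.isBimonotoneSystem
  let S : ℕ → UniformSpace.Completion D.TreePre →L[𝕜] UniformSpace.Completion D.TreePre :=
    fun N => ∑ n ∈ Finset.range N, p (m n)
  have hS : ∀ N w, S N w = ∑ n ∈ Finset.range N, p (m n) w := fun N w => by
    simp only [S, FunLike.coe_sum, Finset.sum_apply]
  have hSle : ∀ N w, ‖S N w‖ ≤ 1 * ‖w‖ := by
    intro N w
    rw [one_mul]
    induction w using UniformSpace.Completion.induction_on with
    | hp => exact isClosed_le (S N).continuous.norm continuous_norm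
    | ih x =>
      obtain ⟨x, rfl⟩ := D.treeEquiv.surjective x
      obtain ⟨M, hM⟩ := hsupp N
      rw [hS, ← Finset.sum_image (f := fun n => p n (D.treeEquiv x)) hm.injective.injOn,
        D.isIntervalMonotone.sum_complProj_coe, UniformSpace.Completion.norm_coe,
        UniformSpace.Completion.norm_coe, D.norm_treeEquiv, D.norm_treeEquiv]
      simp only [← hM]
      exact D.treeSeminorm_filter_supp_le M x
  obtain ⟨P, hP⟩ := exists_tendsto_of_bounded S hSle
    (fun k w => ∑ n ∈ Finset.range (m k), p n w)
    (fun w => (hsys.tendsto_sum w).comp hm.tendsto_atTop) (by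
      intro k n hkn w
      have hproj : ∀ i, p i (∑ l ∈ Finset.range (m k), p l w) = if i < m k then p i w else 0 := by
        intro i
        have := D.isBimonotoneFDD.toIsFDD.proj_sum (Finset.range (m k)) (fun l => p l w)
          (fun l => hsys.mem l w) i
        rw [hsys.proj_eq, Finset.sum_congr rfl fun l _ => rfl] at this
        simpa only [Finset.mem_range] using this
      rw [hS, hS]
      symm
      refine (Finset.sum_congr rfl fun i hi => ?_).trans
        (Finset.sum_subset (Finset.range_mono hkn) fun i _ hi => ?_)
      · rw [hproj, if_pos (hm (Finset.mem_range.1 hi))]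
      · rw [hproj, if_neg (by rw [hm.lt_iff_lt]; simpa using hi)])
  refine ⟨P, P.opNorm_le_bound zero_le_one fun w => ?_, fun w => ?_⟩
  · exact le_of_tendsto (hP w).norm (Eventually.of_forall fun N => hSle N w)
  · simp only [hsys.proj_eq]
    simpa only [hS] using hP w

/-- A decomposition that follows a branch of the tree is embedded onto the subspaces that belong to
the branch. -/
theorem TreeData.exists_embedding {Z : Type u} [NormedAddCommGroup Z] [NormedSpace 𝕜 Z]
    [CompleteSpace Z] {H : ℕ → Submodule 𝕜 Z} (hH : IsBimonotoneFDD H) {m : ℕ → ℕ}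
    (hm : StrictMono m) (T : ∀ k, J (m k) ≃ₗ[𝕜] H k)
    (hT : ∀ k, ∃ M, (D.node M).supp = (Finset.range k).image m ∧ ∀ x : ∀ n, J n,
        (D.node M).q x ≤ 2 * ‖∑ i ∈ Finset.range k, (T i (x (m i)) : Z)‖ ∧
        ‖∑ i ∈ Finset.range k, (T i (x (m i)) : Z)‖ ≤ 2 * (D.node M).q x) :
    ∃ A : Z →L[𝕜] UniformSpace.Completion D.TreePre,
      (∀ n, (H n).map (A : Z →ₗ[𝕜] _) = complTerm D.treeEquiv (m n)) ∧
      (∀ z, 1 / 2 * ‖z‖ ≤ ‖A z‖ ∧ ‖A z‖ ≤ 2 * ‖z‖) ∧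
      LinearMap.range (A : Z →ₗ[𝕜] _) =
        (⨆ n, complTerm D.treeEquiv (m n)).topologicalClosure := by
  -- the `N`-th approximation of the embedding is the inverse of the stage map on the sum of the
  -- first `N` terms
  let pc : ∀ i, Z →ₗ[𝕜] H i := fun i =>
    (hH.projL i).toLinearMap.codRestrict (H i) (hH.proj_mem i)
  let B : ℕ → Z →ₗ[𝕜] Π₀ n, J n := fun N =>
    ∑ i ∈ Finset.range N, DFinsupp.lsingle (m i) ∘ₗ (T i).symm.toLinearMap ∘ₗ pc i
  have hB : ∀ N z, B N z =
      ∑ i ∈ Finset.range N, DFinsupp.single (m i) ((T i).symm (pc i z)) := by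
    intro N z
    simp only [B, LinearMap.sum_apply]
    rfl
  have hBm : ∀ N z, ∀ i ∈ Finset.range N, B N z (m i) = (T i).symm (pc i z) := by
    intro N z i hi
    rw [hB, DFinsupp.finsetSum_apply, Finset.sum_eq_single i, DFinsupp.single_eq_same]
    · intro l _ hl
      exact DFinsupp.single_eq_of_ne fun h => hl (hm.injective h).symm
    · exact fun h => absurd hi h
  have hB0 : ∀ N z, ∀ k ∉ (Finset.range N).image m, B N z k = 0 := by
    intro N z k hk
    rw [hB, DFinsupp.finsetSum_apply]
    refine Finset.sum_eq_zero fun i hi => DFinsupp.single_eq_of_ne ?_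
    rintro rfl
    exact hk (Finset.mem_image_of_mem m hi)
  have hnorm : ∀ N z,
      D.treeSeminorm (B N z) ≤ 2 * ‖∑ i ∈ Finset.range N, hH.toIsFDD.proj i z‖ ∧
      ‖∑ i ∈ Finset.range N, hH.toIsFDD.proj i z‖ ≤ 2 * D.treeSeminorm (B N z) := by
    intro N z
    obtain ⟨M, hM, hq⟩ := hT N
    have h1 : ∑ i ∈ Finset.range N, (T i (B N z (m i)) : Z) =
        ∑ i ∈ Finset.range N, hH.toIsFDD.proj i z := by
      refine Finset.sum_congr rfl fun i hi => ?_
      rw [hBm N z i hi, LinearEquiv.apply_symm_apply]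
      rfl
    have h2 := hq (B N z)
    rw [h1] at h2
    rwa [D.treeSeminorm_eq M _ fun k hk => hB0 N z k (hM ▸ hk)]
  have hSle : ∀ N z, ‖∑ i ∈ Finset.range N, hH.toIsFDD.proj i z‖ ≤ ‖z‖ := by
    intro N z
    rw [Finset.range_eq_Ico]
    exact hH.norm_Ico_le 0 N z
  let A' : ℕ → Z →L[𝕜] UniformSpace.Completion D.TreePre := fun N =>
    LinearMap.mkContinuous
      ((UniformSpace.Completion.toComplL : D.TreePre →L[𝕜] _).toLinearMap ∘ₗ
        D.treeEquiv.toLinearMap ∘ₗ B N) 2 (fun z => by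
          change ‖((D.treeEquiv (B N z) : D.TreePre) : UniformSpace.Completion D.TreePre)‖ ≤ _
          rw [UniformSpace.Completion.norm_coe, D.norm_treeEquiv]
          exact (hnorm N z).1.trans (mul_le_mul_of_nonneg_left (hSle N z) zero_le_two))
  have hA' : ∀ N z, A' N z = ((D.treeEquiv (B N z) : D.TreePre) : UniformSpace.Completion _) :=
    fun N z => rfl
  have hA'norm : ∀ N z, ‖A' N z‖ = D.treeSeminorm (B N z) := by
    intro N z
    rw [hA', UniformSpace.Completion.norm_coe, D.norm_treeEquiv]
  have hpc : ∀ k i z, pc i (∑ l ∈ Finset.range k, hH.toIsFDD.proj l z) =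
      if i < k then pc i z else 0 := by
    intro k i z
    have := hH.toIsFDD.proj_sum (Finset.range k) (fun l => hH.toIsFDD.proj l z)
      (fun l => hH.toIsFDD.proj_mem l z) i
    simp only [Finset.mem_range] at this
    split_ifs at this ⊢ with hik
    · exact Subtype.ext this
    · exact Subtype.ext this
  obtain ⟨A, hA⟩ := exists_tendsto_of_bounded A'
    (fun N z => by
      rw [hA'norm]
      exact (hnorm N z).1.trans (mul_le_mul_of_nonneg_left (hSle N z) zero_le_two))
    (fun k z => ∑ i ∈ Finset.range k, hH.toIsFDD.proj i z)
    (fun z => hH.toIsFDD.tendsto_sum_proj z) (by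
      intro k n hkn z
      have : B n (∑ i ∈ Finset.range k, hH.toIsFDD.proj i z) = B k z := by
        rw [hB, hB]
        symm
        refine (Finset.sum_congr rfl fun i hi => ?_).trans
          (Finset.sum_subset (Finset.range_mono hkn) fun i _ hi => ?_)
        · rw [hpc, if_pos (Finset.mem_range.1 hi)]
        · rw [hpc, if_neg (by simpa using hi), map_zero, DFinsupp.single_zero]
      rw [hA', hA', this])
  have hAz : ∀ k, ∀ z (hz : z ∈ H k), A z =
      ((D.treeEquiv (DFinsupp.single (m k) ((T k).symm ⟨z, hz⟩)) : D.TreePre) :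
        UniformSpace.Completion D.TreePre) := by
    intro k z hz
    refine tendsto_nhds_unique (hA z) (tendsto_const_nhds.congr' ?_)
    filter_upwards [eventually_gt_atTop k] with N hN
    rw [hA', hB, Finset.sum_eq_single k]
    · congr 4
      exact Subtype.ext ((hH.toIsFDD.proj_of_mem hz k).trans (if_pos rfl)).symm
    · intro i _ hi
      have : pc i z = 0 := Subtype.ext ((hH.toIsFDD.proj_of_mem hz i).trans (if_neg hi))
      rw [this, map_zero, DFinsupp.single_zero]
    · exact fun h => absurd (Finset.mem_range.2 hN) h
  have hmap : ∀ n, (H n).map (A : Z →ₗ[𝕜] _) = complTerm D.treeEquiv (m n) := by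
    intro n
    ext w
    rw [Submodule.mem_map, mem_complTerm]
    constructor
    · rintro ⟨z, hz, rfl⟩
      exact ⟨_, hAz n z hz⟩
    · rintro ⟨v, rfl⟩
      refine ⟨T n v, (T n v).2, ?_⟩
      have := hAz n (T n v) (T n v).2
      rwa [Subtype.coe_eta, LinearEquiv.symm_apply_apply] at this
  have hbd : ∀ z, 1 / 2 * ‖z‖ ≤ ‖A z‖ ∧ ‖A z‖ ≤ 2 * ‖z‖ := by
    intro z
    have h1 := (hH.toIsFDD.tendsto_sum_proj z).norm
    refine ⟨le_of_tendsto_of_tendsto' (h1.const_mul (1 / 2)) (hA z).norm fun N => ?_,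
      le_of_tendsto_of_tendsto' (hA z).norm (h1.const_mul 2) fun N => ?_⟩
    · rw [hA'norm]
      linarith [(hnorm N z).2]
    · rw [hA'norm]
      exact (hnorm N z).1
  refine ⟨A, hmap, hbd, le_antisymm ?_ ?_⟩
  · rintro _ ⟨z, rfl⟩
    refine mem_closure_of_tendsto (hA z) (Eventually.of_forall fun N => ?_)
    rw [hA', hB]
    have : ∀ s : Finset ℕ, ((D.treeEquiv (∑ i ∈ s,
        DFinsupp.single (m i) ((T i).symm (pc i z))) : D.TreePre) :
          UniformSpace.Completion D.TreePre) =
        ∑ i ∈ s, ((D.treeEquiv (DFinsupp.single (m i) ((T i).symm (pc i z))) : D.TreePre) :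
          UniformSpace.Completion D.TreePre) := fun s => by
      rw [map_sum]
      exact map_sum (UniformSpace.Completion.toComplL : D.TreePre →L[𝕜] _) _ _
    rw [this]
    exact Submodule.sum_mem _ fun i _ =>
      Submodule.mem_iSup_of_mem (p := fun n => complTerm D.treeEquiv (m n)) i
        (mem_complTerm.2 ⟨_, rfl⟩)
  · refine Submodule.topologicalClosure_minimal _ (iSup_le fun n => ?_) ?_
    · rw [← hmap n]
      exact LinearMap.map_le_range
    · have hanti : AntilipschitzWith 2 A := A.antilipschitz_of_bound fun z => by
        have := (hbd z).1
        push_cast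
        linarith
      exact hanti.isClosed_range A.uniformContinuous

/-- The space of a rich tree is complementably universal. -/
theorem TreeData.Rich.isSchechtmanSpace [∀ n, Nontrivial (J n)] {D : TreeData 𝕜 J} (hD : D.Rich)
    (hJ : ∀ (E : Type u) [NormedAddCommGroup E] [NormedSpace 𝕜 E] [FiniteDimensional 𝕜 E]
      [Nontrivial E], ∀ c : ℝ, 1 < c →
        ∃ n, IsClose c (normSeminorm 𝕜 (J n)) (normSeminorm 𝕜 E)) :
    IsSchechtmanSpace 𝕜 J (complTerm D.treeEquiv) where
  isBimonotoneFDD := D.isBimonotoneFDD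
  isometric := D.nonempty_isometry
  universal Z _ _ _ H hH := by
    obtain ⟨m, T, hm, hT⟩ := hD.exists_branch hJ hH
    obtain ⟨A, h1, h2, h3⟩ := D.exists_embedding hH hm T hT
    obtain ⟨P, h4, h5⟩ := D.exists_projection hm fun k => (hT k).imp fun M h => h.1
    exact ⟨m, A, P, hm, h1, h2, h3, h4, h5⟩

end Universal

/-! ### The press down spaces of complementably universal spaces -/

theorem exists_isSchechtmanSpace {𝕜 : Type v} [RCLike 𝕜] {J : ℕ → Type u}
    [∀ n, NormedAddCommGroup (J n)] [∀ n, NormedSpace 𝕜 (J n)]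
    [∀ n, FiniteDimensional 𝕜 (J n)] [∀ n, Nontrivial (J n)]
    (hJ : IsBanachMazurDense 𝕜 J) (hJ1 : {n | Module.finrank 𝕜 (J n) = 1}.Infinite) :
    ∃ (W : Type u) (_ : NormedAddCommGroup W) (_ : NormedSpace 𝕜 W) (_ : CompleteSpace W)
      (K : ℕ → Submodule 𝕜 W), IsSchechtmanSpace 𝕜 J K := by
  obtain ⟨D, hD⟩ := TreeData.exists_rich fun j c hc N => by
    obtain ⟨n, hn, h⟩ := hJ.frequently_isClose hJ1 (E := J j) hc N
    exact ⟨n, hn, h.symm (by linarith)⟩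
  refine ⟨UniformSpace.Completion D.TreePre, inferInstance, inferInstance, inferInstance, _,
    hD.isSchechtmanSpace fun E _ _ _ _ c hc => ?_⟩
  obtain ⟨n, -, h⟩ := hJ.frequently_isClose hJ1 (E := E) hc 0
  exact ⟨n, h.symm (by linarith)⟩

theorem mainTheorem7 {𝕜 : Type v} [RCLike 𝕜] (p : ℝ≥0∞) [Fact (1 ≤ p)] (hp : 1 < p)
    (J : ℕ → Type u) [∀ n, NormedAddCommGroup (J n)] [∀ n, NormedSpace 𝕜 (J n)]
    [∀ n, FiniteDimensional 𝕜 (J n)] [∀ n, Nontrivial (J n)]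
    (hJ : IsBanachMazurDense 𝕜 J) (hJ1 : {n | Module.finrank 𝕜 (J n) = 1}.Infinite) :
    (∃ (W : Type u) (_ : NormedAddCommGroup W) (_ : NormedSpace 𝕜 W) (_ : CompleteSpace W)
      (K : ℕ → Submodule 𝕜 W), IsSchechtmanSpace 𝕜 J K) ∧
    ∀ (W : Type u) [NormedAddCommGroup W] [NormedSpace 𝕜 W] [CompleteSpace W]
      (K : ℕ → Submodule 𝕜 W), IsSchechtmanSpace 𝕜 J K →
      (p ≠ ∞ → Nonempty (lp (fun _ : ℕ => PressDown p K) p ≃L[𝕜] PressDown p K)) ∧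
      (p = ∞ → Nonempty (C₀(ℕ, PressDown p K) ≃L[𝕜] PressDown p K)) := by
  refine ⟨exists_isSchechtmanSpace hJ hJ1, fun W _ _ _ K hK =>
    ⟨fun hp => hK.nonempty_equiv_pressDown (isSeqSum_lp hp), ?_⟩⟩
  rintro rfl
  obtain ⟨ι, π, h⟩ := exists_isSeqSum_cZero (𝕜 := 𝕜) (X := PressDown ∞ K)
  exact hK.nonempty_equiv_pressDown h
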